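/- Let $\Sigma$ be a smooth oriented surface and let $r:\Sigma\to\mathbb R^4$ be a smooth immersion. By a conformal parameter $z\in W$ we mean an open set $W\subset\mathbb C$ together with a smooth orientation-preserving map $\sigma:W\to\Sigma$ such that the metric induced on $W$ by $x=r\circ\sigma$ has the form $e^{2\alpha}\,dz\,d\bar z$ (then $\sigma$ is a local diffeomorphism; it need not be injective). Write $\partial=\partial/\partial z$, $\bar\partial=\partial/\partial\bar z$. Then: (1) Every point of $\Sigma$ lies in the image of a conformal parameter $\sigma:W\to\Sigma$ with $W$ simply connected, $\sigma$ injective and $\sigma(W)$ open. (2) For every conformal parameter $\sigma:W\to\Sigma$ the surface $x=r\circ\sigma=(x^1,x^2,x^3,x^4)$ has a Weierstrass representation on $W$: there are smooth functions $\psi=(\psi_1,\psi_2):W\to\mathbb C^2$, $\varphi=(\varphi_1,\varphi_2):W\to\mathbb C^2$ and $U:W\to\mathbb C$ with $$\mathcal D\psi=0,\qquad \mathcal D^\vee\varphi=0,$$ $$\mathcal D=\begin{pmatrix}0&\partial\\-\bar\partial&0\end{pmatrix}+\begin{pmatrix}U&0\\0&\bar U\end{pmatrix},\qquad \mathcal D^\vee=\begin{pmatrix}0&\partial\\-\bar\partial&0\end{pmatrix}+\begin{pmatrix}\bar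 U&0\\0&U\end{pmatrix},$$ such that $$x^k(b)=x^k(a)+\int_\gamma\left(f_k\,dz+\bar f_k\,d\bar z\right),\qquad k=1,2,3,4,$$ for every $C^1$ path $\gamma$ in $W$ from $a$ to $b$, where $$f_1=\tfrac i2(\bar\varphi_2\bar\psi_2+\varphi_1\psi_1),\quad f_2=\tfrac12(\bar\varphi_2\bar\psi_2-\varphi_1\psi_1),\quad f_3=\tfrac12(\bar\varphi_2\psi_1+\varphi_1\bar\psi_2),\quad f_4=\tfrac i2(\bar\varphi_2\psi_1-\varphi_1\bar\psi_2).$$ Moreover $e^{2\alpha}=(|\psi_1|^2+|\psi_2|^2)(|\varphi_1|^2+|\varphi_2|^2)$ and $|U|=\tfrac12|\mathbf H|e^{\alpha}$, where $\mathbf H=2x_{z\bar z}/e^{2\alpha}$ is the mean curvature vector. -/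

import Mathlib

open Set
open scoped Manifold ContDiff ComplexConjugate Topology

noncomputable section

/-- The Wirtinger derivative `∂f/∂z = (f_x - i f_y) / 2`. -/
def wirtD (f : ℂ → ℂ) (z : ℂ) : ℂ :=
  (fderiv ℝ f z 1 - Complex.I * fderiv ℝ f z Complex.I) / 2

/-- The Wirtinger derivative `∂f/∂z̄ = (f_x + i f_y) / 2`. -/
def wirtDbar (f : ℂ → ℂ) (z : ℂ) : ℂ :=
  (fderiv ℝ f z 1 + Complex.I * fderiv ℝ f z Complex.I) / 2

/-- The Dirac operator `𝒟 = (0, ∂; -∂̄, 0) + diag(U, Ū)` with complex potential `U`, acting on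
`ψ = (ψ₁, ψ₂)` (the components `ψ₁, ψ₂` are `ψ · 0, ψ · 1`). -/
def diracOp (U : ℂ → ℂ) (ψ : ℂ → Fin 2 → ℂ) (z : ℂ) : Fin 2 → ℂ :=
  ![wirtD (fun w => ψ w 1) z + U z * ψ z 0,
    -wirtDbar (fun w => ψ w 0) z + conj (U z) * ψ z 1]

/-- The operator `𝒟^∨ = (0, ∂; -∂̄, 0) + diag(Ū, U)`. -/
def diracOpDual (U : ℂ → ℂ) (φ : ℂ → Fin 2 → ℂ) (z : ℂ) : Fin 2 → ℂ :=
  ![wirtD (fun w => φ w 1) z + conj (U z) * φ z 0,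
    -wirtDbar (fun w => φ w 0) z + U z * φ z 1]

/-- The functions `f₁, f₂, f₃, f₄` of the Weierstrass representation. -/
def weierstrassCoeff (ψ φ : ℂ → Fin 2 → ℂ) (z : ℂ) : Fin 4 → ℂ :=
  ![Complex.I / 2 * (conj (φ z 1) * conj (ψ z 1) + φ z 0 * ψ z 0),
    1 / 2 * (conj (φ z 1) * conj (ψ z 1) - φ z 0 * ψ z 0),
    1 / 2 * (conj (φ z 1) * ψ z 0 + φ z 0 * conj (ψ z 1)),
    Complex.I / 2 * (conj (φ z 1) * ψ z 0 - φ z 0 * conj (ψ z 1))]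

/-- The `1`-form `η_k = f_k dz + f̄_k dz̄`. -/
def weierstrassForm (ψ φ : ℂ → Fin 2 → ℂ) (k : Fin 4) (z : ℂ) : ℂ →L[ℝ] ℂ :=
  weierstrassCoeff ψ φ z k • ContinuousLinearMap.id ℝ ℂ
    + conj (weierstrassCoeff ψ φ z k) • Complex.conjCLE.toContinuousLinearMap

/-- `X : W → ℝ⁴` is given on the open set `W ⊆ ℂ` by the Weierstrass formulas with smooth spinors
`ψ, φ` and smooth complex potential `U`: the Dirac equations `𝒟ψ = 0`, `𝒟^∨φ = 0` hold on `W`, and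
`x^k(b) = x^k(a) + ∫_γ η_k` for every `C¹` path `γ` in `W` from `a` to `b`. -/
structure IsWeierstrassRepresentation (W : Set ℂ) (X : ℂ → EuclideanSpace ℝ (Fin 4))
    (ψ φ : ℂ → Fin 2 → ℂ) (U : ℂ → ℂ) : Prop where
  smooth_psi : ContDiffOn ℝ ∞ ψ W
  smooth_phi : ContDiffOn ℝ ∞ φ W
  smooth_potential : ContDiffOn ℝ ∞ U W
  dirac : ∀ z ∈ W, diracOp U ψ z = 0
  dirac_dual : ∀ z ∈ W, diracOpDual U φ z = 0
  integral : ∀ (a b : ℂ) (γ : Path a b), (∀ t, γ t ∈ W) →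
    ContDiffOn ℝ 1 γ.extend (Icc 0 1) → ∀ k : Fin 4,
      ((X b k : ℝ) : ℂ) = ((X a k : ℝ) : ℂ) + curveIntegral (weierstrassForm ψ φ k) γ

/-- The factor `e^{2α}` in the induced metric `e^{2α} dz dz̄` of a conformal immersion `X`,
that is `⟨X_x, X_x⟩ = |X_x|²`. -/
def conformalFactor (X : ℂ → EuclideanSpace ℝ (Fin 4)) (z : ℂ) : ℝ :=
  ‖fderiv ℝ X z 1‖ ^ 2

/-- The mean curvature vector `H = 2 X_{z z̄} / e^{2α}` of a conformal immersion `X`. Its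
coordinates are real; it is written as a vector of `ℂ⁴`. -/
def meanCurvatureVector (X : ℂ → EuclideanSpace ℝ (Fin 4)) (z : ℂ) : EuclideanSpace ℂ (Fin 4) :=
  WithLp.toLp 2 fun k =>
    2 * wirtD (wirtDbar fun w => ((X w k : ℝ) : ℂ)) z / (conformalFactor X z : ℂ)

/-- The given atlas of a surface `S` modelled on `ℝ² = ℂ` is oriented: all transition maps
have positive Jacobian. -/
def IsOrientedAtlas (S : Type*) [TopologicalSpace S] [ChartedSpace ℂ S] : Prop :=
  ∀ e ∈ atlas ℂ S, ∀ e' ∈ atlas ℂ S, ∀ x ∈ (e.symm.trans e').source,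
    0 < (fderiv ℝ (e.symm.trans e') x).det

/-- `σ : W → S` introduces a conformal parameter `z ∈ W` on the oriented surface `S` immersed by
`r : S → ℝ⁴`: `W ⊆ ℂ` is open, `σ` is smooth on `W` and preserves orientation, and the metric
induced by `r ∘ σ` on `W` is conformal to `dz dz̄`. (So `σ` is a local diffeomorphism; it need not
be injective, which covers parameters on a covering of a part of `S`.) -/
structure IsConformalParameter {S : Type*} [TopologicalSpace S] [ChartedSpace ℂ S]
    (r : S → EuclideanSpace ℝ (Fin 4)) (W : Set ℂ) (σ : ℂ → S) : Prop where
  isOpen : IsOpen W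
  smooth : ContMDiffOn 𝓘(ℝ, ℂ) 𝓘(ℝ, ℂ) ∞ σ W
  orientation : ∀ z ∈ W, ∀ e ∈ atlas ℂ S, σ z ∈ e.source → 0 < (fderiv ℝ (e ∘ σ) z).det
  conformal : ∀ z ∈ W, ConformalAt (r ∘ σ) z

end

/-! Representation. In the numbering of the statement put `f_k = ∂x^k`. Conformality says `Σ f_k² =
0`, that is, the matrix with rows `(a, b) = (-f₂ - i f₁, f₃ + i f₄)` and `(c, d) = (f₃ - i f₄, f₂ -
i f₁)` has determinant zero; since `x` is immersed, it has rank one. A factorization `a = u₁v₁, b =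
u₁v₂, c = u₂v₁, d = u₂v₂` gives the formulas for `f_k` with `ψ = (v₁, v̄₂)` and `φ = (u₁, ū₂)`. It
is unique up to `(u, v) ↦ (u/ρ, ρv)` with `ρ` nowhere zero. The equation `𝒟ψ = 0` reads `∂̄v = Ū
(v̄₂, -v̄₁)`, and some `U` satisfies it exactly when `∂̄v` is orthogonal to `v`. For `v = e^h w`
this is an equation `∂̄h = g`. The equation `𝒟^∨φ = 0` with the same `U` then follows because
`∂̄∂x^k` is real (`exists_dirac_factorization`). The formula for `e^{2α}` is `2 Σ |f_k|² =
|u|²|v|²`; the formula for `|U|` comes from evaluating `Σ (∂̄f_k)²` through the derivative of the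
matrix.

Two facts are needed on an arbitrary open `W`, simply connected or not. The equation `∂̄h = g` is
solvable (`exists_wirtDbar_eq`): the Cauchy transform handles compact support, and a Mittag-Leffler
argument the general case. And the line spanned by the rows has a smooth nowhere zero section
(`exists_nonvanishing_section`): a generic combination of the rows has only nondegenerate zeros, by
Sard; multiplying it by the conjugate of a function with the same zeros and the same local degrees
makes every degree zero, and the zeros can be perturbed away.

Conformal parameters. In a chart the induced metric is `λ|dz + μ dz̄|²` with `|μ| < 1`. If `∂̄f = μ
∂f` and `∂f ≠ 0`, then `df = ∂f (dz + μ dz̄)`, so the local inverse of `f` is conformal and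
preserves orientation (`exists_conformal_reparametrization`). The Beltrami equation is solved
locally (`exists_beltrami`) by making `μ` vanish at the point with a linear change of variable,
zooming in until `μ` is small, and solving a Neumann equation for the Fourier coefficients of `∂̄f`.
-/

/-! ### Wirtinger calculus. -/

section Wirtinger

variable {f g : ℂ → ℂ} {z : ℂ} {W : Set ℂ}

theorem fderiv_apply_eq_wirtD (f : ℂ → ℂ) (z v : ℂ) :
    fderiv ℝ f z v = wirtD f z * v + wirtDbar f z * conj v := by
  have h : v = v.re • (1 : ℂ) + v.im • Complex.I := by
    simp [Complex.re_add_im]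
  have h2 : fderiv ℝ f z v = v.re * fderiv ℝ f z 1 + v.im * fderiv ℝ f z Complex.I := by
    conv_lhs => rw [h]
    rw [map_add, map_smul, map_smul, Complex.real_smul, Complex.real_smul]
  have h3 : conj v = v.re - v.im * Complex.I :=
    Complex.ext (by simp) (by simp)
  rw [h2, h3, wirtD, wirtDbar]
  generalize hA : fderiv ℝ f z 1 = A
  generalize hB : fderiv ℝ f z Complex.I = B
  conv_rhs => enter [1, 2]; rw [← Complex.re_add_im v]
  linear_combination (v.im * B : ℂ) * Complex.I_sq

/-- The coefficients of a real linear map `v ↦ a v + b v̄` are unique. This and the next lemma serve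
as the chain rule: the differential of a composite is computed once and both coefficients are read
off. -/
theorem wirtD_eq_of_fderiv {a b : ℂ} (h : ∀ v, fderiv ℝ f z v = a * v + b * conj v) :
    wirtD f z = a := by
  rw [wirtD, h, h]
  simp only [map_one, Complex.conj_I]
  linear_combination (-a/2 + b / 2) * Complex.I_sq

theorem wirtDbar_eq_of_fderiv {a b : ℂ} (h : ∀ v, fderiv ℝ f z v = a * v + b * conj v) :
    wirtDbar f z = b := by
  rw [wirtDbar, h, h]
  simp only [map_one, Complex.conj_I]
  linear_combination (a/2 - b / 2) * Complex.I_sq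

theorem wirtD_congr (h : f =ᶠ[𝓝 z] g) : wirtD f z = wirtD g z := by
  simp only [wirtD, h.fderiv_eq]

theorem wirtDbar_congr (h : f =ᶠ[𝓝 z] g) : wirtDbar f z = wirtDbar g z := by
  simp only [wirtDbar, h.fderiv_eq]

theorem wirtD_const (c : ℂ) : wirtD (fun _ => c) z = 0 := by simp [wirtD]

theorem wirtDbar_const (c : ℂ) : wirtDbar (fun _ => c) z = 0 := by simp [wirtDbar]

theorem wirtD_add (hf : DifferentiableAt ℝ f z) (hg : DifferentiableAt ℝ g z) :
    wirtD (fun w => f w + g w) z = wirtD f z + wirtD g z := by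
  simp only [wirtD, fderiv_fun_add hf hg, add_apply]; ring

theorem wirtDbar_add (hf : DifferentiableAt ℝ f z) (hg : DifferentiableAt ℝ g z) :
    wirtDbar (fun w => f w + g w) z = wirtDbar f z + wirtDbar g z := by
  simp only [wirtDbar, fderiv_fun_add hf hg, add_apply]; ring

theorem wirtD_sub (hf : DifferentiableAt ℝ f z) (hg : DifferentiableAt ℝ g z) :
    wirtD (fun w => f w - g w) z = wirtD f z - wirtD g z := by
  simp only [wirtD, fderiv_fun_sub hf hg, sub_apply]; ring

theorem wirtDbar_sub (hf : DifferentiableAt ℝ f z) (hg : DifferentiableAt ℝ g z) :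
    wirtDbar (fun w => f w - g w) z = wirtDbar f z - wirtDbar g z := by
  simp only [wirtDbar, fderiv_fun_sub hf hg, sub_apply]; ring

theorem wirtD_mul (hf : DifferentiableAt ℝ f z) (hg : DifferentiableAt ℝ g z) :
    wirtD (fun w => f w * g w) z = wirtD f z * g z + f z * wirtD g z := by
  simp only [wirtD, fderiv_fun_mul hf hg, add_apply, smul_apply, smul_eq_mul]; ring

theorem wirtDbar_mul (hf : DifferentiableAt ℝ f z) (hg : DifferentiableAt ℝ g z) :
    wirtDbar (fun w => f w * g w) z = wirtDbar f z * g z + f z * wirtDbar g z := by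
  simp only [wirtDbar, fderiv_fun_mul hf hg, add_apply, smul_apply, smul_eq_mul]; ring

theorem wirtDbar_const_mul (c : ℂ) (hf : DifferentiableAt ℝ f z) :
    wirtDbar (fun w => c * f w) z = c * wirtDbar f z := by
  rw [wirtDbar_mul (differentiableAt_const c) hf, wirtDbar_const]; ring

theorem wirtDbar_sum {ι : Type*} (s : Finset ι) (F : ι → ℂ → ℂ)
    (hF : ∀ i ∈ s, DifferentiableAt ℝ (F i) z) :
    wirtDbar (fun w => ∑ i ∈ s, F i w) z = ∑ i ∈ s, wirtDbar (F i) z := by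
  simp only [wirtDbar, fderiv_fun_sum hF, FunLike.coe_sum, Finset.sum_apply,
    Finset.mul_sum, ← Finset.sum_add_distrib, Finset.sum_div]

theorem fderiv_conj_comp (hf : DifferentiableAt ℝ f z) (v : ℂ) :
    fderiv ℝ (fun w => conj (f w)) z v = conj (fderiv ℝ f z v) := by
  have h := (Complex.conjCLE.toContinuousLinearMap.hasFDerivAt (x := f z)).comp z hf.hasFDerivAt
  have h2 : HasFDerivAt (fun w => conj (f w)) _ z := h
  rw [h2.fderiv]; rfl

theorem wirtD_conj (hf : DifferentiableAt ℝ f z) :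
    wirtD (fun w => conj (f w)) z = conj (wirtDbar f z) := by
  simp only [wirtD, wirtDbar, fderiv_conj_comp hf]; simp [Complex.conj_ofNat]; ring

theorem wirtDbar_conj (hf : DifferentiableAt ℝ f z) :
    wirtDbar (fun w => conj (f w)) z = conj (wirtD f z) := by
  simp only [wirtD, wirtDbar, fderiv_conj_comp hf]; simp [Complex.conj_ofNat]

theorem DifferentiableAt.fderiv_real_apply (hf : DifferentiableAt ℂ f z) (v : ℂ) :
    fderiv ℝ f z v = deriv f z * v := by
  rw [(hf.hasDerivAt.hasFDerivAt.restrictScalars ℝ).fderiv]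
  simp [mul_comm]

theorem wirtD_of_differentiableAt (hf : DifferentiableAt ℂ f z) : wirtD f z = deriv f z :=
  wirtD_eq_of_fderiv (b := 0) fun v => by rw [hf.fderiv_real_apply]; simp

theorem wirtDbar_of_differentiableAt (hf : DifferentiableAt ℂ f z) : wirtDbar f z = 0 :=
  wirtDbar_eq_of_fderiv (a := deriv f z) fun v => by rw [hf.fderiv_real_apply]; simp

theorem differentiableAt_complex_of_wirtDbar (hf : DifferentiableAt ℝ f z)
    (h : wirtDbar f z = 0) : DifferentiableAt ℂ f z := by
  refine (hasDerivAt_iff_hasFDerivAt (f' := wirtD f z)).2 ?_ |>.differentiableAt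
  have h2 := hf.hasFDerivAt
  rw [hasFDerivAt_iff_isLittleO_nhds_zero] at h2 ⊢
  refine h2.congr (fun v => ?_) fun _ => rfl
  rw [fderiv_apply_eq_wirtD, h]; simp [mul_comm]

theorem wirtDbar_holo_mul (hf : DifferentiableAt ℂ f z) (hg : DifferentiableAt ℝ g z) :
    wirtDbar (fun w => f w * g w) z = f z * wirtDbar g z := by
  rw [wirtDbar_mul (hf.restrictScalars ℝ) hg, wirtDbar_of_differentiableAt hf]; ring

theorem wirtDbar_comp_holo (hg : DifferentiableAt ℂ g (f z)) (hf : DifferentiableAt ℝ f z) :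
    wirtDbar (fun w => g (f w)) z = deriv g (f z) * wirtDbar f z := by
  have h := (hg.hasDerivAt.hasFDerivAt.restrictScalars ℝ).comp z hf.hasFDerivAt
  have h2 : HasFDerivAt (fun w => g (f w)) _ z := h
  refine wirtDbar_eq_of_fderiv (a := deriv g (f z) * wirtD f z) fun v => ?_
  rw [h2.fderiv, ContinuousLinearMap.comp_apply, fderiv_apply_eq_wirtD]
  simp; ring

theorem wirtDbar_cexp (hf : DifferentiableAt ℝ f z) :
    wirtDbar (fun w => Complex.exp (f w)) z = Complex.exp (f z) * wirtDbar f z := by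
  rw [wirtDbar_comp_holo Complex.differentiableAt_exp hf, Complex.deriv_exp]

theorem ContDiffOn.conj_comp {n : WithTop ℕ∞} (hf : ContDiffOn ℝ n f W) :
    ContDiffOn ℝ n (fun w => conj (f w)) W :=
  Complex.conjCLE.contDiff.comp_contDiffOn hf

theorem ContDiffOn.fderiv_apply_const {E F : Type*} [NormedAddCommGroup E] [NormedSpace ℝ E]
    [NormedAddCommGroup F] [NormedSpace ℝ F] {f : E → F} {W : Set E}
    (hf : ContDiffOn ℝ ∞ f W) (hW : IsOpen W) (v : E) :
    ContDiffOn ℝ ∞ (fun z => fderiv ℝ f z v) W :=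
  (hf.fderiv_of_isOpen hW (m := ∞) (by simp)).clm_apply contDiffOn_const

theorem ContDiffOn.wirtD (hf : ContDiffOn ℝ ∞ f W) (hW : IsOpen W) :
    ContDiffOn ℝ ∞ (wirtD f) W :=
  ((hf.fderiv_apply_const hW 1).sub
    (contDiffOn_const.mul (hf.fderiv_apply_const hW Complex.I))).div_const 2

theorem ContDiffOn.wirtDbar (hf : ContDiffOn ℝ ∞ f W) (hW : IsOpen W) :
    ContDiffOn ℝ ∞ (wirtDbar f) W :=
  ((hf.fderiv_apply_const hW 1).add
    (contDiffOn_const.mul (hf.fderiv_apply_const hW Complex.I))).div_const 2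

theorem ContDiffOn.differentiableAt_of_mem {E F : Type*} [NormedAddCommGroup E] [NormedSpace ℝ E]
    [NormedAddCommGroup F] [NormedSpace ℝ F] {f : E → F} {W : Set E} {x : E}
    (hf : ContDiffOn ℝ ∞ f W) (hW : IsOpen W) (hx : x ∈ W) : DifferentiableAt ℝ f x :=
  (hf.contDiffAt (hW.mem_nhds hx)).differentiableAt (by simp)

theorem DifferentiableOn.contDiffOn_real (hf : DifferentiableOn ℂ f W) (hW : IsOpen W) :
    ContDiffOn ℝ ∞ f W :=
  (hf.contDiffOn hW).restrict_scalars ℝ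

end Wirtinger

/-! ### Functions peaking near the boundary of an open set. -/

section Separating

/-- A Möbius function that is holomorphic and injective on `W`, takes the value `1` at `p`, and has
its pole at a boundary point close to `p` or at infinity. -/
theorem exists_mobius_pole_off {W : Set ℂ} (hW : IsOpen W) {p : ℂ} (hp : p ∈ W) :
    ∃ q : ℂ → ℂ, DifferentiableOn ℂ q W ∧ InjOn q W ∧ q p = 1 ∧ deriv q p ≠ 0 ∧
      ((∃ b ∉ W, ‖p - b‖ ≤ 1 / (1 + ‖p‖) ∧ (∀ b' ∉ W, ‖p - b‖ ≤ ‖p - b'‖) ∧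
          ∀ z, q z = (p - b) / (z - b)) ∨
        ((∀ b ∉ W, 1 / (1 + ‖p‖) < ‖p - b‖) ∧ (p ≠ 0 → ∀ z, q z = z / p))) := by
  -- The threshold shrinks as `p` goes to infinity, so a finite pole is very close to `p` also when
  -- `p` leaves compact sets by becoming large.
  by_cases h : ∃ b ∉ W, ‖p - b‖ ≤ 1 / (1 + ‖p‖)
  · obtain ⟨b', hb', hle⟩ := h
    obtain ⟨b, hb, hd⟩ := hW.isClosed_compl.exists_infDist_eq_dist ⟨b', hb'⟩ p
    have hmin : ∀ b'' ∉ W, ‖p - b‖ ≤ ‖p - b''‖ := fun b'' h'' => by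
      rw [← dist_eq_norm, ← dist_eq_norm, ← hd]
      exact Metric.infDist_le_dist_of_mem h''
    have hne : ∀ z ∈ W, z - b ≠ 0 := fun z hz h0 => hb (sub_eq_zero.1 h0 ▸ hz)
    have hder : HasDerivAt (fun z => (p - b) / (z - b)) (-(p - b) / (p - b) ^ 2) p := by
      have := (hasDerivAt_const p (p - b)).div ((hasDerivAt_id p).sub_const b) (hne p hp)
      simpa using! this
    refine ⟨fun z => (p - b) / (z - b), ?_, ?_, div_self (hne p hp), ?_,
      Or.inl ⟨b, hb, (hmin b' hb').trans hle, hmin, fun z => rfl⟩⟩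
    · exact (differentiableOn_const _).div (differentiableOn_id.sub_const b) hne
    · intro z hz w hw hzw
      have h1 := hne z hz
      have h2 := hne w hw
      have h3 := hne p hp
      simp only at hzw
      rw [div_eq_div_iff h1 h2] at hzw
      have := mul_left_cancel₀ h3 hzw
      linear_combination -this
    · rw [hder.deriv]
      have h3 := hne p hp
      exact div_ne_zero (neg_ne_zero.2 h3) (pow_ne_zero 2 h3)
  · push Not at h
    by_cases h0 : p = 0
    -- `z / p` is not available at `p = 0`. Any normalised injective function will do: in this
    -- alternative the point `0` lies in the compact set of `exists_separating`.
    · refine ⟨fun z => z + 1, by fun_prop, fun z _ w _ hzw => by simpa using hzw, by simp [h0], ?_,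
        Or.inr ⟨h, fun h1 => (h1 h0).elim⟩⟩
      simp
    · refine ⟨fun z => z / p, by fun_prop, fun z _ w _ hzw => ?_, div_self h0, ?_,
        Or.inr ⟨h, fun _ z => rfl⟩⟩
      · simpa [div_left_inj' h0] using hzw
      · simp [h0]

/-- On an open set `W ⊆ ℂ` there are injective holomorphic functions `q p` with `q p p = 1` that
are small on a given compact set as soon as `p` leaves a suitable compact set. -/
theorem exists_separating {W : Set ℂ} (hW : IsOpen W) :
    ∃ q : ℂ → ℂ → ℂ, (∀ p ∈ W, DifferentiableOn ℂ (q p) W ∧ InjOn (q p) W ∧ q p p = 1 ∧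
        deriv (q p) p ≠ 0) ∧
      ∀ K' ⊆ W, IsCompact K' → ∃ K ⊆ W, IsCompact K ∧
        ∀ p ∈ W \ K, ∀ z ∈ K', ‖q p z‖ ≤ 1 / 2 := by
  choose! q hq1 hq2 hq3 hq4 hq5 using fun (p : ℂ) (hp : p ∈ W) => exists_mobius_pole_off hW hp
  refine ⟨q, fun p hp => ⟨hq1 p hp, hq2 p hp, hq3 p hp, hq4 p hp⟩, fun K' hK'W hK' => ?_⟩
  obtain ⟨δ, hδ, hsub⟩ := hK'.exists_thickening_subset_open hW hK'W
  have hdist : ∀ z ∈ K', ∀ b ∉ W, δ ≤ ‖z - b‖ := fun z hz b hb => by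
    by_contra! hlt
    refine hb (hsub (Metric.mem_thickening_iff.2 ⟨z, hz, ?_⟩))
    rwa [dist_comm, dist_eq_norm]
  obtain ⟨R₀, hR₀⟩ := hK'.isBounded.exists_norm_le
  -- The choice gives `1 / (1 + R) ≤ δ / 2`, for a pole at a boundary point, and `|R₀| ≤ R / 2`, for
  -- `z / p`.
  set R : ℝ := 2 * |R₀| + 1 + 2 / δ with hR
  have hδ2 : 0 < 2 / δ := by positivity
  have hRpos : 0 < R := by positivity
  have hRδ : 1 / (1 + R) ≤ δ / 2 := by
    rw [div_le_iff₀ (by positivity)]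
    have : δ / 2 * (2 / δ) = 1 := by field_simp
    nlinarith [abs_nonneg R₀]
  refine ⟨{p | ‖p‖ ≤ R ∧ ∀ b ∉ W, 1 / (1 + R) ≤ ‖p - b‖}, fun p hp => ?_, ?_, ?_⟩
  · by_contra hpW
    have := hp.2 p hpW
    rw [sub_self, norm_zero] at this
    have : 0 < 1 / (1 + R) := by positivity
    linarith
  · refine Metric.isCompact_of_isClosed_isBounded ?_ ?_
    · have : {p : ℂ | ‖p‖ ≤ R ∧ ∀ b ∉ W, 1 / (1 + R) ≤ ‖p - b‖} =
        {p : ℂ | ‖p‖ ≤ R} ∩ ⋂ b ∈ Wᶜ, {p : ℂ | 1 / (1 + R) ≤ ‖p - b‖} := by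
        ext p; simp
      rw [this]
      refine (isClosed_le continuous_norm continuous_const).inter
        (isClosed_biInter fun b _ => isClosed_le continuous_const (by fun_prop))
    · exact (Metric.isBounded_closedBall (x := (0 : ℂ)) (r := R)).subset fun p hp => by
        simpa using hp.1
  · rintro p ⟨hp, hpK⟩ z hz
    have hcase : R < ‖p‖ ∨ ∃ b ∉ W, ‖p - b‖ < 1 / (1 + R) := by
      by_contra! hcon
      exact hpK hcon
    rcases hq5 p hp with ⟨b, hb, h1, h2, h3⟩ | ⟨h1, h2⟩
    · have hpb : ‖p - b‖ ≤ 1 / (1 + R) := by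
        rcases hcase with hc | ⟨b', hb', hc⟩
        · exact h1.trans (one_div_le_one_div_of_le (by positivity) (by linarith))
        · exact (h2 b' hb').trans hc.le
      have := hdist z hz b hb
      rw [h3, norm_div, div_le_iff₀ (by linarith)]
      linarith
    · have hRp : R < ‖p‖ := by
        rcases hcase with hc | ⟨b', hb', hc⟩
        · exact hc
        -- No boundary point is within `1 / (1 + ‖p‖)`, yet `b'` is within `1 / (1 + R)`: this again
        -- forces `R < ‖p‖`.
        · have h4 := (h1 b' hb').trans hc
          rw [one_div_lt_one_div (by positivity) (by positivity)] at h4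
          linarith
      have hp0 : p ≠ 0 := by
        rintro rfl
        rw [norm_zero] at hRp; linarith
      have := hR₀ z hz
      rw [h2 hp0, norm_div, div_le_iff₀ (by linarith)]
      have := le_abs_self R₀
      linarith

end Separating

/-! ### The Cauchy transform inverts `∂̄` on compactly supported functions. -/

section CauchyTransform

open MeasureTheory

/-- The Cauchy transform `z ↦ (1/π) ∫ g(z - w) / w dw` of `g`. -/
noncomputable def cauchyTransform (g : ℂ → ℂ) (z : ℂ) : ℂ :=
  (Real.pi : ℂ)⁻¹ * ∫ w, w⁻¹ * g (z - w)

/-- The singularity has order 1, less than the real dimension 2. -/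
theorem locallyIntegrable_inv_complex : LocallyIntegrable (fun w : ℂ => w⁻¹) := by
  refine locallyIntegrable_of_norm_le_rpow (C := 1) (α := 1) ?_ ?_ ?_ ?_
  · rw [Complex.finrank_real_complex]; norm_num
  · rw [Complex.finrank_real_complex]; norm_num
  · exact Filter.Eventually.of_forall fun w => by
      rw [Real.rpow_neg_one, one_mul, norm_inv]
  · exact measurable_inv.aestronglyMeasurable

theorem cauchyTransform_eq_convolution (g : ℂ → ℂ) (z : ℂ) :
    cauchyTransform g z = (Real.pi : ℂ)⁻¹ *
      convolution (fun w : ℂ => w⁻¹) g (ContinuousLinearMap.mul ℝ ℂ) volume z := by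
  simp [cauchyTransform, convolution_def]

theorem contDiff_cauchyTransform {g : ℂ → ℂ} (hg : ContDiff ℝ ∞ g) (hc : HasCompactSupport g) :
    ContDiff ℝ ∞ (cauchyTransform g) := by
  have := hc.contDiff_convolution_right (n := ⊤) (ContinuousLinearMap.mul ℝ ℂ)
    locallyIntegrable_inv_complex hg
  simpa only [← cauchyTransform_eq_convolution] using contDiff_const (c := (Real.pi : ℂ)⁻¹) |>.mul this

theorem fderiv_cauchyTransform {g : ℂ → ℂ} (hg : ContDiff ℝ ∞ g) (hc : HasCompactSupport g)
    (z v : ℂ) :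
    fderiv ℝ (cauchyTransform g) z v = cauchyTransform (fun w => fderiv ℝ g w v) z := by
  have h := (hc.hasFDerivAt_convolution_right (ContinuousLinearMap.mul ℝ ℂ)
    locallyIntegrable_inv_complex (hg.of_le (by simp)) z).const_mul (Real.pi : ℂ)⁻¹
  have h2 : HasFDerivAt (cauchyTransform g) _ z :=
    h.congr_of_eventuallyEq (Filter.Eventually.of_forall fun w => cauchyTransform_eq_convolution g w)
  rw [h2.fderiv, cauchyTransform_eq_convolution, smul_apply, smul_eq_mul,
    convolution_precompR_apply _ locallyIntegrable_inv_complex (hc.fderiv ℝ)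
      (hg.continuous_fderiv (by simp))]

/-- The convolution integrand of the Cauchy transform is integrable. -/
theorem integrable_inv_mul_comp_sub {g : ℂ → ℂ} (hg : Continuous g) (hc : HasCompactSupport g)
    (z : ℂ) : Integrable fun w => w⁻¹ * g (z - w) := by
  have := hc.convolutionExists_right (ContinuousLinearMap.mul ℝ ℂ)
    locallyIntegrable_inv_complex hg z
  simpa [ConvolutionExistsAt] using this

theorem wirtDbar_cauchyTransform_eq {g : ℂ → ℂ} (hg : ContDiff ℝ ∞ g) (hc : HasCompactSupport g)
    (z : ℂ) : wirtDbar (cauchyTransform g) z = cauchyTransform (wirtDbar g) z := by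
  have hi (v : ℂ) : Integrable fun w => w⁻¹ * fderiv ℝ g (z - w) v :=
    integrable_inv_mul_comp_sub (g := fun w => fderiv ℝ g w v)
      ((hg.continuous_fderiv (by simp)).clm_apply continuous_const) (hc.fderiv_apply ℝ v) z
  rw [wirtDbar, fderiv_cauchyTransform hg hc, fderiv_cauchyTransform hg hc]
  simp only [cauchyTransform]
  have : ∫ w, w⁻¹ * wirtDbar g (z - w) = (∫ w, w⁻¹ * fderiv ℝ g (z - w) 1) / 2 +
      Complex.I / 2 * ∫ w, w⁻¹ * fderiv ℝ g (z - w) Complex.I := by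
    rw [← integral_div, ← integral_const_mul, ← integral_add ((hi 1).div_const 2)
      ((hi Complex.I).const_mul _)]
    refine integral_congr_ae (Filter.Eventually.of_forall fun w => ?_)
    simp only [wirtDbar]; ring
  rw [this]; ring

/-- The unit complex number with argument `θ`, written as in `Complex.polarCoord`. -/
theorem polar_hasDerivAt (θ : ℝ) :
    HasDerivAt (fun θ : ℝ => Complex.exp (θ * Complex.I)) (Complex.I * Complex.exp (θ * Complex.I)) θ := by
  have h : HasDerivAt (fun θ : ℝ => (θ : ℂ) * Complex.I) Complex.I θ := by
    simpa using (Complex.ofRealCLM.hasDerivAt (x := θ)).mul_const Complex.I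
  simpa [mul_comm] using h.cexp

/-- In polar coordinates `w = r e^{iθ}` the Jacobian turns `1/w` into `e^{-iθ}`, and `e^{-iθ} ∂̄g =
(A + iB) / 2`, where `A` and `B` are the derivatives of `g` along `e^{iθ}` and `i e^{iθ}`. Along
each ray `A` integrates to `g z` by the fundamental theorem of calculus; on each circle `B`
integrates to `0` by periodicity. -/
theorem integral_inv_mul_wirtDbar {g : ℂ → ℂ} (hg : ContDiff ℝ ∞ g) (hc : HasCompactSupport g)
    (z : ℂ) : ∫ w, w⁻¹ * wirtDbar g (z - w) = Real.pi * g z := by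
  have hdg : Continuous (fderiv ℝ g) := hg.continuous_fderiv (by simp)
  set E : ℝ → ℂ := fun θ => Complex.exp (θ * Complex.I) with hE
  have hEc : Continuous E := by fun_prop
  have hEn : ∀ θ, ‖E θ‖ = 1 := fun θ => Complex.norm_exp_ofReal_mul_I θ
  have hE0 : ∀ θ, E θ ≠ 0 := fun θ => Complex.exp_ne_zero _
  obtain ⟨R, hR⟩ : ∃ R, ∀ w, R ≤ ‖w‖ → w ∉ tsupport g := by
    obtain ⟨R, hR⟩ := hc.isCompact.isBounded.exists_norm_le
    exact ⟨R + 1, fun w hw hmem => by linarith [hR w hmem]⟩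
  have hvan : ∀ r θ : ℝ, |R| + ‖z‖ < r → z - r * E θ ∉ tsupport g := fun r θ hr => by
    refine hR _ ?_
    have h1 : ‖(r : ℂ) * E θ‖ = |r| := by simp [hEn]
    have h2 := norm_sub_norm_le ((r : ℂ) * E θ) z
    rw [norm_sub_rev] at h2
    linarith [le_abs_self R, le_abs_self r]
  set A : ℝ × ℝ → ℂ := fun p => fderiv ℝ g (z - p.1 * E p.2) (E p.2) with hA
  set B : ℝ × ℝ → ℂ := fun p => fderiv ℝ g (z - p.1 * E p.2) (Complex.I * E p.2) with hB
  have hAc : Continuous A := by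
    refine (hdg.comp ?_).clm_apply ?_ <;> fun_prop
  have hBc : Continuous B := by
    refine (hdg.comp ?_).clm_apply ?_ <;> fun_prop
  -- Splitting the integral and exchanging the order of integration both need integrability; it
  -- holds because the integrands vanish for large `r`.
  have hint : ∀ F : ℝ × ℝ → ℂ, Continuous F → (∀ r θ : ℝ, |R| + ‖z‖ < r → F (r, θ) = 0) →
      IntegrableOn F (Ioi 0 ×ˢ Ioo (-Real.pi) Real.pi) := fun F hF hF0 => by
    refine IntegrableOn.of_forall_sdiff_eq_zero (s := Icc 0 (|R| + ‖z‖) ×ˢ Icc (-Real.pi) Real.pi)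
      (hF.continuousOn.integrableOn_compact (isCompact_Icc.prod isCompact_Icc))
      (measurableSet_Ioi.prod measurableSet_Ioo) ?_
    rintro ⟨r, θ⟩ ⟨⟨hr, hθ⟩, hn⟩
    refine hF0 r θ ?_
    by_contra! hle
    exact hn ⟨⟨le_of_lt hr, hle⟩, Ioo_subset_Icc_self hθ⟩
  have hz0 : ∀ r θ : ℝ, |R| + ‖z‖ < r → fderiv ℝ g (z - r * E θ) = 0 := fun r θ hr => by
    by_contra h0
    exact hvan r θ hr (support_fderiv_subset ℝ h0)
  have hAi := hint A hAc fun r θ hr => by simp [hA, hz0 r θ hr]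
  have hBi := hint B hBc fun r θ hr => by simp [hB, hz0 r θ hr]
  have hE' : ∀ θ : ℝ, (Real.cos θ + Real.sin θ * Complex.I : ℂ) = E θ := fun θ => by
    simp only [hE]
    rw [Complex.exp_mul_I]; simp
  have hEE : ∀ θ : ℝ, (E θ)⁻¹ = conj (E θ) := fun θ => by
    rw [Complex.inv_def, Complex.normSq_eq_norm_sq, hEn]; simp
  rw [← Complex.integral_comp_polarCoord_symm]
  have h1 : ∫ p in polarCoord.target, p.1 • ((Complex.polarCoord.symm p)⁻¹ *
      wirtDbar g (z - Complex.polarCoord.symm p)) =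
      ∫ p in Ioi (0 : ℝ) ×ˢ Ioo (-Real.pi) Real.pi, ((1 / 2) * A p + (Complex.I / 2) * B p) := by
    refine setIntegral_congr_fun (measurableSet_Ioi.prod measurableSet_Ioo) ?_
    rintro ⟨r, θ⟩ ⟨hr, -⟩
    have hr0 : (r : ℂ) ≠ 0 := by exact_mod_cast (ne_of_gt hr)
    simp only [Complex.polarCoord_symm_apply, hE', hA, hB, fderiv_apply_eq_wirtD, map_mul,
      Complex.conj_I, mul_inv, hEE, Complex.real_smul]
    field_simp
    linear_combination (wirtDbar g (z - r * E θ) * conj (E θ) - wirtD g (z - r * E θ) * E θ) *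
      Complex.I_sq
  have h2 : ∫ p in Ioi (0 : ℝ) ×ˢ Ioo (-Real.pi) Real.pi, A p = 2 * Real.pi * g z := by
    rw [Measure.volume_eq_prod, ← Measure.prod_restrict, integral_prod_symm]
    · have : ∀ θ : ℝ, ∫ r in Ioi (0 : ℝ), A (r, θ) = g z := fun θ => by
        have hd : ∀ r : ℝ, HasDerivAt (fun r : ℝ => g (z - r * E θ)) (-A (r, θ)) r := fun r => by
          have h3 : HasDerivAt (fun r : ℝ => z - r * E θ) (-E θ) r := by
            simpa using ((Complex.ofRealCLM.hasDerivAt (x := r)).mul_const (E θ)).const_sub z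
          have h4 := ((hg.differentiable (by simp)).differentiableAt
            (x := z - r * E θ)).hasFDerivAt.comp_hasDerivAt r h3
          have h5 : fderiv ℝ g (z - r * E θ) (-E θ) = -A (r, θ) := map_neg _ _
          rw [← h5]; exact h4
        have hsupp : HasCompactSupport (fun r : ℝ => g (z - r * E θ)) := by
          refine HasCompactSupport.intro (isCompact_Icc (a := -(|R| + ‖z‖)) (b := |R| + ‖z‖))
            fun r hr => ?_
          refine image_eq_zero_of_notMem_tsupport (hR _ ?_)
          have h1 : ‖(r : ℂ) * E θ‖ = |r| := by simp [hEn]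
          have h2 := norm_sub_norm_le ((r : ℂ) * E θ) z
          rw [norm_sub_rev] at h2
          have h3 : |R| + ‖z‖ < |r| := by
            by_contra! hle
            exact hr (abs_le.1 hle)
          linarith [le_abs_self R]
        have hcd : ContDiff ℝ 1 (fun r : ℝ => g (z - r * E θ)) :=
          (hg.of_le (by simp)).comp (contDiff_const.sub
            (Complex.ofRealCLM.contDiff.mul contDiff_const))
        have h5 := hsupp.integral_Ioi_deriv_eq hcd 0
        have h6 : deriv (fun r : ℝ => g (z - r * E θ)) = fun r => -A (r, θ) :=
          funext fun r => (hd r).deriv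
        rw [h6, integral_neg] at h5
        simpa using h5
      simp only [this, setIntegral_const, Real.volume_real_Ioo_of_le
        (by linarith [Real.pi_pos] : -Real.pi ≤ Real.pi)]
      rw [Complex.real_smul]; push_cast; ring
    · rw [Measure.prod_restrict]; exact hAi
  have h3 : ∫ p in Ioi (0 : ℝ) ×ˢ Ioo (-Real.pi) Real.pi, B p = 0 := by
    rw [Measure.volume_eq_prod, setIntegral_prod _ hBi]
    refine (setIntegral_congr_fun (g := fun _ => (0 : ℂ)) measurableSet_Ioi fun r hr => ?_).trans
      (by simp)
    have hd : ∀ θ : ℝ, HasDerivAt (fun θ : ℝ => g (z - r * E θ)) (-r * B (r, θ)) θ := fun θ => by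
      have h3 : HasDerivAt (fun θ : ℝ => z - r * E θ) (-(r * (Complex.I * E θ))) θ :=
        ((polar_hasDerivAt θ).const_mul (r : ℂ)).const_sub z
      have h4 := ((hg.differentiable (by simp)).differentiableAt
        (x := z - r * E θ)).hasFDerivAt.comp_hasDerivAt θ h3
      have h5 : fderiv ℝ g (z - r * E θ) (-(r * (Complex.I * E θ))) = -r * B (r, θ) := by
        have h6 := (fderiv ℝ g (z - r * E θ)).map_smul r (Complex.I * E θ)
        rw [Complex.real_smul, Complex.real_smul] at h6
        rw [map_neg, h6, neg_mul]
      rw [← h5]; exact h4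
    have hr0 : (r : ℂ) ≠ 0 := by exact_mod_cast (ne_of_gt hr)
    have hpi : -Real.pi ≤ Real.pi := by linarith [Real.pi_pos]
    have h4 := intervalIntegral.integral_eq_sub_of_hasDerivAt (a := -Real.pi) (b := Real.pi)
      (fun θ _ => hd θ) (Continuous.intervalIntegrable (by fun_prop) _ _)
    have h5 : E Real.pi = E (-Real.pi) := by
      simp [hE, Complex.exp_neg, Complex.exp_pi_mul_I]
    rw [h5, sub_self, intervalIntegral.integral_const_mul, mul_eq_zero,
      or_iff_right (neg_ne_zero.2 hr0), intervalIntegral.integral_of_le hpi,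
      integral_Ioc_eq_integral_Ioo] at h4
    exact h4
  have h4 : polarCoord.target = Ioi (0 : ℝ) ×ˢ Ioo (-Real.pi) Real.pi := rfl
  rw [h1, integral_add (hAi.const_mul _) (hBi.const_mul _), integral_const_mul,
    integral_const_mul, h2, h3]
  ring

/-- The Cauchy transform of a smooth compactly supported function solves the `∂̄`-equation. -/
theorem wirtDbar_cauchyTransform {g : ℂ → ℂ} (hg : ContDiff ℝ ∞ g) (hc : HasCompactSupport g)
    (z : ℂ) : wirtDbar (cauchyTransform g) z = g z := by
  rw [wirtDbar_cauchyTransform_eq hg hc, cauchyTransform, integral_inv_mul_wirtDbar hg hc,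
    ← mul_assoc, inv_mul_cancel₀ (by exact_mod_cast Real.pi_ne_zero), one_mul]

/-- The constant depends on `R` alone, so it serves all the functions `g / q ^ N` at once. With `z`
and the support of `g` in the disc of radius `R`, only `‖w‖ ≤ 2R` contributes, where `1/w` is
integrable. -/
theorem exists_norm_cauchyTransform_le (R : ℝ) :
    ∃ A : ℝ, 0 < A ∧ ∀ (g : ℂ → ℂ) (M : ℝ), 0 ≤ M → (∀ w, ‖g w‖ ≤ M) → (∀ w, R < ‖w‖ → g w = 0) →
      ∀ z, ‖z‖ ≤ R → ‖cauchyTransform g z‖ ≤ A * M := by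
  set D := Metric.closedBall (0 : ℂ) (R + R) with hD
  have hi : IntegrableOn (fun w : ℂ => ‖w⁻¹‖) D :=
    (locallyIntegrable_inv_complex.integrableOn_isCompact (isCompact_closedBall _ _)).norm
  refine ⟨|Real.pi⁻¹ * ∫ w in D, ‖w⁻¹‖| + 1, by positivity, fun g M hM hg h0 z hz => ?_⟩
  have h1 : ‖∫ w, w⁻¹ * g (z - w)‖ ≤ ∫ w, D.indicator (fun w => ‖w⁻¹‖ * M) w := by
    refine norm_integral_le_of_norm_le ((integrable_indicator_iff
      Metric.isClosed_closedBall.measurableSet).2 (hi.mul_const M))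
      (Filter.Eventually.of_forall fun w => ?_)
    by_cases hw : w ∈ D
    · rw [indicator_of_mem hw, norm_mul]
      exact mul_le_mul_of_nonneg_left (hg _) (norm_nonneg _)
    · rw [indicator_of_notMem hw, h0, mul_zero, norm_zero]
      have h2 : R + R < ‖w‖ := by simpa [hD] using hw
      have h3 := norm_sub_norm_le w z
      rw [norm_sub_rev] at h3
      linarith
  rw [integral_indicator Metric.isClosed_closedBall.measurableSet, integral_mul_const] at h1
  rw [cauchyTransform, norm_mul]
  have h2 : ‖(Real.pi : ℂ)⁻¹‖ = Real.pi⁻¹ := by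
    rw [norm_inv, Complex.norm_real, Real.norm_of_nonneg Real.pi_pos.le]
  rw [h2]
  have h3 : 0 < Real.pi⁻¹ := inv_pos.2 Real.pi_pos
  calc Real.pi⁻¹ * ‖∫ w, w⁻¹ * g (z - w)‖ ≤ Real.pi⁻¹ * ((∫ w in D, ‖w⁻¹‖) * M) := by gcongr
    _ = (Real.pi⁻¹ * ∫ w in D, ‖w⁻¹‖) * M := by ring
    _ ≤ _ := by
      refine mul_le_mul_of_nonneg_right ?_ hM
      linarith [le_abs_self (Real.pi⁻¹ * ∫ w in D, ‖w⁻¹‖)]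

end CauchyTransform

/-! ### Solving `∂̄h = g` on an arbitrary open set. -/

section DbarEquation

theorem contDiff_mul_of_tsupport_subset {θ g : ℂ → ℂ} {W : Set ℂ} (hW : IsOpen W)
    (hθ : ContDiff ℝ ∞ θ) (hsupp : tsupport θ ⊆ W) (hg : ContDiffOn ℝ ∞ g W) :
    ContDiff ℝ ∞ fun w => θ w * g w := by
  refine contDiff_iff_contDiffAt.2 fun w => ?_
  by_cases hw : w ∈ tsupport θ
  · exact hθ.contDiffAt.mul (hg.contDiffAt (hW.mem_nhds (hsupp hw)))
  · refine (contDiffAt_const (c := (0 : ℂ))).congr_of_eventuallyEq ?_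
    filter_upwards [(isClosed_tsupport θ).isOpen_compl.mem_nhds hw] with y hy
    rw [image_eq_zero_of_notMem_tsupport hy, zero_mul]

theorem isOpen_lt_norm_of_differentiableOn {W : Set ℂ} (hW : IsOpen W) {q : ℂ → ℂ}
    (hq : DifferentiableOn ℂ q W) (c : ℝ) : IsOpen {z | z ∈ W ∧ c < ‖q z‖} :=
  hq.continuousOn.norm.isOpen_inter_preimage hW isOpen_Ioi

/-- A substitute for Runge approximation: divide `g` by `q ^ N`, take the Cauchy transform, multiply
back by `q ^ N`. The holomorphic factor passes through `∂̄`, so the equation is unaffected, while on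
`K'` the solution is at most a constant times `(4/3) ^ N * (1/2) ^ N = (2/3) ^ N`. -/
theorem exists_dbar_small_of_holomorphic {W : Set ℂ} (hW : IsOpen W) {q : ℂ → ℂ}
    (hq : DifferentiableOn ℂ q W) {g : ℂ → ℂ} (hg : ContDiff ℝ ∞ g) (hc : HasCompactSupport g)
    (hsupp : tsupport g ⊆ {z | z ∈ W ∧ 3 / 4 < ‖q z‖}) {K' : Set ℂ} (hK' : IsCompact K')
    (hqK : ∀ z ∈ K', ‖q z‖ ≤ 1 / 2) {ε : ℝ} (hε : 0 < ε) :
    ∃ h : ℂ → ℂ, ContDiffOn ℝ ∞ h W ∧ (∀ z ∈ W, wirtDbar h z = g z) ∧ ∀ z ∈ K', ‖h z‖ ≤ ε := by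
  obtain ⟨R₁, hR₁⟩ := hK'.isBounded.exists_norm_le
  obtain ⟨R₂, hR₂⟩ := hc.isCompact.isBounded.exists_norm_le
  obtain ⟨M, hM⟩ := hc.exists_bound_of_continuous hg.continuous
  have hM0 : 0 ≤ M := (norm_nonneg _).trans (hM 0)
  obtain ⟨A, hA, hbound⟩ := exists_norm_cauchyTransform_le (max R₁ R₂)
  obtain ⟨N, hN⟩ : ∃ N : ℕ, A * M * (2 / 3 : ℝ) ^ N ≤ ε := by
    have h1 := (tendsto_pow_atTop_nhds_zero_of_lt_one (r := (2 / 3 : ℝ)) (by norm_num)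
      (by norm_num)).const_mul (A * M)
    rw [mul_zero] at h1
    exact ((h1.eventually (eventually_lt_nhds hε)).exists).imp fun _ h => le_of_lt h
  set U := {z | z ∈ W ∧ 3 / 4 < ‖q z‖} with hU
  have hUo : IsOpen U := isOpen_lt_norm_of_differentiableOn hW hq _
  have hq0 : ∀ w ∈ U, q w ≠ 0 := fun w hw h0 => by
    have := hw.2
    rw [h0, norm_zero] at this; linarith
  set G : ℂ → ℂ := fun w => g w * (q w ^ N)⁻¹ with hG
  have hqU : DifferentiableOn ℂ (fun w => (q w ^ N)⁻¹) U :=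
    ((hq.mono fun w hw => hw.1).pow N).inv fun w hw => pow_ne_zero N (hq0 w hw)
  have hGs : ContDiff ℝ ∞ G :=
    contDiff_mul_of_tsupport_subset hUo hg hsupp (hqU.contDiffOn_real hUo)
  have hGc : HasCompactSupport G := hc.mul_right
  have hGb : ∀ w, ‖G w‖ ≤ M * (4 / 3) ^ N := fun w => by
    by_cases hw : w ∈ tsupport g
    · have h1 := (hsupp hw).2
      have h2 : ‖(q w ^ N)⁻¹‖ ≤ (4 / 3) ^ N := by
        rw [norm_inv, norm_pow, ← inv_pow]
        refine pow_le_pow_left₀ (by positivity) ?_ N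
        rw [show (4 / 3 : ℝ) = (3 / 4)⁻¹ by norm_num]
        exact inv_anti₀ (by norm_num) h1.le
      rw [hG, norm_mul]
      exact mul_le_mul (hM w) h2 (norm_nonneg _) hM0
    · simp only [hG, image_eq_zero_of_notMem_tsupport hw, zero_mul, norm_zero]
      positivity
  have hG0 : ∀ w, max R₁ R₂ < ‖w‖ → G w = 0 := fun w hw => by
    have : w ∉ tsupport g := fun hmem =>
      absurd (hR₂ w hmem) (not_le.2 (lt_of_le_of_lt (le_max_right _ _) hw))
    simp only [hG, image_eq_zero_of_notMem_tsupport this, zero_mul]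
  have hqN : DifferentiableOn ℂ (fun w => q w ^ N) W := hq.pow N
  have hC := contDiff_cauchyTransform hGs hGc
  refine ⟨fun z => q z ^ N * cauchyTransform G z, ?_, fun z hz => ?_, fun z hz => ?_⟩
  · exact (hqN.contDiffOn_real hW).mul hC.contDiffOn
  · rw [wirtDbar_holo_mul (hqN.differentiableAt (hW.mem_nhds hz))
      (hC.differentiable (by simp)).differentiableAt, wirtDbar_cauchyTransform hGs hGc]
    by_cases hw : z ∈ tsupport g
    · have := pow_ne_zero N (hq0 z (hsupp hw))
      simp only [hG]; field_simp
    · simp only [hG, image_eq_zero_of_notMem_tsupport hw, zero_mul, mul_zero]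
  · have h1 := hbound G _ (by positivity) hGb hG0 z ((hR₁ z hz).trans (le_max_left _ _))
    have h2 : ‖q z ^ N‖ ≤ (1 / 2) ^ N := by
      rw [norm_pow]; exact pow_le_pow_left₀ (norm_nonneg _) (hqK z hz) N
    rw [norm_mul]
    calc ‖q z ^ N‖ * ‖cauchyTransform G z‖ ≤ (1 / 2) ^ N * (A * (M * (4 / 3) ^ N)) :=
          mul_le_mul h2 h1 (norm_nonneg _) (by positivity)
      _ = A * M * ((1 / 2) * (4 / 3)) ^ N := by rw [mul_pow]; ring
      _ ≤ ε := by norm_num at hN ⊢; exact hN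

/-- As `q p p = 1`, the sets `3/4 < ‖q p‖` with `p` in the support of `g` cover that support. A
partition of unity subordinate to a finite subcover reduces to one `q p` at a time. -/
theorem exists_dbar_small {W : Set ℂ} (hW : IsOpen W) {K K' : Set ℂ} (hK' : IsCompact K')
    {q : ℂ → ℂ → ℂ} (hq : ∀ p ∈ W, DifferentiableOn ℂ (q p) W) (hq1 : ∀ p ∈ W, q p p = 1)
    (hqK : ∀ p ∈ W \ K, ∀ z ∈ K', ‖q p z‖ ≤ 1 / 2) {g : ℂ → ℂ} (hg : ContDiff ℝ ∞ g)
    (hc : HasCompactSupport g) (hsupp : tsupport g ⊆ W \ K) {ε : ℝ} (hε : 0 < ε) :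
    ∃ h : ℂ → ℂ, ContDiffOn ℝ ∞ h W ∧ (∀ z ∈ W, wirtDbar h z = g z) ∧ ∀ z ∈ K', ‖h z‖ ≤ ε := by
  obtain ⟨t, ht⟩ := hc.isCompact.elim_finite_subcover
    (fun p : tsupport g => {z | z ∈ W ∧ 3 / 4 < ‖q p z‖})
    (fun p => isOpen_lt_norm_of_differentiableOn hW (hq p (hsupp p.2).1) _)
    (fun z hz => mem_iUnion.2 ⟨⟨z, hz⟩, (hsupp hz).1, by
      simp only [hq1 z (hsupp hz).1, norm_one]; norm_num⟩)
  obtain ⟨ρ, hρ⟩ := SmoothPartitionOfUnity.exists_isSubordinate (ι := t) 𝓘(ℝ, ℂ)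
    (isClosed_tsupport g) (fun p => {z | z ∈ W ∧ 3 / 4 < ‖q p z‖})
    (fun p => isOpen_lt_norm_of_differentiableOn hW (hq p (hsupp p.1.2).1) _)
    (fun z hz => by
      obtain ⟨p, hp, hz⟩ := mem_iUnion₂.1 (ht hz)
      exact mem_iUnion.2 ⟨⟨p, hp⟩, hz⟩)
  have hρs : ∀ p, ContDiff ℝ ∞ fun w => (ρ p w : ℂ) := fun p =>
    Complex.ofRealCLM.contDiff.comp (contMDiff_iff_contDiff.1 (ρ p).contMDiff)
  -- The `+ 1` keeps the denominator positive when the subcover is empty.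
  have hpiece : ∀ p : t, ∃ h : ℂ → ℂ, ContDiffOn ℝ ∞ h W ∧
      (∀ z ∈ W, wirtDbar h z = ρ p z * g z) ∧ ∀ z ∈ K', ‖h z‖ ≤ ε / (t.card + 1) := fun p => by
    refine exists_dbar_small_of_holomorphic hW (hq p.1 (hsupp p.1.2).1) ((hρs p).mul hg)
      hc.mul_left ?_ hK' (hqK _ (hsupp p.1.2)) (by positivity)
    refine Subset.trans ?_ (hρ p)
    refine closure_mono fun w hw => ?_
    rw [Function.mem_support] at hw ⊢
    contrapose! hw
    simp [hw]
  choose h hs hd hb using hpiece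
  refine ⟨fun z => ∑ p, h p z, ContDiffOn.sum fun p _ => hs p, fun z hz => ?_, fun z hz => ?_⟩
  · rw [wirtDbar_sum _ _ fun p _ => (hs p).differentiableAt_of_mem hW hz]
    simp only [hd _ z hz]
    rw [← Finset.sum_mul]
    by_cases hz' : z ∈ tsupport g
    · have h1 := ρ.sum_eq_one hz'
      rw [finsum_eq_sum_of_fintype] at h1
      rw [← Complex.ofReal_sum, h1]; simp
    · simp [image_eq_zero_of_notMem_tsupport hz']
  · refine (norm_sum_le_of_le _ fun p _ => hb p z hz).trans ?_
    rw [Finset.sum_const, nsmul_eq_mul, Finset.card_univ, Fintype.card_coe,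
      mul_div_assoc', div_le_iff₀ (by positivity)]
    nlinarith

theorem IsOpen.exists_compact_exhaustion {W : Set ℂ} (hW : IsOpen W) :
    ∃ L : ℕ → Set ℂ, (∀ n, IsCompact (L n)) ∧ Monotone L ∧ (∀ n, L n ⊆ W) ∧
      ∀ z ∈ W, ∃ n, L n ∈ 𝓝 z := by
  have : LocallyCompactSpace W := hW.locallyCompactSpace
  let K := CompactExhaustion.choice W
  refine ⟨fun n => Subtype.val '' K n, fun n => (K.isCompact n).image continuous_subtype_val,
    fun m n h => image_mono (K.subset h), fun n => Subtype.coe_image_subset _ _, fun z hz => ?_⟩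
  obtain ⟨n, hn⟩ := mem_iUnion.1 ((K.iUnion_eq ▸ mem_univ (⟨z, hz⟩ : W)) : (⟨z, hz⟩ : W) ∈ ⋃ n, K n)
  refine ⟨n + 1, ?_⟩
  have h1 : K (n + 1) ∈ 𝓝 (⟨z, hz⟩ : W) := mem_interior_iff_mem_nhds.1 (K.subset_interior_succ n hn)
  exact hW.isOpenEmbedding_subtypeVal.isOpenMap.image_mem_nhds h1

theorem exists_smooth_cutoff {W C : Set ℂ} (hW : IsOpen W) (hC : IsCompact C) (hCW : C ⊆ W) :
    ∃ θ : ℂ → ℂ, ContDiff ℝ ∞ θ ∧ HasCompactSupport θ ∧ tsupport θ ⊆ W ∧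
      ∀ z ∈ C, θ =ᶠ[𝓝 z] fun _ => 1 := by
  obtain ⟨D, hD, hCD, hDW⟩ := exists_compact_between hC hW hCW
  obtain ⟨f, hf1, hf0, -⟩ := exists_contMDiffMap_one_nhds_of_subset_interior (n := ⊤) 𝓘(ℝ, ℂ)
    hC.isClosed hCD
  have hsub : tsupport (fun z => (f z : ℂ)) ⊆ D := by
    refine closure_minimal (fun z hz => ?_) hD.isClosed
    by_contra hzD
    exact hz (by simp [hf0 z hzD])
  refine ⟨fun z => (f z : ℂ), Complex.ofRealCLM.contDiff.comp
    (contMDiff_iff_contDiff.1 f.contMDiff), hD.of_isClosed_subset (isClosed_tsupport _) hsub,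
    hsub.trans hDW, fun z hz => ?_⟩
  filter_upwards [hf1.filter_mono (nhds_le_nhdsSet hz)] with w hw
  simp [hw]

/-- The inhomogeneous Cauchy–Riemann equation is solvable on every open subset of the plane. -/
theorem exists_wirtDbar_eq {W : Set ℂ} (hW : IsOpen W) {g : ℂ → ℂ} (hg : ContDiffOn ℝ ∞ g W) :
    ∃ h : ℂ → ℂ, ContDiffOn ℝ ∞ h W ∧ ∀ z ∈ W, wirtDbar h z = g z := by
  obtain ⟨q, hq, hsep⟩ := exists_separating hW
  obtain ⟨L, hL, hLm, hLW, hLn⟩ := hW.exists_compact_exhaustion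
  choose K hKW hKc hK using fun n => hsep (L n) (hLW n) (hL n)
  have hC (n : ℕ) : ∃ θ : ℂ → ℂ, ContDiff ℝ ∞ θ ∧ HasCompactSupport θ ∧ tsupport θ ⊆ W ∧
      ∀ z ∈ L n ∪ ⋃ m ∈ Iic n, K m, θ =ᶠ[𝓝 z] fun _ => 1 :=
    exists_smooth_cutoff hW ((hL n).union ((finite_Iic n).isCompact_biUnion fun m _ => hKc m))
      (union_subset (hLW n) (iUnion₂_subset fun m _ => hKW m))
  choose θ hθs hθc hθW hθ1 using hC
  have hθL : ∀ m n, m ≤ n → ∀ z ∈ L m, θ n =ᶠ[𝓝 z] fun _ => 1 := fun m n hmn z hz =>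
    hθ1 n z (Or.inl (hLm hmn hz))
  have hθK : ∀ m n, m ≤ n → ∀ z ∈ K m, θ n =ᶠ[𝓝 z] fun _ => 1 := fun m n hmn z hz =>
    hθ1 n z (Or.inr (mem_biUnion (mem_Iic.2 hmn) hz))
  -- Both cutoffs are 1 near `K n`, so `d n` is supported off `K n` and `∂̄h = d n` has a solution
  -- that is small on `L n`.
  set d : ℕ → ℂ → ℂ := fun n w => θ (n + 1) w * g w - θ n w * g w with hd
  have hθg (n : ℕ) : ContDiff ℝ ∞ fun w => θ n w * g w :=
    contDiff_mul_of_tsupport_subset hW (hθs n) (hθW n) hg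
  have hds (n : ℕ) : ContDiff ℝ ∞ (d n) := (hθg (n + 1)).sub (hθg n)
  have hdc (n : ℕ) : HasCompactSupport (d n) :=
    ((hθc (n + 1)).mul_right).sub ((hθc n).mul_right)
  have hdW (n : ℕ) : tsupport (d n) ⊆ W \ K n := by
    intro z hz
    refine ⟨?_, fun hzK => ?_⟩
    · by_contra hzW
      have h1 : ∀ k, (θ k) =ᶠ[𝓝 z] fun _ => 0 := fun k =>
        notMem_tsupport_iff_eventuallyEq.1 fun hmem => hzW (hθW k hmem)
      refine notMem_tsupport_iff_eventuallyEq.2 ?_ hz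
      filter_upwards [h1 n, h1 (n + 1)] with w hw hw'
      simp [hd, hw, hw']
    · refine notMem_tsupport_iff_eventuallyEq.2 ?_ hz
      filter_upwards [hθK n n le_rfl z hzK, hθK n (n + 1) (Nat.le_succ n) z hzK] with w hw hw'
      simp [hd, hw, hw']
  have hh (n : ℕ) := exists_dbar_small hW (hL n) (fun p hp => (hq p hp).1)
    (fun p hp => (hq p hp).2.2.1) (hK n) (hds n) (hdc n) (hdW n)
    (ε := (1 / 2 : ℝ) ^ n) (by positivity)
  choose h hhs hhd hhb using hh
  have h0s := contDiff_cauchyTransform (hθg 0) (hθc 0).mul_right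
  -- Formally `∂̄H = θ₀ g + Σ (θₙ₊₁ - θₙ) g = g`; the bounds `2⁻ⁿ` on `L n` make the series
  -- converge.
  set H : ℂ → ℂ := fun z => cauchyTransform (fun w => θ 0 w * g w) z + ∑' n, h n z with hH
  have key : ∀ z ∈ W, ContDiffAt ℝ ∞ H z ∧ wirtDbar H z = g z := fun z hz => by
    obtain ⟨m, hm⟩ := hLn z hz
    set V := interior (L m) with hV
    have hVo : IsOpen V := isOpen_interior
    have hzV : z ∈ V := mem_interior_iff_mem_nhds.2 hm
    have hVL : V ⊆ L m := interior_subset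
    -- From index `m` on, both cutoffs are 1 on `L m`, so `d` vanishes there and the tail is a
    -- uniformly convergent series of holomorphic functions, invisible to `∂̄`.
    have hhol : ∀ n, DifferentiableOn ℂ (h (n + m)) V := fun n w hw => by
      have hwW := hLW m (hVL hw)
      refine (differentiableAt_complex_of_wirtDbar
        ((hhs (n + m)).differentiableAt_of_mem hW hwW) ?_).differentiableWithinAt
      rw [hhd _ w hwW]
      have h1 := (hθL m (n + m) (by omega) w (hVL hw)).self_of_nhds
      have h2 := (hθL m (n + m + 1) (by omega) w (hVL hw)).self_of_nhds
      simp only [hd, h1, h2, sub_self]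
    have hbd : ∀ n, ∀ w ∈ V, ‖h (n + m) w‖ ≤ (1 / 2 : ℝ) ^ n := fun n w hw =>
      (hhb (n + m) w (hLm (Nat.le_add_left m n) (hVL hw))).trans
        (pow_le_pow_of_le_one (by norm_num) (by norm_num) (Nat.le_add_right n m))
    have hgeo : Summable fun n : ℕ => (1 / 2 : ℝ) ^ n := summable_geometric_two
    have htail := Complex.differentiableOn_tsum_of_summable_norm hgeo hhol hVo hbd
    have hsplit : ∀ w ∈ V, H w = cauchyTransform (fun w => θ 0 w * g w) w +
        (∑ n ∈ Finset.range m, h n w + ∑' n, h (n + m) w) := fun w hw => by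
      simp only [hH]
      have h1 : Summable fun n => h (n + m) w := Summable.of_norm_bounded hgeo fun n => hbd n w hw
      rw [((summable_nat_add_iff (f := fun n => h n w) m).1 h1).sum_add_tsum_nat_add]
    have hcongr : H =ᶠ[𝓝 z] fun w => cauchyTransform (fun w => θ 0 w * g w) w +
        (∑ n ∈ Finset.range m, h n w + ∑' n, h (n + m) w) := by
      filter_upwards [hVo.mem_nhds hzV] with w hw using hsplit w hw
    have hfin : ContDiffAt ℝ ∞ (fun w => ∑ n ∈ Finset.range m, h n w) z :=
      ContDiffAt.sum fun n _ => (hhs n).contDiffAt (hW.mem_nhds hz)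
    have htl : ContDiffAt ℝ ∞ (fun w => ∑' n, h (n + m) w) z :=
      (htail.contDiffOn_real hVo).contDiffAt (hVo.mem_nhds hzV)
    refine ⟨(h0s.contDiffAt.add (hfin.add htl)).congr_of_eventuallyEq hcongr, ?_⟩
    rw [wirtDbar_congr hcongr, wirtDbar_add (h0s.contDiffAt.differentiableAt (by simp))
      ((hfin.add htl).differentiableAt (by simp)), wirtDbar_add (hfin.differentiableAt (by simp))
      (htl.differentiableAt (by simp)), wirtDbar_cauchyTransform (hθg 0) (hθc 0).mul_right,
      wirtDbar_sum _ _ fun n _ => (hhs n).differentiableAt_of_mem hW hz,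
      wirtDbar_of_differentiableAt (htail.differentiableAt (hVo.mem_nhds hzV))]
    simp only [hhd _ z hz, hd]
    -- The finite part telescopes to `θ m z * g z`, and `θ m z = 1`.
    rw [Finset.sum_range_sub (fun n => θ n z * g z)]
    have h1 := (hθL m m le_rfl z (hVL hzV)).self_of_nhds
    simp only [h1]; ring
  exact ⟨H, fun z hz => (key z hz).1.contDiffWithinAt, fun z hz => (key z hz).2⟩

end DbarEquation

/-! ### Determinants in terms of Wirtinger derivatives. -/

section RealLinear

theorem det_of_apply_eq {L : ℂ →L[ℝ] ℂ} {A B : ℂ} (h : ∀ v, L v = A * v + B * conj v) :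
    L.det = ‖A‖ ^ 2 - ‖B‖ ^ 2 := by
  rw [ContinuousLinearMap.det, ← LinearMap.det_toMatrix Complex.basisOneI, Matrix.det_fin_two]
  simp only [LinearMap.toMatrix_apply, Complex.coe_basisOneI, Complex.coe_basisOneI_repr]
  simp [h, Complex.sq_norm, Complex.normSq_apply]
  ring

theorem det_fderiv_eq (f : ℂ → ℂ) (z : ℂ) :
    (fderiv ℝ f z).det = ‖wirtD f z‖ ^ 2 - ‖wirtDbar f z‖ ^ 2 :=
  det_of_apply_eq (fderiv_apply_eq_wirtD f z)

end RealLinear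

/-! ### A row combination with nondegenerate zeros. -/

section RegularCombination

open MeasureTheory

/-- The derivative of a smooth map between planes is invertible on some fibre (Sard). -/
theorem exists_regular_value {V : Set ℂ} {t : ℂ → ℂ} (ht : ∀ z ∈ V, DifferentiableAt ℝ t z) :
    ∃ κ : ℂ, ∀ z ∈ V, t z = κ → ‖wirtD t z‖ ≠ ‖wirtDbar t z‖ := by
  set C := {z | z ∈ V ∧ (fderiv ℝ t z).det = 0} with hC
  -- Between spaces of equal dimension, Sard's theorem needs no more than differentiability.
  have h0 : volume (t '' C) = 0 :=
    addHaar_image_eq_zero_of_det_fderivWithin_eq_zero volume (f' := fderiv ℝ t)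
      (fun z hz => (ht z hz.1).hasFDerivAt.hasFDerivWithinAt) fun z hz => hz.2
  obtain ⟨κ, hκ⟩ : ∃ κ, κ ∉ t '' C := by
    by_contra! hall
    rw [eq_univ_of_forall hall] at h0
    simp at h0
  refine ⟨κ, fun z hz hzκ heq => hκ ⟨z, ⟨hz, ?_⟩, hzκ⟩⟩
  rw [det_fderiv_eq, heq, sub_self]

/-- Where the first row `(a, b)` is nonzero the second is `t` times it, with `t` their smooth
Hermitian quotient, and `κ` is a regular value of `t`. The combination vanishes only where `(a, b) ≠
0` and `t = κ`; near such a point it is `(t - κ)(a, b)`, so its derivative is that of `t` times `(a,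
b)`. The numbers `A, B` are the Wirtinger derivatives of `t`, and `‖A‖ ≠ ‖B‖` is regularity. -/
theorem exists_regular_combination {W : Set ℂ} (hW : IsOpen W) {a b c d : ℂ → ℂ}
    (ha : ContDiffOn ℝ ∞ a W) (hb : ContDiffOn ℝ ∞ b W) (hc : ContDiffOn ℝ ∞ c W)
    (hd : ContDiffOn ℝ ∞ d W) (hdet : ∀ z ∈ W, a z * d z = b z * c z)
    (hne : ∀ z ∈ W, a z ≠ 0 ∨ b z ≠ 0 ∨ c z ≠ 0 ∨ d z ≠ 0) :
    ∃ κ : ℂ, ∀ p ∈ W, c p - κ * a p = 0 → d p - κ * b p = 0 → (a p ≠ 0 ∨ b p ≠ 0) ∧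
      ∃ A B : ℂ, ‖A‖ ≠ ‖B‖ ∧
        wirtD (fun z => c z - κ * a z) p = A * a p ∧ wirtDbar (fun z => c z - κ * a z) p = B * a p ∧
        wirtD (fun z => d z - κ * b z) p = A * b p ∧ wirtDbar (fun z => d z - κ * b z) p = B * b p := by
  set n : ℂ → ℂ := fun z => a z * conj (a z) + b z * conj (b z) with hn
  set t : ℂ → ℂ := fun z => (c z * conj (a z) + d z * conj (b z)) / n z with ht
  have hnn : ∀ z, n z = ((‖a z‖ ^ 2 + ‖b z‖ ^ 2 : ℝ) : ℂ) := fun z => by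
    simp only [hn, Complex.mul_conj']; push_cast; ring
  have hn0 : ∀ z, (a z ≠ 0 ∨ b z ≠ 0) → n z ≠ 0 := fun z hz => by
    rw [hnn]
    have : (0 : ℝ) < ‖a z‖ ^ 2 + ‖b z‖ ^ 2 := by rcases hz with h | h <;> positivity
    exact_mod_cast this.ne'
  have hd' {f : ℂ → ℂ} (hf : ContDiffOn ℝ ∞ f W) {z : ℂ} (hz : z ∈ W) : DifferentiableAt ℝ f z :=
    hf.differentiableAt_of_mem hW hz
  have htd : ∀ z ∈ {z | z ∈ W ∧ (a z ≠ 0 ∨ b z ≠ 0)}, DifferentiableAt ℝ t z := fun z ⟨hz, hz0⟩ => by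
    have h1 := hd' (hc.mul ha.conj_comp) hz
    have h2 := hd' (hd.mul hb.conj_comp) hz
    have h3 := hd' (ha.mul ha.conj_comp) hz
    have h4 := hd' (hb.mul hb.conj_comp) hz
    simp only [ht, div_eq_mul_inv]
    exact (h1.add h2).mul ((h3.add h4).inv (hn0 z hz0))
  have hct : ∀ z ∈ W, (a z ≠ 0 ∨ b z ≠ 0) → c z = t z * a z ∧ d z = t z * b z := fun z hz hz0 => by
    have h1 := hn0 z hz0
    have h2 := hdet z hz
    simp only [ht]
    constructor
    · rw [div_mul_eq_mul_div, eq_div_iff h1]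
      simp only [hn]
      linear_combination -conj (b z) * h2
    · rw [div_mul_eq_mul_div, eq_div_iff h1]
      simp only [hn]
      linear_combination conj (a z) * h2
  obtain ⟨κ, hκ⟩ := exists_regular_value htd
  refine ⟨κ, fun p hp h1 h2 => ?_⟩
  have hp0 : a p ≠ 0 ∨ b p ≠ 0 := by
    by_contra! hcon
    rw [hcon.1, mul_zero, sub_zero] at h1
    rw [hcon.2, mul_zero, sub_zero] at h2
    rcases hne p hp with h | h | h | h
    exacts [h hcon.1, h hcon.2, h h1, h h2]
  have htp : t p - κ = 0 := by
    obtain ⟨h3, h4⟩ := hct p hp hp0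
    rw [h3, ← sub_mul] at h1
    rw [h4, ← sub_mul] at h2
    rcases hp0 with h | h
    exacts [(mul_eq_zero.1 h1).resolve_right h, (mul_eq_zero.1 h2).resolve_right h]
  have hev : ∀ᶠ z in 𝓝 p, z ∈ W ∧ (a z ≠ 0 ∨ b z ≠ 0) := by
    refine Filter.Eventually.and (hW.mem_nhds hp) ?_
    rcases hp0 with h | h
    · exact ((hd' ha hp).continuousAt.eventually_ne h).mono fun _ h => Or.inl h
    · exact ((hd' hb hp).continuousAt.eventually_ne h).mono fun _ h => Or.inr h
  have htκ : DifferentiableAt ℝ (fun z => t z - κ) p := (htd p ⟨hp, hp0⟩).sub_const κ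
  have e1 : (fun z => c z - κ * a z) =ᶠ[𝓝 p] fun z => (t z - κ) * a z :=
    hev.mono fun z hz => by
      simp only [(hct z hz.1 hz.2).1.symm ▸ sub_mul (t z) κ (a z)]
  have e2 : (fun z => d z - κ * b z) =ᶠ[𝓝 p] fun z => (t z - κ) * b z :=
    hev.mono fun z hz => by
      simp only [(hct z hz.1 hz.2).2.symm ▸ sub_mul (t z) κ (b z)]
  refine ⟨hp0, wirtD t p, wirtDbar t p, hκ p ⟨hp, hp0⟩ (sub_eq_zero.1 htp), ?_, ?_, ?_, ?_⟩
  · rw [wirtD_congr e1, wirtD_mul htκ (hd' ha hp), htp,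
      wirtD_sub (htd p ⟨hp, hp0⟩) (differentiableAt_const κ), wirtD_const]; ring
  · rw [wirtDbar_congr e1, wirtDbar_mul htκ (hd' ha hp), htp,
      wirtDbar_sub (htd p ⟨hp, hp0⟩) (differentiableAt_const κ), wirtDbar_const]; ring
  · rw [wirtD_congr e2, wirtD_mul htκ (hd' hb hp), htp,
      wirtD_sub (htd p ⟨hp, hp0⟩) (differentiableAt_const κ), wirtD_const]; ring
  · rw [wirtDbar_congr e2, wirtDbar_mul htκ (hd' hb hp), htp,
      wirtDbar_sub (htd p ⟨hp, hp0⟩) (differentiableAt_const κ), wirtDbar_const]; ring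

end RegularCombination

/-! ### Smooth functions with prescribed zeros and local degrees. -/

section PrescribedZeros

/-- A smooth stand-in for the elementary factors of a Weierstrass product. Being exactly 1 for small
`ζ`, it makes the products locally finite, so no convergence question arises. -/
theorem exists_smooth_one_sub :
    ∃ β : ℂ → ℂ, ContDiff ℝ ∞ β ∧ (∀ ζ, ‖ζ‖ ≤ 1 / 2 → β ζ = 1) ∧ (∀ ζ, β ζ = 0 ↔ ζ = 1) ∧
      β =ᶠ[𝓝 1] fun ζ => 1 - ζ := by
  let f : ContDiffBump (0 : ℂ) := ⟨1 / 2, 3 / 4, by norm_num, by norm_num⟩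
  have hout : ∀ ζ : ℂ, 3 / 4 ≤ ‖ζ‖ → f ζ = 0 := fun ζ hζ =>
    f.zero_of_le_dist (by simpa using hζ)
  refine ⟨fun ζ => 1 - ((1 - f ζ : ℝ) : ℂ) * ζ, ?_, fun ζ hζ => ?_, fun ζ => ⟨fun h => ?_, ?_⟩, ?_⟩
  · exact contDiff_const.sub ((Complex.ofRealCLM.contDiff.comp
      (contDiff_const.sub f.contDiff)).mul contDiff_id)
  · have : f ζ = 1 := f.one_of_mem_closedBall (by simpa [f] using hζ)
    simp [this]
  · have h1 : ((1 - f ζ : ℝ) : ℂ) * ζ = 1 := (sub_eq_zero.1 h).symm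
    have h2 : (1 - f ζ) * ‖ζ‖ = 1 := by
      have := congrArg norm h1
      rwa [norm_mul, Complex.norm_real, Real.norm_of_nonneg (by linarith [f.le_one (x := ζ)]),
        norm_one] at this
    have h3 : 3 / 4 ≤ ‖ζ‖ := by nlinarith [f.nonneg (x := ζ), norm_nonneg ζ]
    rw [hout ζ h3] at h1
    simpa using h1
  · rintro rfl
    simp [hout 1 (by simp; norm_num)]
  · have : ∀ᶠ ζ : ℂ in 𝓝 1, 3 / 4 < ‖ζ‖ :=
      continuous_norm.continuousAt.eventually_const_lt (by simp; norm_num)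
    filter_upwards [this] with ζ hζ
    simp [hout ζ hζ.le]

/-- A smooth function on `W` with prescribed simple zeros; at each zero it is to first order
holomorphic or antiholomorphic, as prescribed. -/
theorem exists_smooth_prescribed_zeros {W : Set ℂ} (hW : IsOpen W) {Z : Set ℂ} (hZW : Z ⊆ W)
    (hfin : ∀ K ⊆ W, IsCompact K → (Z ∩ K).Finite) (Q : ℂ → Prop) :
    ∃ P : ℂ → ℂ, ContDiffOn ℝ ∞ P W ∧ (∀ z ∈ W, P z = 0 ↔ z ∈ Z) ∧
      (∀ p ∈ Z, Q p → wirtD P p ≠ 0 ∧ wirtDbar P p = 0) ∧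
      ∀ p ∈ Z, ¬ Q p → wirtD P p = 0 ∧ wirtDbar P p ≠ 0 := by
  classical
  obtain ⟨q, hq, hsep⟩ := exists_separating hW
  obtain ⟨β, hβs, hβ1, hβ0, hβn⟩ := exists_smooth_one_sub
  -- The factor vanishes at `p` only, because `q p` is injective and takes the value 1 at `p`.
  -- Conjugation changes the local degree from `+1` to `-1`.
  set F : ℂ → ℂ → ℂ := fun p z =>
    if p ∈ Z then (if Q p then β (q p z) else conj (β (q p z))) else 1 with hF
  have hβq : ∀ p ∈ Z, ContDiffOn ℝ ∞ (fun z => β (q p z)) W := fun p hp =>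
    hβs.comp_contDiffOn ((hq p (hZW hp)).1.contDiffOn_real hW)
  have hFs : ∀ p, ContDiffOn ℝ ∞ (F p) W := fun p => by
    by_cases hp : p ∈ Z
    · by_cases hQ : Q p
      · exact (hβq p hp).congr fun z _ => by simp only [hF, if_pos hp, if_pos hQ]
      · exact (hβq p hp).conj_comp.congr fun z _ => by simp only [hF, if_pos hp, if_neg hQ]
    · exact (contDiffOn_const (c := (1 : ℂ))).congr fun z _ => by simp only [hF, if_neg hp]
  have hF0 : ∀ p, ∀ z ∈ W, F p z = 0 ↔ p ∈ Z ∧ z = p := fun p z hz => by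
    by_cases hp : p ∈ Z
    · obtain ⟨-, hinj, hqp, -⟩ := hq p (hZW hp)
      have h1 : F p z = 0 ↔ β (q p z) = 0 := by
        by_cases hQ : Q p <;> simp [hF, hp, hQ]
      rw [h1, hβ0]
      refine ⟨fun h => ⟨hp, hinj hz (hZW hp) (h.trans hqp.symm)⟩, fun h => ?_⟩
      rw [h.2, hqp]
    · simp [hF, hp]
  have hF1 : ∀ p z, ‖q p z‖ ≤ 1 / 2 → F p z = 1 := fun p z h => by
    simp only [hF, hβ1 _ h, map_one, ite_self]
  have hFd : ∀ p ∈ Z, (Q p → wirtD (F p) p ≠ 0 ∧ wirtDbar (F p) p = 0) ∧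
      (¬ Q p → wirtD (F p) p = 0 ∧ wirtDbar (F p) p ≠ 0) := fun p hp => by
    obtain ⟨hqd, -, hqp, hq'⟩ := hq p (hZW hp)
    have hqa := hqd.differentiableAt (hW.mem_nhds (hZW hp))
    have hdiff : DifferentiableAt ℂ (fun z => 1 - q p z) p := hqa.const_sub 1
    have hlocal : (fun z => β (q p z)) =ᶠ[𝓝 p] fun z => 1 - q p z := by
      have : Filter.Tendsto (q p) (𝓝 p) (𝓝 1) := by
        have := hqa.continuousAt
        rwa [ContinuousAt, hqp] at this
      exact this.eventually hβn
    have hder : deriv (fun z => 1 - q p z) p ≠ 0 := by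
      rw [deriv_const_sub]; exact neg_ne_zero.2 hq'
    refine ⟨fun hQ => ?_, fun hQ => ?_⟩
    · have h1 : F p =ᶠ[𝓝 p] fun z => 1 - q p z := by
        refine Filter.EventuallyEq.trans (Filter.Eventually.of_forall fun z => ?_) hlocal
        simp only [hF, if_pos hp, if_pos hQ]
      rw [wirtD_congr h1, wirtDbar_congr h1, wirtD_of_differentiableAt hdiff,
        wirtDbar_of_differentiableAt hdiff]
      exact ⟨hder, rfl⟩
    · have h1 : F p =ᶠ[𝓝 p] fun z => conj (1 - q p z) := by
        filter_upwards [hlocal] with z hz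
        simp only [hF, if_pos hp, if_neg hQ, hz]
      rw [wirtD_congr h1, wirtDbar_congr h1, wirtD_conj (hdiff.restrictScalars ℝ),
        wirtDbar_conj (hdiff.restrictScalars ℝ), wirtD_of_differentiableAt hdiff,
        wirtDbar_of_differentiableAt hdiff]
      exact ⟨map_zero _, (map_ne_zero _).2 hder⟩
  -- On a compact neighbourhood of `z₀`, `‖q p‖ ≤ 1/2` for `p` outside a compact `K`, so only the
  -- finitely many factors with `p ∈ Z ∩ K` differ from 1.
  have hloc : ∀ z₀ ∈ W, ∃ T : Finset ℂ, (∀ p ∈ T, p ∈ Z) ∧ (z₀ ∈ Z → z₀ ∈ T) ∧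
      (fun z => ∏ᶠ p, F p z) =ᶠ[𝓝 z₀] fun z => ∏ p ∈ T, F p z := fun z₀ hz₀ => by
    obtain ⟨K', hK', hzK', hK'W⟩ := exists_compact_subset hW hz₀
    obtain ⟨K, hKW, hKc, hK⟩ := hsep K' hK'W hK'
    have hsupp : ∀ z ∈ K', (Function.mulSupport fun p => F p z) ⊆ (hfin K hKW hKc).toFinset :=
      fun z hz p hp => by
        have hpZ : p ∈ Z := by
          by_contra hpZ
          exact hp (by simp only [hF, if_neg hpZ])
        rw [Finite.coe_toFinset]
        refine ⟨hpZ, ?_⟩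
        by_contra hpK
        exact hp (hF1 p z (hK p ⟨hZW hpZ, hpK⟩ z hz))
    refine ⟨(hfin K hKW hKc).toFinset, fun p hp => ((Finite.mem_toFinset _).1 hp).1,
      fun hzZ => ?_, ?_⟩
    · refine hsupp z₀ (interior_subset hzK') ?_
      rw [Function.mem_mulSupport, (hF0 z₀ z₀ hz₀).2 ⟨hzZ, rfl⟩]
      exact zero_ne_one
    · filter_upwards [mem_interior_iff_mem_nhds.1 hzK'] with z hz
      exact finprod_eq_prod_of_mulSupport_subset _ (hsupp z hz)
  have hderiv : ∀ p ∈ Z, ∃ r : ℂ, r ≠ 0 ∧ wirtD (fun z => ∏ᶠ p, F p z) p = wirtD (F p) p * r ∧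
      wirtDbar (fun z => ∏ᶠ p, F p z) p = wirtDbar (F p) p * r := fun p hp => by
    obtain ⟨T, hT, hpT, heq⟩ := hloc p (hZW hp)
    have heq2 : (fun z => ∏ᶠ p, F p z) =ᶠ[𝓝 p] fun z => F p z * ∏ p' ∈ T.erase p, F p' z := by
      filter_upwards [heq] with z hz
      rw [hz, Finset.mul_prod_erase _ (fun p' => F p' z) (hpT hp)]
    have hd1 := (hFs p).differentiableAt_of_mem hW (hZW hp)
    have hd2 : DifferentiableAt ℝ (fun z => ∏ p' ∈ T.erase p, F p' z) p :=
      (contDiffOn_prod fun p' _ => hFs p').differentiableAt_of_mem hW (hZW hp)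
    have h0 := (hF0 p p (hZW hp)).2 ⟨hp, rfl⟩
    refine ⟨∏ p' ∈ T.erase p, F p' p, Finset.prod_ne_zero_iff.2 fun p' hp' h => ?_, ?_, ?_⟩
    · exact Finset.ne_of_mem_erase hp' ((hF0 p' p (hZW hp)).1 h).2.symm
    · rw [wirtD_congr heq2, wirtD_mul hd1 hd2, h0]; ring
    · rw [wirtDbar_congr heq2, wirtDbar_mul hd1 hd2, h0]; ring
  refine ⟨fun z => ∏ᶠ p, F p z, fun z hz => ?_, fun z hz => ?_, fun p hp hQ => ?_, fun p hp hQ => ?_⟩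
  · obtain ⟨T, -, -, heq⟩ := hloc z hz
    exact (((contDiffOn_prod fun p' _ => hFs p').contDiffAt
      (hW.mem_nhds hz)).congr_of_eventuallyEq heq).contDiffWithinAt
  · obtain ⟨T, hT, hzT, heq⟩ := hloc z hz
    rw [heq.self_of_nhds, Finset.prod_eq_zero_iff]
    refine ⟨fun ⟨p, _, hp⟩ => ?_, fun h => ⟨z, hzT h, (hF0 z z hz).2 ⟨h, rfl⟩⟩⟩
    obtain ⟨hpZ, rfl⟩ := (hF0 p z hz).1 hp
    exact hpZ
  · obtain ⟨r, hr, h1, h2⟩ := hderiv p hp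
    obtain ⟨h3, h4⟩ := (hFd p hp).1 hQ
    exact ⟨h1 ▸ mul_ne_zero h3 hr, by rw [h2, h4, zero_mul]⟩
  · obtain ⟨r, hr, h1, h2⟩ := hderiv p hp
    obtain ⟨h3, h4⟩ := (hFd p hp).2 hQ
    exact ⟨by rw [h1, h3, zero_mul], h2 ▸ mul_ne_zero h4 hr⟩

end PrescribedZeros

/-! ### Triviality of the line spanned by the rows. -/

section NonvanishingSection

/-- Up to `o(‖v‖²)`, `conj P * T` at `p + v` is the product of the two differentials, whose real
part is at least `c ‖v‖²` and absorbs the error. -/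
theorem eventually_re_conj_mul_nonneg {P T : ℂ → ℂ} {p : ℂ} (hP : DifferentiableAt ℝ P p)
    (hT : DifferentiableAt ℝ T p) (hP0 : P p = 0) (hT0 : T p = 0) {c : ℝ} (hc : 0 < c)
    (h : ∀ v, c * ‖v‖ ^ 2 ≤ (conj (fderiv ℝ P p v) * fderiv ℝ T p v).re) :
    ∀ᶠ z in 𝓝 p, 0 ≤ (conj (P z) * T z).re := by
  have hPo := hP.hasFDerivAt.isLittleO
  have hTo := hT.hasFDerivAt.isLittleO
  have hPO := hP.hasFDerivAt.isBigO_sub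
  have hTO : (fun z => fderiv ℝ T p (z - p)) =O[𝓝 p] fun z => z - p :=
    (fderiv ℝ T p).isBigO_sub (𝓝 p) p
  simp only [hP0, hT0, sub_zero] at hPo hTo hPO
  have hPO' : (fun z => conj (P z)) =O[𝓝 p] fun z => z - p :=
    hPO.norm_left.congr_left (fun z => (RCLike.norm_conj (P z)).symm) |>.of_norm_left
  have hPo' : (fun z => conj (P z - fderiv ℝ P p (z - p))) =o[𝓝 p] fun z => z - p :=
    hPo.norm_left.congr_left (fun z => (RCLike.norm_conj _).symm) |>.of_norm_left
  have hsum := (hPO'.mul_isLittleO hTo).add (hPo'.mul_isBigO hTO)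
  filter_upwards [hsum.bound hc] with z hz
  have h1 := h (z - p)
  have h2 : conj (P z) * T z = conj (fderiv ℝ P p (z - p)) * fderiv ℝ T p (z - p) +
      (conj (P z) * (T z - fderiv ℝ T p (z - p)) +
        conj (P z - fderiv ℝ P p (z - p)) * fderiv ℝ T p (z - p)) := by
    rw [map_sub (starRingEnd ℂ) (P z)]; ring
  rw [h2, Complex.add_re]
  have h3 := (Complex.abs_re_le_norm _).trans hz
  rw [norm_mul, ← sq] at h3
  linarith [neg_abs_le (conj (P z) * (T z - fderiv ℝ T p (z - p)) +
        conj (P z - fderiv ℝ P p (z - p)) * fderiv ℝ T p (z - p)).re]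

/-- `α v` will be the differential of `P` and the other factor that of `T`. The right side is `‖α‖²
m` times the real part of `‖A‖²‖v‖² + B Ā v̄²`, and the second term is dominated when `‖B‖ < ‖A‖`.
-/
theorem le_re_conj_mul_of_norm_lt (α A B v : ℂ) (m : ℝ) (hm : 0 ≤ m) :
    ‖α‖ ^ 2 * m * (‖A‖ * (‖A‖ - ‖B‖)) * ‖v‖ ^ 2 ≤
      (conj (α * v) * ((A * v + B * conj v) * (m * conj (conj α * A)))).re := by
  have h1 : conj (α * v) * ((A * v + B * conj v) * (m * conj (conj α * A))) =
      ((‖α‖ ^ 2 * m : ℝ) : ℂ) * (((‖A‖ ^ 2 * ‖v‖ ^ 2 : ℝ) : ℂ) + B * conj A * conj v ^ 2) := by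
    push_cast
    rw [← Complex.mul_conj', ← Complex.mul_conj', ← Complex.mul_conj']
    simp only [map_mul, Complex.conj_conj]
    ring
  rw [h1, Complex.re_ofReal_mul, Complex.add_re, Complex.ofReal_re, mul_assoc (‖α‖ ^ 2 * m)]
  refine mul_le_mul_of_nonneg_left ?_ (by positivity)
  have h2 := Complex.abs_re_le_norm (B * conj A * conj v ^ 2)
  simp only [norm_mul, norm_pow, RCLike.norm_conj] at h2
  nlinarith [neg_abs_le (B * conj A * conj v ^ 2).re]

theorem le_re_conj_mul_of_lt_norm (α A B v : ℂ) (m : ℝ) (hm : 0 ≤ m) :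
    ‖α‖ ^ 2 * m * (‖B‖ * (‖B‖ - ‖A‖)) * ‖v‖ ^ 2 ≤
      (conj (α * conj v) * ((A * v + B * conj v) * (m * conj (conj α * B)))).re := by
  have := le_re_conj_mul_of_norm_lt α B A (conj v) m hm
  rwa [RCLike.norm_conj, Complex.conj_conj, add_comm (B * conj v)] at this

theorem finite_inter_of_isolated {X : Type*} [TopologicalSpace X] {Z K : Set X} (hK : IsCompact K)
    (h : ∀ p ∈ K, ∃ U ∈ 𝓝 p, Z ∩ U ⊆ {p}) : (Z ∩ K).Finite := by
  choose! U hU hZ using h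
  obtain ⟨t, htK, ht⟩ := hK.elim_nhds_subcover U hU
  refine t.finite_toSet.subset fun z hz => ?_
  obtain ⟨p, hp, hzp⟩ := mem_iUnion₂.1 (ht hz.2)
  rw [mem_singleton_iff.1 (hZ p (htK p hp) ⟨hz.1, hzp⟩)]
  exact hp

/-- `‖A v + B v̄‖ ≥ |‖A‖ - ‖B‖| ‖v‖`, so the differential is bounded below and the zero, if `p` is
one, is isolated. -/
theorem eventually_ne_zero_of_wirt {f : ℂ → ℂ} {p A B m : ℂ} (hf : DifferentiableAt ℝ f p)
    (hAB : ‖A‖ ≠ ‖B‖) (hm : m ≠ 0) (hA : wirtD f p = A * m) (hB : wirtDbar f p = B * m) :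
    ∀ᶠ z in 𝓝[≠] p, f z ≠ 0 := by
  have hpos : 0 < |‖A‖ - ‖B‖| * ‖m‖ := by
    have := abs_pos.2 (sub_ne_zero.2 hAB)
    positivity
  refine hf.hasFDerivAt.eventually_ne ⟨(|‖A‖ - ‖B‖| * ‖m‖)⁻¹.toNNReal,
    ContinuousLinearMap.antilipschitz_of_bound _ fun v => ?_⟩
  rw [Real.coe_toNNReal _ (inv_pos.2 hpos).le, inv_mul_eq_div, le_div_iff₀ hpos, fderiv_apply_eq_wirtD, hA, hB]
  have h1 : A * m * v + B * m * conj v = m * (A * v - -(B * conj v)) := by ring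
  have h2 := abs_norm_sub_norm_le (A * v) (-(B * conj v))
  rw [norm_neg, norm_mul, norm_mul, RCLike.norm_conj, ← sub_mul, abs_mul, abs_norm] at h2
  rw [h1, norm_mul]
  calc ‖v‖ * (|‖A‖ - ‖B‖| * ‖m‖) = ‖m‖ * (|‖A‖ - ‖B‖| * ‖v‖) := by ring
    _ ≤ _ := mul_le_mul_of_nonneg_left h2 (norm_nonneg _)

/-- The row space of a smooth family of complex `2 × 2` matrices of rank one over an open subset of
the plane is spanned by a smooth nowhere vanishing vector function. -/
theorem exists_nonvanishing_section {W : Set ℂ} (hW : IsOpen W) {a b c d : ℂ → ℂ}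
    (ha : ContDiffOn ℝ ∞ a W) (hb : ContDiffOn ℝ ∞ b W) (hc : ContDiffOn ℝ ∞ c W)
    (hd : ContDiffOn ℝ ∞ d W) (hdet : ∀ z ∈ W, a z * d z = b z * c z)
    (hne : ∀ z ∈ W, a z ≠ 0 ∨ b z ≠ 0 ∨ c z ≠ 0 ∨ d z ≠ 0) :
    ∃ v₁ v₂ : ℂ → ℂ, ContDiffOn ℝ ∞ v₁ W ∧ ContDiffOn ℝ ∞ v₂ W ∧
      ∀ z ∈ W, (v₁ z ≠ 0 ∨ v₂ z ≠ 0) ∧ a z * v₂ z = b z * v₁ z ∧ c z * v₂ z = d z * v₁ z := by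
  obtain ⟨κ, hκ⟩ := exists_regular_combination hW ha hb hc hd hdet hne
  set s₁ : ℂ → ℂ := fun z => c z - κ * a z with hs₁
  set s₂ : ℂ → ℂ := fun z => d z - κ * b z with hs₂
  have hs₁s : ContDiffOn ℝ ∞ s₁ W := hc.sub (contDiffOn_const.mul ha)
  have hs₂s : ContDiffOn ℝ ∞ s₂ W := hd.sub (contDiffOn_const.mul hb)
  have hdiff {f : ℂ → ℂ} (hf : ContDiffOn ℝ ∞ f W) {z : ℂ} (hz : z ∈ W) :
    DifferentiableAt ℝ f z := hf.differentiableAt_of_mem hW hz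
  set Z : Set ℂ := {z | z ∈ W ∧ s₁ z = 0 ∧ s₂ z = 0} with hZ
  have hZW : Z ⊆ W := fun z hz => hz.1
  choose! hab A B hAB h1A h1B h2A h2B using fun (p : ℂ) (hp : p ∈ Z) => hκ p hp.1 hp.2.1 hp.2.2
  have hiso : ∀ p ∈ W, ∃ U ∈ 𝓝 p, Z ∩ U ⊆ {p} := fun p hp => by
    have hone : ∀ f : ℂ → ℂ, (∀ z ∈ Z, f z = 0) → (∀ᶠ z in 𝓝[≠] p, f z ≠ 0) →
        ∃ U ∈ 𝓝 p, Z ∩ U ⊆ {p} := fun f hfZ hf => by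
      refine ⟨_, eventually_nhdsWithin_iff.1 hf, fun z hz => ?_⟩
      by_contra hzp
      exact hz.2 hzp (hfZ z hz.1)
    by_cases hpZ : p ∈ Z
    · rcases hab p hpZ with h | h
      · exact hone s₁ (fun z hz => hz.2.1)
          (eventually_ne_zero_of_wirt (hdiff hs₁s hp) (hAB p hpZ) h (h1A p hpZ) (h1B p hpZ))
      · exact hone s₂ (fun z hz => hz.2.2)
          (eventually_ne_zero_of_wirt (hdiff hs₂s hp) (hAB p hpZ) h (h2A p hpZ) (h2B p hpZ))
    · have : s₁ p ≠ 0 ∨ s₂ p ≠ 0 := by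
        by_contra! hcon
        exact hpZ ⟨hp, hcon⟩
      rcases this with h | h
      · exact hone s₁ (fun z hz => hz.2.1)
          (((hdiff hs₁s hp).continuousAt.eventually_ne h).filter_mono nhdsWithin_le_nhds)
      · exact hone s₂ (fun z hz => hz.2.2)
          (((hdiff hs₂s hp).continuousAt.eventually_ne h).filter_mono nhdsWithin_le_nhds)
  -- `‖B p‖ < ‖A p‖` means that `s` has local degree `+1` at `p`, otherwise `-1`. `P` has the same
  -- zeros with the same degrees, so `conj P * s` has degree zero at each of them.
  obtain ⟨P, hPs, hP0, hPp, hPn⟩ := exists_smooth_prescribed_zeros hW hZW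
    (fun K hKW hK => finite_inter_of_isolated hK fun p hp => hiso p (hKW hp))
    fun p => ‖B p‖ < ‖A p‖
  have hPD := hPs.wirtD hW
  have hPDb := hPs.wirtDbar hW
  -- At a zero `p` this vector is `σ (a p, b p)` with `σ ≠ 0`, where `σ` is the multiplier for which
  -- `conj P * ⟨s, S⟩` has nonnegative real part near `p`. Being defined on all of `W`, it needs no
  -- patching of local choices.
  set S₁ : ℂ → ℂ := fun z =>
    conj (wirtD P z) * wirtD s₁ z + conj (wirtDbar P z) * wirtDbar s₁ z with hS₁
  set S₂ : ℂ → ℂ := fun z =>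
    conj (wirtD P z) * wirtD s₂ z + conj (wirtDbar P z) * wirtDbar s₂ z with hS₂
  have hS₁s : ContDiffOn ℝ ∞ S₁ W := (hPD.conj_comp.mul (hs₁s.wirtD hW)).add
    (hPDb.conj_comp.mul (hs₁s.wirtDbar hW))
  have hS₂s : ContDiffOn ℝ ∞ S₂ W := (hPD.conj_comp.mul (hs₂s.wirtD hW)).add
    (hPDb.conj_comp.mul (hs₂s.wirtDbar hW))
  set y : ℂ → ℂ := fun z => S₁ z * conj (a z) + S₂ z * conj (b z) with hy
  have hys : ContDiffOn ℝ ∞ y W := (hS₁s.mul ha.conj_comp).add (hS₂s.mul hb.conj_comp)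
  set T : ℂ → ℂ := fun z => s₁ z * conj (S₁ z) + s₂ z * conj (S₂ z) with hT
  have hTs : ContDiffOn ℝ ∞ T W := (hs₁s.mul hS₁s.conj_comp).add (hs₂s.mul hS₂s.conj_comp)
  set N : Set ℂ := interior {z | z ∈ W ∧ 0 ≤ (conj (P z) * T z).re ∧ y z ≠ 0} with hN
  have hZN : Z ⊆ N := fun p hp => by
    have hpW := hZW hp
    set m : ℝ := ‖a p‖ ^ 2 + ‖b p‖ ^ 2 with hm
    have hm0 : 0 < m := by rcases hab p hp with h | h <;> positivity
    have hmc : (m : ℂ) = a p * conj (a p) + b p * conj (b p) := by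
      rw [Complex.mul_conj', Complex.mul_conj', hm]; push_cast; ring
    set σ : ℂ := conj (wirtD P p) * A p + conj (wirtDbar P p) * B p with hσ
    have hS₁p : S₁ p = σ * a p := by simp only [hS₁, hσ, h1A p hp, h1B p hp]; ring
    have hS₂p : S₂ p = σ * b p := by simp only [hS₂, hσ, h2A p hp, h2B p hp]; ring
    have hyp : y p = σ * m := by simp only [hy, hS₁p, hS₂p, hmc]; ring
    have hT0 : T p = 0 := by simp only [hT, hp.2.1, hp.2.2, zero_mul, add_zero]
    have hP0' : P p = 0 := (hP0 p hpW).2 hp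
    have hTA : wirtD T p = A p * (m * conj σ) := by
      rw [hT, wirtD_add (hdiff (hs₁s.mul hS₁s.conj_comp) hpW) (hdiff (hs₂s.mul hS₂s.conj_comp) hpW),
        wirtD_mul (hdiff hs₁s hpW) (hdiff hS₁s.conj_comp hpW),
        wirtD_mul (hdiff hs₂s hpW) (hdiff hS₂s.conj_comp hpW), hp.2.1, hp.2.2, h1A p hp, h2A p hp,
        hS₁p, hS₂p, hmc]
      simp only [map_mul]; ring
    have hTB : wirtDbar T p = B p * (m * conj σ) := by
      rw [hT, wirtDbar_add (hdiff (hs₁s.mul hS₁s.conj_comp) hpW)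
        (hdiff (hs₂s.mul hS₂s.conj_comp) hpW),
        wirtDbar_mul (hdiff hs₁s hpW) (hdiff hS₁s.conj_comp hpW),
        wirtDbar_mul (hdiff hs₂s hpW) (hdiff hS₂s.conj_comp hpW), hp.2.1, hp.2.2, h1B p hp,
        h2B p hp, hS₁p, hS₂p, hmc]
      simp only [map_mul]; ring
    have hDT : ∀ v, fderiv ℝ T p v = (A p * v + B p * conj v) * (m * conj σ) := fun v => by
      rw [fderiv_apply_eq_wirtD, hTA, hTB]; ring
    have hmain : σ ≠ 0 ∧ ∀ᶠ z in 𝓝 p, 0 ≤ (conj (P z) * T z).re := by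
      by_cases hQ : ‖B p‖ < ‖A p‖
      · obtain ⟨hα, hβ⟩ := hPp p hp hQ
        have hA0 : 0 < ‖A p‖ := (norm_nonneg _).trans_lt hQ
        have hσ' : σ = conj (wirtD P p) * A p := by rw [hσ, hβ]; simp
        have hα' : 0 < ‖wirtD P p‖ := norm_pos_iff.2 hα
        refine ⟨by rw [hσ']; exact mul_ne_zero ((map_ne_zero _).2 hα) (norm_pos_iff.1 hA0),
          eventually_re_conj_mul_nonneg (hdiff hPs hpW) (hdiff hTs hpW) hP0' hT0
            (c := ‖wirtD P p‖ ^ 2 * m * (‖A p‖ * (‖A p‖ - ‖B p‖)))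
            (mul_pos (by positivity) (mul_pos hA0 (sub_pos.2 hQ))) fun v => ?_⟩
        rw [hDT, fderiv_apply_eq_wirtD P, hβ, zero_mul, add_zero, hσ']
        exact le_re_conj_mul_of_norm_lt _ _ _ _ _ hm0.le
      · obtain ⟨hα, hβ⟩ := hPn p hp hQ
        have hQ' : ‖A p‖ < ‖B p‖ := lt_of_le_of_ne (not_lt.1 hQ) (hAB p hp)
        have hB0 : 0 < ‖B p‖ := (norm_nonneg _).trans_lt hQ'
        have hσ' : σ = conj (wirtDbar P p) * B p := by rw [hσ, hα]; simp
        have hβ' : 0 < ‖wirtDbar P p‖ := norm_pos_iff.2 hβ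
        refine ⟨by rw [hσ']; exact mul_ne_zero ((map_ne_zero _).2 hβ) (norm_pos_iff.1 hB0),
          eventually_re_conj_mul_nonneg (hdiff hPs hpW) (hdiff hTs hpW) hP0' hT0
            (c := ‖wirtDbar P p‖ ^ 2 * m * (‖B p‖ * (‖B p‖ - ‖A p‖)))
            (mul_pos (by positivity) (mul_pos hB0 (sub_pos.2 hQ'))) fun v => ?_⟩
        rw [hDT, fderiv_apply_eq_wirtD P, hα, zero_mul, zero_add, hσ']
        exact le_re_conj_mul_of_lt_norm _ _ _ _ _ hm0.le
    rw [hN, mem_interior_iff_mem_nhds]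
    have hyne : y p ≠ 0 := by
      rw [hyp]; exact mul_ne_zero hmain.1 (by exact_mod_cast hm0.ne')
    exact Filter.Eventually.and (hW.mem_nhds hpW)
      (hmain.2.and ((hdiff hys hpW).continuousAt.eventually_ne hyne))
  -- The perturbation `y (a, b)` is switched on exactly on the open set `N`, which contains all
  -- zeros of `s`; it stays in the line of the rows.
  obtain ⟨η, hηN, hηs, hη01⟩ :=
    IsOpen.exists_contDiff_support_eq (n := ⊤) (isOpen_interior : IsOpen N)
  change Function.support η = N at hηN
  have hηc : ContDiff ℝ ∞ fun z => (η z : ℂ) := Complex.ofRealCLM.contDiff.comp hηs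
  refine ⟨fun z => conj (P z) * s₁ z + η z * (y z * a z),
    fun z => conj (P z) * s₂ z + η z * (y z * b z),
    (hPs.conj_comp.mul hs₁s).add (hηc.contDiffOn.mul (hys.mul ha)),
    (hPs.conj_comp.mul hs₂s).add (hηc.contDiffOn.mul (hys.mul hb)), fun z hz => ⟨?_, ?_, ?_⟩⟩
  · by_cases hzN : z ∈ N
    · by_contra! hcon
      obtain ⟨-, hre, hy0⟩ := interior_subset hzN
      have hη0 : 0 < η z := lt_of_le_of_ne (hη01 ⟨z, rfl⟩).1 (Ne.symm (by
        rw [← hηN] at hzN; exact hzN))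
      -- Pairing the perturbed vector with `S` gives a number of real part at least `η ‖y‖² > 0` on
      -- `N`, so the vector cannot vanish there.
      have h1 : conj (P z) * T z + η z * (y z * conj (y z)) = 0 := by
        simp only [hT]
        have h2 : conj (y z) = conj (S₁ z) * a z + conj (S₂ z) * b z := by simp [hy]
        rw [h2]
        linear_combination conj (S₁ z) * hcon.1 + conj (S₂ z) * hcon.2
      have h3 := congrArg Complex.re h1
      rw [Complex.mul_conj', ← Complex.ofReal_pow, Complex.add_re, Complex.re_ofReal_mul,
        Complex.ofReal_re, Complex.zero_re] at h3
      have : 0 < η z * ‖y z‖ ^ 2 := by positivity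
      linarith
    · have hη0 : η z = 0 := by
        by_contra h0
        exact hzN (hηN ▸ h0)
      have hzZ : z ∉ Z := fun h => hzN (hZN h)
      have hP : conj (P z) ≠ 0 := (map_ne_zero _).2 fun h => hzZ ((hP0 z hz).1 h)
      simp only [hη0, Complex.ofReal_zero, zero_mul, add_zero]
      by_contra! hcon
      exact hzZ ⟨hz, (mul_eq_zero.1 hcon.1).resolve_left hP, (mul_eq_zero.1 hcon.2).resolve_left hP⟩
  · simp only [hs₁, hs₂]
    linear_combination conj (P z) * hdet z hz
  · simp only [hs₁, hs₂]
    linear_combination (κ * conj (P z) - η z * y z) * hdet z hz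

end NonvanishingSection

/-! ### From rank one matrices to Dirac spinors. -/

section DiracSpinors

variable {W : Set ℂ}

theorem wirtDbar_wirtD_comm (hW : IsOpen W) {f : ℂ → ℂ} (hf : ContDiffOn ℝ ∞ f W) {z : ℂ}
    (hz : z ∈ W) : wirtDbar (wirtD f) z = wirtD (wirtDbar f) z := by
  have hfz : ContDiffAt ℝ ∞ f z := hf.contDiffAt (hW.mem_nhds hz)
  have hD : DifferentiableAt ℝ (fderiv ℝ f) z :=
    (hfz.fderiv_right (m := ∞) (by simp)).differentiableAt (by simp)
  have hsymm : IsSymmSndFDerivAt ℝ f z := hfz.isSymmSndFDerivAt (by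
    simp only [minSmoothness_of_isRCLikeNormedField]; exact WithTop.coe_le_coe.2 (le_top : (2 : ℕ∞) ≤ ⊤))
  have h1 : ∀ v w, fderiv ℝ (fun z => fderiv ℝ f z v) z w = fderiv ℝ (fderiv ℝ f) z w v :=
    fun v w => by
      rw [fderiv_clm_apply hD (differentiableAt_const v)]
      simp
  have hd : ∀ v, DifferentiableAt ℝ (fun z => fderiv ℝ f z v) z := fun v =>
    hD.clm_apply (differentiableAt_const v)
  have h2 : ∀ w, fderiv ℝ (wirtD f) z w = (fderiv ℝ (fderiv ℝ f) z w 1 -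
      Complex.I * fderiv ℝ (fderiv ℝ f) z w Complex.I) * 2⁻¹ := fun w => by
    have : wirtD f = fun z => (fderiv ℝ f z 1 - Complex.I * fderiv ℝ f z Complex.I) * 2⁻¹ := rfl
    rw [this, fderiv_mul_const ((hd 1).fun_sub ((hd _).const_mul _)),
      fderiv_fun_sub (hd 1) ((hd _).const_mul _), fderiv_const_mul (hd _)]
    simp [h1]; ring
  have h3 : ∀ w, fderiv ℝ (wirtDbar f) z w = (fderiv ℝ (fderiv ℝ f) z w 1 +
      Complex.I * fderiv ℝ (fderiv ℝ f) z w Complex.I) * 2⁻¹ := fun w => by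
    have : wirtDbar f = fun z => (fderiv ℝ f z 1 + Complex.I * fderiv ℝ f z Complex.I) * 2⁻¹ := rfl
    rw [this, fderiv_mul_const ((hd 1).fun_add ((hd _).const_mul _)),
      fderiv_fun_add (hd 1) ((hd _).const_mul _), fderiv_const_mul (hd _)]
    simp [h1]; ring
  rw [wirtDbar, wirtD, h2, h2, h3, h3, hsymm 1 Complex.I]
  ring

theorem normSq_add_normSq_eq (v₁ v₂ : ℂ) :
    v₁ * conj v₁ + v₂ * conj v₂ = ((‖v₁‖ ^ 2 + ‖v₂‖ ^ 2 : ℝ) : ℂ) := by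
  rw [Complex.mul_conj', Complex.mul_conj']; push_cast; ring

theorem normSq_add_normSq_ne_zero {v₁ v₂ : ℂ} (h : v₁ ≠ 0 ∨ v₂ ≠ 0) :
    v₁ * conj v₁ + v₂ * conj v₂ ≠ 0 := by
  rw [normSq_add_normSq_eq]
  have : (0 : ℝ) < ‖v₁‖ ^ 2 + ‖v₂‖ ^ 2 := by rcases h with h | h <;> positivity
  exact_mod_cast this.ne'

/-- A nowhere vanishing smooth vector function can be rescaled so that its `∂̄`-derivative is
orthogonal to it. -/
theorem exists_rescaling_dbar_orthogonal (hW : IsOpen W) {w₁ w₂ : ℂ → ℂ}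
    (h₁ : ContDiffOn ℝ ∞ w₁ W) (h₂ : ContDiffOn ℝ ∞ w₂ W) (hne : ∀ z ∈ W, w₁ z ≠ 0 ∨ w₂ z ≠ 0) :
    ∃ ρ : ℂ → ℂ, ContDiffOn ℝ ∞ ρ W ∧ (∀ z, ρ z ≠ 0) ∧ ∀ z ∈ W,
      wirtDbar (fun z => ρ z * w₁ z) z * conj (ρ z * w₁ z) +
        wirtDbar (fun z => ρ z * w₂ z) z * conj (ρ z * w₂ z) = 0 := by
  set n : ℂ → ℂ := fun z => w₁ z * conj (w₁ z) + w₂ z * conj (w₂ z) with hn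
  have hns : ContDiffOn ℝ ∞ n W := (h₁.mul h₁.conj_comp).add (h₂.mul h₂.conj_comp)
  have hn0 : ∀ z ∈ W, n z ≠ 0 := fun z hz => normSq_add_normSq_ne_zero (hne z hz)
  -- Orthogonality of `∂̄(e^h w)` and `e^h w` is `∂̄h ⟨w, w⟩ + ⟨∂̄w, w⟩ = 0`, so `g` is the required
  -- value of `∂̄h`.
  set g : ℂ → ℂ := fun z =>
    -(wirtDbar w₁ z * conj (w₁ z) + wirtDbar w₂ z * conj (w₂ z)) * (n z)⁻¹ with hg
  have hgs : ContDiffOn ℝ ∞ g W :=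
    (((h₁.wirtDbar hW).mul h₁.conj_comp).add ((h₂.wirtDbar hW).mul h₂.conj_comp)).neg.mul
      (hns.inv hn0)
  obtain ⟨h, hh, hhg⟩ := exists_wirtDbar_eq hW hgs
  have hρ : ContDiffOn ℝ ∞ (fun z => Complex.exp (h z)) W := hh.cexp
  refine ⟨fun z => Complex.exp (h z), hρ, fun z => Complex.exp_ne_zero _, fun z hz => ?_⟩
  have hρz := hρ.differentiableAt_of_mem hW hz
  rw [wirtDbar_mul hρz (h₁.differentiableAt_of_mem hW hz),
    wirtDbar_mul hρz (h₂.differentiableAt_of_mem hW hz),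
    wirtDbar_cexp (hh.differentiableAt_of_mem hW hz), hhg z hz]
  have h3 : g z * n z = -(wirtDbar w₁ z * conj (w₁ z) + wirtDbar w₂ z * conj (w₂ z)) := by
    simp only [hg]; rw [inv_mul_cancel_right₀ (hn0 z hz)]
  simp only [hn] at h3
  simp only [map_mul]
  linear_combination (Complex.exp (h z) * conj (Complex.exp (h z))) * h3

/-- Factorization of a smooth rank one matrix function, subject to the reality condition of
`∂̄∂x`, into a solution of the two Dirac equations. -/
theorem exists_dirac_factorization (hW : IsOpen W) {a b c d : ℂ → ℂ}
    (ha : ContDiffOn ℝ ∞ a W) (hb : ContDiffOn ℝ ∞ b W) (hc : ContDiffOn ℝ ∞ c W)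
    (hd : ContDiffOn ℝ ∞ d W) (hdet : ∀ z ∈ W, a z * d z = b z * c z)
    (hne : ∀ z ∈ W, a z ≠ 0 ∨ b z ≠ 0 ∨ c z ≠ 0 ∨ d z ≠ 0)
    (had : ∀ z ∈ W, wirtDbar d z = -conj (wirtDbar a z))
    (hbc : ∀ z ∈ W, wirtDbar b z = conj (wirtDbar c z)) :
    ∃ u₁ u₂ v₁ v₂ U : ℂ → ℂ, ContDiffOn ℝ ∞ u₁ W ∧ ContDiffOn ℝ ∞ u₂ W ∧ ContDiffOn ℝ ∞ v₁ W ∧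
      ContDiffOn ℝ ∞ v₂ W ∧ ContDiffOn ℝ ∞ U W ∧ ∀ z ∈ W,
        (a z = u₁ z * v₁ z ∧ b z = u₁ z * v₂ z ∧ c z = u₂ z * v₁ z ∧ d z = u₂ z * v₂ z) ∧
        (wirtDbar v₁ z = conj (U z) * conj (v₂ z) ∧ wirtDbar v₂ z = -(conj (U z) * conj (v₁ z))) ∧
        (wirtDbar u₁ z = U z * conj (u₂ z) ∧ wirtDbar u₂ z = -(U z * conj (u₁ z))) := by
  obtain ⟨w₁, w₂, hw₁, hw₂, hw⟩ := exists_nonvanishing_section hW ha hb hc hd hdet hne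
  obtain ⟨ρ, hρ, hρ0, hort⟩ := exists_rescaling_dbar_orthogonal hW hw₁ hw₂ fun z hz => (hw z hz).1
  set v₁ : ℂ → ℂ := fun z => ρ z * w₁ z with hv₁
  set v₂ : ℂ → ℂ := fun z => ρ z * w₂ z with hv₂
  have hv₁s : ContDiffOn ℝ ∞ v₁ W := hρ.mul hw₁
  have hv₂s : ContDiffOn ℝ ∞ v₂ W := hρ.mul hw₂
  set n : ℂ → ℂ := fun z => v₁ z * conj (v₁ z) + v₂ z * conj (v₂ z) with hn
  have hns : ContDiffOn ℝ ∞ n W := (hv₁s.mul hv₁s.conj_comp).add (hv₂s.mul hv₂s.conj_comp)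
  have hn0 : ∀ z ∈ W, n z ≠ 0 := fun z hz => normSq_add_normSq_ne_zero (by
    rcases (hw z hz).1 with h | h
    · exact Or.inl (mul_ne_zero (hρ0 z) h)
    · exact Or.inr (mul_ne_zero (hρ0 z) h))
  have hninv := hns.inv hn0
  -- In `ℂ²` the orthogonal complement of `v` is spanned by `(v̄₂, -v̄₁)`; `V` is the coefficient of
  -- `∂̄v` along it, and the potential is `U = V̄`.
  set V : ℂ → ℂ := fun z => (wirtDbar v₁ z * v₂ z - wirtDbar v₂ z * v₁ z) * (n z)⁻¹ with hV
  have hVs : ContDiffOn ℝ ∞ V W := (((hv₁s.wirtDbar hW).mul hv₂s).sub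
    ((hv₂s.wirtDbar hW).mul hv₁s)).mul hninv
  -- The rows are multiples of `v`; Hermitian projection gives the multipliers smoothly.
  set u₁ : ℂ → ℂ := fun z => (a z * conj (v₁ z) + b z * conj (v₂ z)) * (n z)⁻¹ with hu₁
  set u₂ : ℂ → ℂ := fun z => (c z * conj (v₁ z) + d z * conj (v₂ z)) * (n z)⁻¹ with hu₂
  have hu₁s : ContDiffOn ℝ ∞ u₁ W :=
    ((ha.mul hv₁s.conj_comp).add (hb.mul hv₂s.conj_comp)).mul hninv
  have hu₂s : ContDiffOn ℝ ∞ u₂ W :=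
    ((hc.mul hv₁s.conj_comp).add (hd.mul hv₂s.conj_comp)).mul hninv
  have hfac : ∀ z ∈ W, a z = u₁ z * v₁ z ∧ b z = u₁ z * v₂ z ∧ c z = u₂ z * v₁ z ∧
      d z = u₂ z * v₂ z := fun z hz => by
    obtain ⟨-, h1, h2⟩ := hw z hz
    have h1' : a z * v₂ z = b z * v₁ z := by simp only [hv₁, hv₂]; linear_combination ρ z * h1
    have h2' : c z * v₂ z = d z * v₁ z := by simp only [hv₁, hv₂]; linear_combination ρ z * h2
    have h0 := hn0 z hz
    simp only [hu₁, hu₂]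
    refine ⟨?_, ?_, ?_, ?_⟩ <;> rw [mul_right_comm, eq_mul_inv_iff_mul_eq₀ h0] <;> simp only [hn]
    · linear_combination conj (v₂ z) * h1'
    · linear_combination -conj (v₁ z) * h1'
    · linear_combination conj (v₂ z) * h2'
    · linear_combination -conj (v₁ z) * h2'
  have hdv : ∀ z ∈ W, wirtDbar v₁ z = V z * conj (v₂ z) ∧ wirtDbar v₂ z = -(V z * conj (v₁ z)) :=
    fun z hz => by
      have h0 := hn0 z hz
      have h1 := hort z hz
      constructor
      · simp only [hV]
        rw [mul_right_comm, eq_mul_inv_iff_mul_eq₀ h0]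
        simp only [hn]
        linear_combination v₁ z * h1
      · simp only [hV]
        rw [mul_right_comm, ← neg_mul, eq_mul_inv_iff_mul_eq₀ h0]
        simp only [hn]
        linear_combination v₂ z * h1
  refine ⟨u₁, u₂, v₁, v₂, fun z => conj (V z), hu₁s, hu₂s, hv₁s, hv₂s, hVs.conj_comp,
    fun z hz => ⟨hfac z hz, ?_, ?_⟩⟩
  · simpa only [Complex.conj_conj] using hdv z hz
  · have hdiff {f : ℂ → ℂ} (hf : ContDiffOn ℝ ∞ f W) : DifferentiableAt ℝ f z :=
      hf.differentiableAt_of_mem hW hz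
    have hpr : ∀ {f u v : ℂ → ℂ}, ContDiffOn ℝ ∞ u W → ContDiffOn ℝ ∞ v W →
        (∀ y ∈ W, f y = u y * v y) → wirtDbar f z = wirtDbar u z * v z + u z * wirtDbar v z :=
      fun hu hv h => by
        rw [wirtDbar_congr (Filter.eventuallyEq_of_mem (hW.mem_nhds hz) h),
          wirtDbar_mul (hdiff hu) (hdiff hv)]
    have ea := hpr hu₁s hv₁s fun y hy => (hfac y hy).1
    have eb := hpr hu₁s hv₂s fun y hy => (hfac y hy).2.1
    have ec := hpr hu₂s hv₁s fun y hy => (hfac y hy).2.2.1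
    have ed := hpr hu₂s hv₂s fun y hy => (hfac y hy).2.2.2
    have h1 := had z hz
    have h2 := hbc z hz
    rw [(hdv z hz).1] at ea ec
    rw [(hdv z hz).2] at eb ed
    rw [ea, ed] at h1
    rw [eb, ec] at h2
    set p := wirtDbar u₁ z
    set q := wirtDbar u₂ z
    have h0 := hn0 z hz
    simp only [hn] at h0
    -- With `P = p - V̄ ū₂` and `Q = q̄ + V u₁` the reality relations become `P v₂ = Q v̄₁` and `P
    -- v₁ = -Q v̄₂`. The determinant of this homogeneous system is `|v₁|² + |v₂|²` up to sign, so `P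
    -- = Q = 0`.
    have h3 := congrArg conj h2
    have h4 := congrArg conj h1
    simp only [map_add, map_mul, map_neg, Complex.conj_conj] at h1 h2 h3 h4
    constructor
    · refine sub_eq_zero.1 ((mul_eq_zero.1 (?_ : (p - conj (V z) * conj (u₂ z)) *
        (v₁ z * conj (v₁ z) + v₂ z * conj (v₂ z)) = 0)).resolve_right h0)
      linear_combination conj (v₂ z) * h2 + conj (v₁ z) * h4
    · rw [eq_neg_iff_add_eq_zero]
      refine (mul_eq_zero.1 (?_ : (q + conj (V z) * conj (u₁ z)) *
        (v₁ z * conj (v₁ z) + v₂ z * conj (v₂ z)) = 0)).resolve_right h0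
      linear_combination conj (v₂ z) * h1 - conj (v₁ z) * h3

end DiracSpinors

/-! ### The Weierstrass representation of a conformal immersion. -/

section ConformalImmersion

variable {W : Set ℂ} {X : ℂ → EuclideanSpace ℝ (Fin 4)}

theorem contDiffOn_coord_complex (hX : ContDiffOn ℝ ∞ X W) (k : Fin 4) :
    ContDiffOn ℝ ∞ (fun w => ((X w k : ℝ) : ℂ)) W :=
  Complex.ofRealCLM.contDiff.comp_contDiffOn
    ((EuclideanSpace.proj (𝕜 := ℝ) k).contDiff.comp_contDiffOn hX)

theorem fderiv_coord_complex {z : ℂ} (hX : DifferentiableAt ℝ X z) (k : Fin 4) (v : ℂ) :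
    fderiv ℝ (fun w => ((X w k : ℝ) : ℂ)) z v = ((fderiv ℝ X z v k : ℝ) : ℂ) := by
  have h := (Complex.ofRealCLM.hasFDerivAt.comp z
    ((EuclideanSpace.proj (𝕜 := ℝ) k).hasFDerivAt.comp z hX.hasFDerivAt))
  have h2 : HasFDerivAt (fun w => ((X w k : ℝ) : ℂ)) _ z := h
  rw [h2.fderiv]
  rfl

theorem wirtDbar_ofReal {x : ℂ → ℝ} {z : ℂ} (h : DifferentiableAt ℝ (fun w => (x w : ℂ)) z) :
    wirtDbar (fun w => (x w : ℂ)) z = conj (wirtD (fun w => (x w : ℂ)) z) := by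
  rw [← wirtDbar_conj h]
  exact wirtDbar_congr (Filter.Eventually.of_forall fun w => (Complex.conj_ofReal _).symm)

/-- `∂̄∂` is a quarter of the Laplacian, a real operator. This is the source of the two reality
hypotheses of `exists_dirac_factorization`. -/
theorem conj_wirtDbar_wirtD_ofReal (hW : IsOpen W) {x : ℂ → ℝ}
    (h : ContDiffOn ℝ ∞ (fun w => (x w : ℂ)) W) {z : ℂ} (hz : z ∈ W) :
    conj (wirtDbar (wirtD fun w => (x w : ℂ)) z) = wirtDbar (wirtD fun w => (x w : ℂ)) z := by
  rw [← wirtD_conj ((h.wirtD hW).differentiableAt_of_mem hW hz), wirtDbar_wirtD_comm hW h hz]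
  refine wirtD_congr (Filter.eventuallyEq_of_mem (hW.mem_nhds hz) fun w hw => ?_)
  exact (wirtDbar_ofReal (h.differentiableAt_of_mem hW hw)).symm

/-- Here `4 Σ f_k² = |X_x|² - |X_y|² - 2i⟨X_x, X_y⟩` and `4 Σ |f_k|² = |X_x|² + |X_y|²`. -/
theorem ConformalAt.sum_wirtD_coord_sq {z : ℂ} (hX : ConformalAt X z) :
    ∑ k, wirtD (fun w => ((X w k : ℝ) : ℂ)) z ^ 2 = 0 ∧
      ∑ k, ‖wirtD (fun w => ((X w k : ℝ) : ℂ)) z‖ ^ 2 = conformalFactor X z / 2 ∧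
      0 < conformalFactor X z := by
  have hd := hX.differentiableAt
  obtain ⟨c, hc, hin⟩ := conformalAt_iff'.1 hX
  have h11 := hin 1 1
  have hII := hin Complex.I Complex.I
  have h1I := hin 1 Complex.I
  have hcf : conformalFactor X z = c := by
    rw [conformalFactor, ← real_inner_self_eq_norm_sq, h11]; simp
  rw [hcf]
  simp only [PiLp.inner_apply, Fin.sum_univ_four, Complex.inner, map_one,
    Complex.conj_I, RCLike.inner_apply, conj_trivial] at h11 hII h1I
  simp at h11 hII h1I
  simp only [Fin.sum_univ_four, wirtD, fderiv_coord_complex hd]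
  generalize fderiv ℝ X z 1 = A at *
  generalize fderiv ℝ X z Complex.I = B at *
  have hn : ∀ s t : ℝ, ‖((s : ℂ) - Complex.I * t) / 2‖ ^ 2 = (s ^ 2 + t ^ 2) / 4 := fun s t => by
    rw [← Complex.normSq_eq_norm_sq, Complex.normSq_apply]
    simp; ring
  have h1 : (A 0 * A 0 + A 1 * A 1 + A 2 * A 2 + A 3 * A 3 : ℂ) = c := by exact_mod_cast h11
  have h2 : (B 0 * B 0 + B 1 * B 1 + B 2 * B 2 + B 3 * B 3 : ℂ) = c := by exact_mod_cast hII
  have h3 : (B 0 * A 0 + B 1 * A 1 + B 2 * A 2 + B 3 * A 3 : ℂ) = 0 := by exact_mod_cast h1I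
  refine ⟨?_, ?_, hc⟩
  · linear_combination (1 / 4 : ℂ) * h1 - (1 / 4 : ℂ) * h2 - (Complex.I / 2) * h3 +
      ((B 0 * B 0 + B 1 * B 1 + B 2 * B 2 + B 3 * B 3 : ℂ) / 4) * Complex.I_sq
  · simp only [hn]; linarith

theorem curveIntegral_eq_sub_of_fderiv {F : ℂ → ℂ} {ω' : ℂ → ℂ →L[ℝ] ℂ} (hW : IsOpen W)
    (hF : ContDiffOn ℝ ∞ F W) (hω : ∀ z ∈ W, ω' z = fderiv ℝ F z) {a b : ℂ} (γ : Path a b)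
    (hγW : ∀ t, γ t ∈ W) (hγ : ContDiffOn ℝ 1 γ.extend (Icc 0 1)) :
    curveIntegral ω' γ = F b - F a := by
  have hωc : ContinuousOn ω' W := (hF.continuousOn_fderiv_of_isOpen hW (by simp)).congr hω
  have hint := hωc.curveIntegrable_of_contDiffOn hγ hγW
  have hext : ∀ t, γ.extend t ∈ W := fun t => hγW _
  rw [curveIntegral_def]
  have hFd : ∀ t, HasFDerivAt F (ω' (γ.extend t)) (γ.extend t) := fun t => by
    rw [hω _ (hext t)]
    exact (hF.differentiableAt_of_mem hW (hext t)).hasFDerivAt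
  have := intervalIntegral.integral_eq_sub_of_hasDerivAt_of_le (f := fun t => F (γ.extend t))
    (f' := curveIntegralFun ω' γ) zero_le_one
    (hF.continuousOn.comp hγ.continuousOn fun t _ => hext t) (fun t ht => ?_) hint
  · rw [this]; simp
  · rw [curveIntegralFun_def]
    have h1 : HasDerivAt γ.extend (derivWithin γ.extend (Icc 0 1) t) t :=
      ((hγ.differentiableOn (by simp) t (Ioo_subset_Icc_self ht)).hasDerivWithinAt).hasDerivAt
        (Icc_mem_nhds ht.1 ht.2)
    exact (hFd t).comp_hasDerivAt t h1

/-- Every conformal immersion of an open subset of the plane into `ℝ⁴` has a Weierstrass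
representation. -/
theorem exists_weierstrassRepresentation (hW : IsOpen W) (hX : ContDiffOn ℝ ∞ X W)
    (hconf : ∀ z ∈ W, ConformalAt X z) :
    ∃ (ψ φ : ℂ → Fin 2 → ℂ) (U : ℂ → ℂ),
      IsWeierstrassRepresentation W X ψ φ U ∧
      (∀ z ∈ W, conformalFactor X z =
        (‖ψ z 0‖ ^ 2 + ‖ψ z 1‖ ^ 2) * (‖φ z 0‖ ^ 2 + ‖φ z 1‖ ^ 2)) ∧
      ∀ z ∈ W, ‖U z‖ = ‖meanCurvatureVector X z‖ * Real.sqrt (conformalFactor X z) / 2 := by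
  set f : Fin 4 → ℂ → ℂ := fun k => wirtD fun w => ((X w k : ℝ) : ℂ) with hf
  have hx := contDiffOn_coord_complex hX
  have hfs : ∀ k, ContDiffOn ℝ ∞ (f k) W := fun k => (hx k).wirtD hW
  have hfd : ∀ k, ∀ z ∈ W, DifferentiableAt ℝ (f k) z := fun k z hz =>
    (hfs k).differentiableAt_of_mem hW hz
  have hq : ∀ z ∈ W, f 0 z ^ 2 + f 1 z ^ 2 + f 2 z ^ 2 + f 3 z ^ 2 = 0 := fun z hz => by
    have := (hconf z hz).sum_wirtD_coord_sq.1
    rwa [Fin.sum_univ_four] at this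
  have hnorm : ∀ z ∈ W, 2 * (‖f 0 z‖ ^ 2 + ‖f 1 z‖ ^ 2 + ‖f 2 z‖ ^ 2 + ‖f 3 z‖ ^ 2) =
      conformalFactor X z := fun z hz => by
    have := (hconf z hz).sum_wirtD_coord_sq.2.1
    rw [Fin.sum_univ_four] at this
    linarith
  have hreal : ∀ k, ∀ z ∈ W, conj (wirtDbar (f k) z) = wirtDbar (f k) z := fun k z hz =>
    conj_wirtDbar_wirtD_ofReal hW (hx k) hz
  set I := Complex.I with hI
  have hadd : ∀ (j k : Fin 4) (s t : ℂ), ∀ z ∈ W, wirtDbar (fun w => s * f j w + t * f k w) z =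
      s * wirtDbar (f j) z + t * wirtDbar (f k) z := fun j k s t z hz => by
    rw [wirtDbar_add ((hfd j z hz).const_mul s) ((hfd k z hz).const_mul t),
      wirtDbar_const_mul _ (hfd j z hz), wirtDbar_const_mul _ (hfd k z hz)]
  have hsm : ∀ (j k : Fin 4) (s t : ℂ), ContDiffOn ℝ ∞ (fun w => s * f j w + t * f k w) W :=
    fun j k s t => (contDiffOn_const.mul (hfs j)).add (contDiffOn_const.mul (hfs k))
  -- With indices from 0, the matrix is `a = -f₁ - i f₀`, `b = f₂ + i f₃`, `c = f₂ - i f₃`, `d = f₁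
  -- - i f₀`; these are the four products of spinor components obtained by inverting the formulas
  -- for `f`.
  obtain ⟨u₁, u₂, v₁, v₂, U, hu₁, hu₂, hv₁, hv₂, hU, hall⟩ := exists_dirac_factorization hW
    (hsm 1 0 (-1) (-I)) (hsm 2 3 1 I) (hsm 2 3 1 (-I)) (hsm 1 0 1 (-I))
    (fun z hz => by
      linear_combination -(hq z hz) + (f 0 z ^ 2 + f 3 z ^ 2) * Complex.I_sq)
    (fun z hz => by
      by_contra! hcon
      obtain ⟨h1, h2, h3, h4⟩ := hcon
      have e1 : f 1 z = 0 := by linear_combination (h4 - h1) / 2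
      have e2 : f 2 z = 0 := by linear_combination (h2 + h3) / 2
      have e0 : I * f 0 z = 0 := by linear_combination -(h1 + h4) / 2
      have e3 : I * f 3 z = 0 := by linear_combination (h2 - h3) / 2
      have h5 := (hconf z hz).sum_wirtD_coord_sq.2.2
      rw [← hnorm z hz, e1, e2, (mul_eq_zero.1 e0).resolve_left Complex.I_ne_zero,
        (mul_eq_zero.1 e3).resolve_left Complex.I_ne_zero] at h5
      simp at h5)
    (fun z hz => by
      rw [hadd _ _ _ _ z hz, hadd _ _ _ _ z hz, map_add, map_mul, map_mul, hreal 1 z hz,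
        hreal 0 z hz, map_neg, map_neg, hI, Complex.conj_I, map_one]; ring)
    (fun z hz => by
      rw [hadd _ _ _ _ z hz, hadd _ _ _ _ z hz, map_add, map_mul, map_mul, hreal 2 z hz,
        hreal 3 z hz, map_neg, hI, Complex.conj_I, map_one, neg_neg])
  have hcf : ∀ z ∈ W, conformalFactor X z =
      (‖v₁ z‖ ^ 2 + ‖v₂ z‖ ^ 2) * (‖u₁ z‖ ^ 2 + ‖u₂ z‖ ^ 2) := fun z hz => by
    obtain ⟨⟨ha, hb, hc, hd⟩, -, -⟩ := hall z hz
    have hpar : ∀ s t : ℂ, ‖s + I * t‖ ^ 2 + ‖s - I * t‖ ^ 2 = 2 * (‖s‖ ^ 2 + ‖t‖ ^ 2) :=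
      fun s t => by
        have h1 := parallelogram_law_with_norm ℝ s (I * t)
        rw [norm_mul, hI, Complex.norm_I, one_mul] at h1
        linarith
    have h1 := hpar (f 1 z) (f 0 z)
    have h2 := hpar (f 2 z) (f 3 z)
    have ea : ‖f 1 z + I * f 0 z‖ = ‖u₁ z‖ * ‖v₁ z‖ := by
      rw [← norm_mul, ← ha, ← norm_neg]; congr 1; ring
    have ed : ‖f 1 z - I * f 0 z‖ = ‖u₂ z‖ * ‖v₂ z‖ := by
      rw [← norm_mul, ← hd]; congr 1; ring
    have eb : ‖f 2 z + I * f 3 z‖ = ‖u₁ z‖ * ‖v₂ z‖ := by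
      rw [← norm_mul, ← hb]; congr 1; ring
    have ec : ‖f 2 z - I * f 3 z‖ = ‖u₂ z‖ * ‖v₁ z‖ := by
      rw [← norm_mul, ← hc]; congr 1; ring
    rw [ea, ed] at h1
    rw [eb, ec] at h2
    rw [← hnorm z hz]
    linear_combination -h1 - h2
  have hcoef : ∀ z ∈ W, ∀ k, weierstrassCoeff (fun z => ![v₁ z, conj (v₂ z)])
      (fun z => ![u₁ z, conj (u₂ z)]) z k = f k z := fun z hz k => by
    obtain ⟨⟨ha, hb, hc, hd⟩, -, -⟩ := hall z hz
    fin_cases k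
    · simp [weierstrassCoeff, ← ha, ← hb, ← hc, ← hd]
      linear_combination -(f 0 z) * Complex.I_sq
    · simp [weierstrassCoeff, ← ha, ← hb, ← hc, ← hd]
      ring
    · simp [weierstrassCoeff, ← ha, ← hb, ← hc, ← hd]
      ring
    · simp [weierstrassCoeff, ← ha, ← hb, ← hc, ← hd]
      linear_combination -(f 3 z) * Complex.I_sq
  refine ⟨fun z => ![v₁ z, conj (v₂ z)], fun z => ![u₁ z, conj (u₂ z)], U, ⟨?_, ?_, hU, ?_, ?_, ?_⟩,
    fun z hz => ?_, fun z hz => ?_⟩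
  · refine contDiffOn_pi.2 fun i => ?_
    fin_cases i
    exacts [hv₁, hv₂.conj_comp]
  · refine contDiffOn_pi.2 fun i => ?_
    fin_cases i
    exacts [hu₁, hu₂.conj_comp]
  · intro z hz
    obtain ⟨-, ⟨h1, h2⟩, -⟩ := hall z hz
    simp only [diracOp, Matrix.cons_val_zero, Matrix.cons_val_one,
      wirtD_conj (hv₂.differentiableAt_of_mem hW hz), h1, h2]
    ext i
    fin_cases i <;> simp
  · intro z hz
    obtain ⟨-, -, ⟨h1, h2⟩⟩ := hall z hz
    simp only [diracOpDual, Matrix.cons_val_zero, Matrix.cons_val_one,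
      wirtD_conj (hu₂.differentiableAt_of_mem hW hz), h1, h2]
    ext i
    fin_cases i <;> simp
  · intro a b γ hγW hγ k
    rw [curveIntegral_eq_sub_of_fderiv hW (hx k) (fun z hz => ?_) γ hγW hγ]
    · ring
    · ext v
      rw [fderiv_apply_eq_wirtD, wirtDbar_ofReal ((hx k).differentiableAt_of_mem hW hz)]
      simp only [weierstrassForm, hcoef z hz k, hf]
      simp
  · rw [hcf z hz]
    simp
  · obtain ⟨⟨ha, hb, hc, hd⟩, ⟨hv1, hv2⟩, ⟨hu1, hu2⟩⟩ := hall z hz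
    have hcpos := (hconf z hz).sum_wirtD_coord_sq.2.2
    have hpr : ∀ {g u v : ℂ → ℂ}, ContDiffOn ℝ ∞ u W → ContDiffOn ℝ ∞ v W →
        (∀ y ∈ W, g y = u y * v y) → wirtDbar g z = wirtDbar u z * v z + u z * wirtDbar v z :=
      fun hu hv h => by
        rw [wirtDbar_congr (Filter.eventuallyEq_of_mem (hW.mem_nhds hz) h),
          wirtDbar_mul (hu.differentiableAt_of_mem hW hz) (hv.differentiableAt_of_mem hW hz)]
    have ea := hpr hu₁ hv₁ fun y hy => (hall y hy).1.1
    have eb := hpr hu₁ hv₂ fun y hy => (hall y hy).1.2.1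
    have ec := hpr hu₂ hv₁ fun y hy => (hall y hy).1.2.2.1
    have ed := hpr hu₂ hv₂ fun y hy => (hall y hy).1.2.2.2
    rw [hadd _ _ _ _ z hz] at ea eb ec ed
    rw [hv1] at ea ec
    rw [hv2] at eb ed
    rw [hu1] at ea eb
    rw [hu2] at ec ed
    -- The sum is `∂̄b ∂̄c - ∂̄a ∂̄d`, minus the determinant of the differentiated matrix, into
    -- which the Dirac equations are substituted. As the `∂̄f_k` are real, it also equals `Σ
    -- |∂̄f_k|²`.
    have hsum : ∑ k, wirtDbar (f k) z ^ 2 =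
        ((‖U z‖ ^ 2 * conformalFactor X z : ℝ) : ℂ) := by
      have h1 : ((‖U z‖ ^ 2 * conformalFactor X z : ℝ) : ℂ) = (U z * conj (U z)) *
          ((v₁ z * conj (v₁ z) + v₂ z * conj (v₂ z)) *
            (u₁ z * conj (u₁ z) + u₂ z * conj (u₂ z))) := by
        rw [normSq_add_normSq_eq, normSq_add_normSq_eq, Complex.mul_conj', hcf z hz]
        push_cast; ring
      have e1 : (wirtDbar (f 1) z) ^ 2 + (wirtDbar (f 0) z) ^ 2 =
        -((-1 * wirtDbar (f 1) z + -I * wirtDbar (f 0) z) *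
          (1 * wirtDbar (f 1) z + -I * wirtDbar (f 0) z)) := by
        linear_combination (wirtDbar (f 0) z) ^ 2 * Complex.I_sq
      have e2 : (wirtDbar (f 2) z) ^ 2 + (wirtDbar (f 3) z) ^ 2 =
        (1 * wirtDbar (f 2) z + I * wirtDbar (f 3) z) *
          (1 * wirtDbar (f 2) z + -I * wirtDbar (f 3) z) := by
        linear_combination (wirtDbar (f 3) z) ^ 2 * Complex.I_sq
      rw [ea, ed] at e1
      rw [eb, ec] at e2
      rw [Fin.sum_univ_four, h1]
      linear_combination e1 + e2
    have hsq : ∀ k, ((‖wirtDbar (f k) z‖ ^ 2 : ℝ) : ℂ) = wirtDbar (f k) z ^ 2 := fun k => by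
      have := Complex.mul_conj' (wirtDbar (f k) z)
      rw [hreal k z hz] at this
      push_cast
      rw [← this, sq]
    have hsum' : ∑ k, ‖wirtDbar (f k) z‖ ^ 2 = ‖U z‖ ^ 2 * conformalFactor X z := by
      have : ((∑ k, ‖wirtDbar (f k) z‖ ^ 2 : ℝ) : ℂ) =
          ((‖U z‖ ^ 2 * conformalFactor X z : ℝ) : ℂ) := by
        rw [← hsum, Complex.ofReal_sum]
        exact Finset.sum_congr rfl fun k _ => hsq k
      exact_mod_cast this
    have hH : ‖meanCurvatureVector X z‖ ^ 2 * conformalFactor X z = 4 * ‖U z‖ ^ 2 := by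
      rw [EuclideanSpace.norm_sq_eq]
      have h1 : ∀ k, ‖meanCurvatureVector X z k‖ ^ 2 =
          4 / conformalFactor X z ^ 2 * ‖wirtDbar (f k) z‖ ^ 2 := fun k => by
        have h2 : meanCurvatureVector X z k =
            2 * wirtDbar (f k) z / (conformalFactor X z : ℂ) := by
          rw [hf, wirtDbar_wirtD_comm hW (hx k) hz]; rfl
        rw [h2, norm_div, norm_mul, Complex.norm_real, Real.norm_of_nonneg hcpos.le, div_pow,
          mul_pow]
        simp; ring
      simp only [h1]
      rw [← Finset.mul_sum, hsum']
      field_simp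
    have h3 : (‖meanCurvatureVector X z‖ * Real.sqrt (conformalFactor X z) / 2) ^ 2 = ‖U z‖ ^ 2 := by
      rw [div_pow, mul_pow, Real.sq_sqrt hcpos.le, hH]; ring
    exact ((sq_eq_sq₀ (by positivity) (norm_nonneg _)).1 h3).symm

end ConformalImmersion

/-! ### Fourier series on the unit square. -/

section PlaneWaves

open MeasureTheory

/-- The exponential `z = x + iy ↦ exp (2πi (n₀ x + n₁ y))`. -/
noncomputable def planeWave (n : Fin 2 → ℤ) (z : ℂ) : ℂ :=
  Complex.exp (2 * Real.pi * Complex.I * (n 0 * z.re + n 1 * z.im))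

/-- The Fourier coefficients on the unit square of a function supported there. -/
noncomputable def planeCoeff (g : ℂ → ℂ) (n : Fin 2 → ℤ) : ℂ := ∫ z, g z * planeWave (-n) z

/-- The eigenvalue of `∂/∂z̄` on `planeWave n`. -/
noncomputable def dbarSymbol (n : Fin 2 → ℤ) : ℂ := Real.pi * Complex.I * (n 0 + Complex.I * n 1)

/-- The eigenvalue of `∂/∂z` on `planeWave n`. -/
noncomputable def dSymbol (n : Fin 2 → ℤ) : ℂ := Real.pi * Complex.I * (n 0 - Complex.I * n 1)

theorem norm_planeWave (n : Fin 2 → ℤ) (z : ℂ) : ‖planeWave n z‖ = 1 := by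
  have : 2 * Real.pi * Complex.I * (n 0 * z.re + n 1 * z.im) =
      ((2 * Real.pi * (n 0 * z.re + n 1 * z.im) : ℝ) : ℂ) * Complex.I := by push_cast; ring
  rw [planeWave, this, Complex.norm_exp_ofReal_mul_I]

theorem planeWave_add (m n : Fin 2 → ℤ) (z : ℂ) :
    planeWave (m + n) z = planeWave m z * planeWave n z := by
  simp only [planeWave, ← Complex.exp_add, Pi.add_apply]
  congr 1; push_cast; ring

theorem hasFDerivAt_planeWave (n : Fin 2 → ℤ) (z : ℂ) :
    HasFDerivAt (planeWave n) (((dSymbol n * planeWave n z) • ContinuousLinearMap.id ℝ ℂ) +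
      (dbarSymbol n * planeWave n z) • Complex.conjCLE.toContinuousLinearMap) z := by
  have h1 : HasFDerivAt (fun z : ℂ => 2 * Real.pi * Complex.I * (n 0 * z.re + n 1 * z.im))
      ((2 * Real.pi * Complex.I : ℂ) • ((n 0 : ℂ) • (Complex.ofRealCLM.comp Complex.reCLM) +
        (n 1 : ℂ) • (Complex.ofRealCLM.comp Complex.imCLM))) z :=
    (((Complex.ofRealCLM.comp Complex.reCLM).hasFDerivAt.const_mul _).add
      ((Complex.ofRealCLM.comp Complex.imCLM).hasFDerivAt.const_mul _)).const_mul _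
  refine h1.cexp.congr_fderiv ?_
  ext v
  simp only [smul_apply, add_apply,
    ContinuousLinearMap.comp_apply, Complex.reCLM_apply, Complex.imCLM_apply,
    Complex.ofRealCLM_apply, smul_eq_mul, ContinuousLinearMap.id_apply,
    ContinuousLinearEquiv.coe_coe, Complex.conjCLE_apply, planeWave, dSymbol, dbarSymbol]
  generalize Complex.exp (2 * Real.pi * Complex.I * (n 0 * z.re + n 1 * z.im)) = E
  rw [Complex.re_eq_add_conj, Complex.im_eq_sub_conj]
  field_simp
  linear_combination (E * v * n 1 - E * conj v * n 1) * Complex.I_sq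

theorem contDiff_planeWave (n : Fin 2 → ℤ) : ContDiff ℝ ∞ (planeWave n) := by
  have h : ContDiff ℝ ∞ fun z : ℂ => 2 * Real.pi * Complex.I * (n 0 * z.re + n 1 * z.im) :=
    contDiff_const.mul ((contDiff_const.mul (Complex.ofRealCLM.comp Complex.reCLM).contDiff).add
      (contDiff_const.mul (Complex.ofRealCLM.comp Complex.imCLM).contDiff))
  exact h.cexp

theorem continuous_planeWave (n : Fin 2 → ℤ) : Continuous (planeWave n) :=
  (contDiff_planeWave n).continuous

theorem wirtDbar_planeWave (n : Fin 2 → ℤ) (z : ℂ) :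
    wirtDbar (planeWave n) z = dbarSymbol n * planeWave n z :=
  wirtDbar_eq_of_fderiv fun v => by rw [(hasFDerivAt_planeWave n z).fderiv]; rfl

theorem norm_le_norm_dbarSymbol (n : Fin 2 → ℤ) : ‖n‖ ≤ ‖dbarSymbol n‖ := by
  have h1 : ‖dbarSymbol n‖ = Real.pi * ‖(n 0 + Complex.I * n 1 : ℂ)‖ := by
    rw [dbarSymbol, norm_mul, norm_mul, Complex.norm_I, Complex.norm_real,
      Real.norm_of_nonneg Real.pi_pos.le, mul_one]
  have h2 : ‖n‖ ≤ ‖(n 0 + Complex.I * n 1 : ℂ)‖ := by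
    refine (pi_norm_le_iff_of_nonneg (norm_nonneg _)).2 fun i => ?_
    fin_cases i
    · refine le_trans ?_ (Complex.abs_re_le_norm _)
      simp [Int.norm_eq_abs]
    · refine le_trans ?_ (Complex.abs_im_le_norm _)
      simp [Int.norm_eq_abs]
  rw [h1]
  nlinarith [Real.pi_gt_three, norm_nonneg (n 0 + Complex.I * n 1 : ℂ)]

theorem norm_dSymbol (n : Fin 2 → ℤ) : ‖dSymbol n‖ = ‖dbarSymbol n‖ := by
  have : dbarSymbol n = -conj (dSymbol n) := by
    simp [dbarSymbol, dSymbol]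
  rw [this, norm_neg, RCLike.norm_conj]

theorem norm_dbarSymbol_le (n : Fin 2 → ℤ) : ‖dbarSymbol n‖ ≤ 8 * ‖n‖ := by
  have h1 : ‖dbarSymbol n‖ = Real.pi * ‖(n 0 + Complex.I * n 1 : ℂ)‖ := by
    rw [dbarSymbol, norm_mul, norm_mul, Complex.norm_I, Complex.norm_real,
      Real.norm_of_nonneg Real.pi_pos.le, mul_one]
  have h2 : ‖(n 0 + Complex.I * n 1 : ℂ)‖ ≤ ‖n‖ + ‖n‖ := by
    refine (norm_add_le _ _).trans (add_le_add ?_ ?_)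
    · simpa [Complex.norm_intCast, Int.norm_eq_abs] using norm_le_pi_norm n 0
    · simpa [Complex.norm_intCast, Int.norm_eq_abs] using norm_le_pi_norm n 1
  rw [h1]
  nlinarith [Real.pi_lt_four, Real.pi_pos, norm_nonneg n]

/-- Fourier inversion for continuous functions supported in the interior of the unit square. -/
theorem hasSum_planeCoeff_mul_planeWave {g : ℂ → ℂ} (hg : Continuous g) {r : ℝ} (hr : r < 1 / 2)
    (hsupp : ∀ z : ℂ, (r < |z.re| ∨ r < |z.im|) → g z = 0) (hsum : Summable (planeCoeff g)) {z : ℂ}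
    (hre : |z.re| ≤ r) (him : |z.im| ≤ r) :
    HasSum (fun n => planeCoeff g n * planeWave n z) (g z) := by
  -- `rep` picks the representative in `(-1/2, 1/2]`, and `G` is `g` carried to the torus through
  -- it.
  set rep : UnitAddCircle → ℝ := fun t => (AddCircle.equivIoc 1 (-(1 / 2)) t : ℝ) with hrep
  have hrep_coe : ∀ x : ℝ, x ∈ Ioc (-(1 / 2) : ℝ) (-(1 / 2) + 1) →
      rep (x : UnitAddCircle) = x := fun x hx => AddCircle.equivIoc_coe_of_mem hx
  have hcoe_rep : ∀ t : UnitAddCircle, ((rep t : ℝ) : UnitAddCircle) = t :=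
    fun t => AddCircle.coe_equivIoc
  set G : UnitAddTorus (Fin 2) → ℂ := fun t => g (rep (t 0) + rep (t 1) * Complex.I) with hG
  set C : Set UnitAddCircle := (fun x : ℝ => (x : UnitAddCircle)) '' Icc (-r) r with hC
  have hCclosed : IsClosed C := (isCompact_Icc.image (AddCircle.continuous_mk' 1)).isClosed
  have hGC : ∀ t : UnitAddTorus (Fin 2), (t 0 ∉ C ∨ t 1 ∉ C) → G t = 0 := fun t ht => by
    refine hsupp _ ?_
    have : ∀ s : UnitAddCircle, s ∉ C → r < |rep s| := fun s hs => by
      by_contra! hle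
      exact hs ⟨rep s, abs_le.1 hle, hcoe_rep s⟩
    rcases ht with h | h
    · left; simpa using this _ h
    · right; simpa using this _ h
  -- `rep` can jump only at the seam `-1/2`, which `C` misses since `r < 1/2`; where a coordinate is
  -- off `C`, `G` vanishes in a neighbourhood. Hence `G` is continuous.
  have hCa : ∀ s ∈ C, s ≠ ((-(1 / 2) : ℝ) : UnitAddCircle) := by
    rintro s ⟨x, hx, rfl⟩ heq
    have h1 : x ∈ Ico (-(1 / 2) : ℝ) (-(1 / 2) + 1) := ⟨by linarith [hx.1], by linarith [hx.2]⟩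
    have h2 := (AddCircle.coe_eq_coe_iff_of_mem_Ico h1 ⟨le_rfl, by norm_num⟩).1 heq
    linarith [hx.1]
  have hGcont : Continuous G := by
    refine continuous_iff_continuousAt.2 fun t => ?_
    by_cases ht : t 0 ∈ C ∧ t 1 ∈ C
    · have hcr : ∀ s ∈ C, ContinuousAt rep s := fun s hs =>
        continuous_subtype_val.continuousAt.comp (AddCircle.continuousAt_equivIoc 1 _ (hCa s hs))
      have h0 : ContinuousAt (fun t : UnitAddTorus (Fin 2) => rep (t 0)) t :=
        (hcr _ ht.1).comp (f := fun t : UnitAddTorus (Fin 2) => t 0) (continuous_apply 0).continuousAt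
      have h1 : ContinuousAt (fun t : UnitAddTorus (Fin 2) => rep (t 1)) t :=
        (hcr _ ht.2).comp (f := fun t : UnitAddTorus (Fin 2) => t 1) (continuous_apply 1).continuousAt
      exact hg.continuousAt.comp ((Complex.continuous_ofReal.continuousAt.comp h0).add
        ((Complex.continuous_ofReal.continuousAt.comp h1).mul continuousAt_const))
    · have hopen : IsOpen {t : UnitAddTorus (Fin 2) | t 0 ∉ C ∨ t 1 ∉ C} :=
        (hCclosed.isOpen_compl.preimage (f := fun t : UnitAddTorus (Fin 2) => t 0)
          (continuous_apply 0)).union (hCclosed.isOpen_compl.preimage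
          (f := fun t : UnitAddTorus (Fin 2) => t 1) (continuous_apply 1))
      refine (continuousAt_const (y := (0 : ℂ))).congr ?_
      filter_upwards [hopen.mem_nhds (by rwa [not_and_or] at ht)] with s hs
      exact (hGC s hs).symm
  have hwave : ∀ (n : Fin 2 → ℤ) (x : Fin 2 → ℝ),
      UnitAddTorus.mFourier n (fun i => (x i : UnitAddCircle)) =
        planeWave n (x 0 + x 1 * Complex.I) := fun n x => by
    simp only [UnitAddTorus.mFourier, ContinuousMap.coe_mk, Fin.prod_univ_two, fourier_coe_apply,
      planeWave, ← Complex.exp_add]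
    congr 1; simp; ring
  set B : Set (Fin 2 → ℝ) := {x | ∀ i, x i ∈ Ioc (-(1 / 2) : ℝ) (-(1 / 2) + 1)} with hB
  have hBm : MeasurableSet B := by
    have : B = univ.pi fun _ => Ioc (-(1 / 2) : ℝ) (-(1 / 2) + 1) := by
      ext x; simp [hB]
    rw [this]
    exact MeasurableSet.univ_pi fun _ => measurableSet_Ioc
  have hcoeff : UnitAddTorus.mFourierCoeff G = planeCoeff g := by
    funext n
    rw [UnitAddTorus.mFourierCoeff_eq_integral G n fun _ => -(1 / 2)]
    have h1 : ∫ x in B, UnitAddTorus.mFourier (-n) (fun i => (x i : UnitAddCircle)) •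
        G (fun i => (x i : UnitAddCircle)) =
        ∫ x in B, g (x 0 + x 1 * Complex.I) * planeWave (-n) (x 0 + x 1 * Complex.I) := by
      refine setIntegral_congr_fun hBm fun x hx => ?_
      simp only [hG, hwave, hrep_coe _ (hx 0), hrep_coe _ (hx 1), smul_eq_mul]
      ring
    have h2 : ∫ x in B, g (x 0 + x 1 * Complex.I) * planeWave (-n) (x 0 + x 1 * Complex.I) =
        ∫ x : Fin 2 → ℝ, g (x 0 + x 1 * Complex.I) * planeWave (-n) (x 0 + x 1 * Complex.I) := by
      refine setIntegral_eq_integral_of_forall_compl_eq_zero fun x hx => ?_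
      rw [hsupp, zero_mul]
      by_contra! hcon
      refine hx fun i => ?_
      obtain ⟨h3, h4⟩ := hcon
      simp at h3 h4
      rw [abs_le] at h3 h4
      fin_cases i
      · exact ⟨by simp only [Fin.zero_eta]; linarith, by simp only [Fin.zero_eta]; linarith⟩
      · exact ⟨by simp only [Fin.mk_one]; linarith, by simp only [Fin.mk_one]; linarith⟩
    refine (h1.trans h2).trans ?_
    rw [planeCoeff, ← Complex.volume_preserving_equiv_pi.symm.integral_comp
      Complex.measurableEquivPi.symm.measurableEmbedding]
    rfl
  have hmain := UnitAddTorus.hasSum_mFourier_series_apply_of_summable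
    (f := ⟨G, hGcont⟩) (hcoeff ▸ hsum) (fun i => ((![z.re, z.im] i : ℝ) : UnitAddCircle))
  rw [abs_le] at hre him
  have hz : (⟨G, hGcont⟩ : C(UnitAddTorus (Fin 2), ℂ))
      (fun i => ((![z.re, z.im] i : ℝ) : UnitAddCircle)) = g z := by
    simp only [ContinuousMap.coe_mk, hG]
    rw [hrep_coe _ ⟨by simp; linarith, by simp; linarith⟩,
      hrep_coe _ ⟨by simp; linarith, by simp; linarith⟩]
    simp [Complex.re_add_im]
  rw [hz] at hmain
  convert hmain using 2 with n
  rw [hwave]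
  simp only [ContinuousMap.coe_mk, hcoeff, smul_eq_mul]
  simp [Complex.re_add_im]

end PlaneWaves

/-! ### Decay of Fourier coefficients of smooth functions. -/

section Decay

open MeasureTheory

theorem ContDiff.wirtDbar {g : ℂ → ℂ} (hg : ContDiff ℝ ∞ g) : ContDiff ℝ ∞ (wirtDbar g) :=
  contDiffOn_univ.1 (hg.contDiffOn.wirtDbar isOpen_univ)

theorem ContDiff.iterate_wirtDbar {g : ℂ → ℂ} (hg : ContDiff ℝ ∞ g) (k : ℕ) :
    ContDiff ℝ ∞ (_root_.wirtDbar^[k] g) := by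
  induction k with
  | zero => exact hg
  | succ k ih => rw [Function.iterate_succ_apply']; exact ih.wirtDbar

theorem iterate_wirtDbar_eq_zero {g : ℂ → ℂ} {C : Set ℂ} (hC : IsClosed C)
    (hg : ∀ z ∉ C, g z = 0) (k : ℕ) {z : ℂ} (hz : z ∉ C) : wirtDbar^[k] g z = 0 := by
  induction k generalizing z with
  | zero => exact hg z hz
  | succ k ih =>
    rw [Function.iterate_succ_apply',
      wirtDbar_congr (Filter.eventually_of_mem (hC.isOpen_compl.mem_nhds hz) fun w hw => ih hw)]
    exact wirtDbar_const 0

theorem HasCompactSupport.iterate_wirtDbar {g : ℂ → ℂ} (hg : HasCompactSupport g) (k : ℕ) :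
    HasCompactSupport (wirtDbar^[k] g) :=
  HasCompactSupport.intro hg fun _ hz =>
    iterate_wirtDbar_eq_zero (isClosed_tsupport g) (fun _ => image_eq_zero_of_notMem_tsupport) k hz

theorem integral_wirtDbar_eq_zero {g : ℂ → ℂ} (hg : ContDiff ℝ ∞ g) (hc : HasCompactSupport g) :
    ∫ z, wirtDbar g z = 0 := by
  have hv : ∀ v : ℂ, Integrable (fun z => fderiv ℝ g z v) ∧ ∫ z, fderiv ℝ g z v = 0 := fun v => by
    have h1 : Continuous fun z => fderiv ℝ g z v :=
      (hg.continuous_fderiv (by simp)).clm_apply continuous_const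
    have h2 : Integrable fun z => fderiv ℝ g z v :=
      h1.integrable_of_hasCompactSupport (hc.fderiv_apply ℝ v)
    refine ⟨h2, ?_⟩
    have h3 := integral_mul_fderiv_eq_neg_fderiv_mul_of_integrable (μ := volume)
      (f := fun _ : ℂ => (1 : ℂ)) (g := g) (v := v) (by simp) (by simpa using h2)
      (by simpa using hg.continuous.integrable_of_hasCompactSupport hc)
      (fun _ _ => differentiableAt_const _) (fun z _ => (hg.differentiable (by simp)) z)
    simpa using h3
  simp only [wirtDbar]
  rw [integral_div, integral_add (hv 1).1 ((hv _).1.const_mul _), integral_const_mul, (hv 1).2,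
    (hv _).2]
  simp

theorem planeCoeff_wirtDbar {g : ℂ → ℂ} (hg : ContDiff ℝ ∞ g) (hc : HasCompactSupport g)
    (n : Fin 2 → ℤ) : planeCoeff (wirtDbar g) n = dbarSymbol n * planeCoeff g n := by
  have h : ∫ z, wirtDbar (fun w => g w * planeWave (-n) w) z = 0 :=
    integral_wirtDbar_eq_zero (hg.mul (contDiff_planeWave (-n))) hc.mul_right
  have h1 : ∀ z, wirtDbar (fun w => g w * planeWave (-n) w) z = wirtDbar g z * planeWave (-n) z -
      dbarSymbol n * (g z * planeWave (-n) z) := fun z => by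
    have h2 : wirtDbar (fun w => g w * planeWave (-n) w) z = _ := wirtDbar_mul (hg.differentiable (by simp) z)
      ((contDiff_planeWave (-n)).differentiable (by simp) z)
    rw [h2, wirtDbar_planeWave]
    have : dbarSymbol (-n) = -dbarSymbol n := by simp [dbarSymbol]; ring
    rw [this]; ring
  have hint : ∀ {f : ℂ → ℂ}, ContDiff ℝ ∞ f → HasCompactSupport f →
      Integrable fun z => f z * planeWave (-n) z := fun hf hcf =>
    (hf.continuous.mul (continuous_planeWave _)).integrable_of_hasCompactSupport hcf.mul_right
  simp only [h1] at h
  rw [integral_sub (hint hg.wirtDbar (hc.iterate_wirtDbar 1)) ((hint hg hc).const_mul _),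
    integral_const_mul] at h
  exact sub_eq_zero.1 h

/-- Ellipticity: the symbol of `∂̄` is at least `‖n‖`, so iterating this single operator controls
every power of `‖n‖`. -/
theorem norm_pow_mul_norm_planeCoeff_le {g : ℂ → ℂ} (hg : ContDiff ℝ ∞ g)
    (hc : HasCompactSupport g) (k : ℕ) (n : Fin 2 → ℤ) :
    ‖n‖ ^ k * ‖planeCoeff g n‖ ≤ ∫ z, ‖wirtDbar^[k] g z‖ := by
  have h1 : planeCoeff (wirtDbar^[k] g) n = dbarSymbol n ^ k * planeCoeff g n := by
    induction k with
    | zero => simp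
    | succ k ih =>
      rw [Function.iterate_succ_apply', planeCoeff_wirtDbar (hg.iterate_wirtDbar k)
        (hc.iterate_wirtDbar k), ih]
      ring
  calc ‖n‖ ^ k * ‖planeCoeff g n‖ ≤ ‖dbarSymbol n‖ ^ k * ‖planeCoeff g n‖ := by
        gcongr; exact norm_le_norm_dbarSymbol n
    _ = ‖planeCoeff (wirtDbar^[k] g) n‖ := by rw [h1, norm_mul, norm_pow]
    _ ≤ ∫ z, ‖wirtDbar^[k] g z * planeWave (-n) z‖ := norm_integral_le_integral_norm _
    _ = _ := by simp only [norm_mul, norm_planeWave, mul_one]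

/-- Families on `ℤ²` decaying faster than every power. -/
def RapidDecay (c : (Fin 2 → ℤ) → ℂ) : Prop :=
  ∀ k : ℕ, Summable fun n => (1 + ‖n‖) ^ k * ‖c n‖

theorem summable_inv_one_add_norm_pow_three :
    Summable fun n : Fin 2 → ℤ => ((1 + ‖n‖) ^ 3)⁻¹ := by
  have h := EisensteinSeries.summable_one_div_norm_rpow (k := 3) (by norm_num)
  refine h.of_norm_bounded_eventually ?_
  refine (Set.finite_singleton (0 : Fin 2 → ℤ)).subset fun n hn => ?_
  by_contra hne
  refine hn ?_
  have hpos : 0 < ‖n‖ := norm_pos_iff.2 hne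
  change ‖_‖ ≤ ‖n‖ ^ (-3 : ℝ)
  rw [Real.rpow_neg (norm_nonneg _), Real.norm_of_nonneg (by positivity)]
  norm_cast
  gcongr
  linarith

/-- Three more derivatives buy a factor that is summable over `ℤ²`. For `k = 0` the `ℓ¹` norm of the
coefficients is thus bounded by the `L¹` norms of `g` and `∂̄³g`. -/
theorem one_add_norm_pow_mul_norm_planeCoeff_le {g : ℂ → ℂ} (hg : ContDiff ℝ ∞ g)
    (hc : HasCompactSupport g) (k : ℕ) (n : Fin 2 → ℤ) :
    (1 + ‖n‖) ^ k * ‖planeCoeff g n‖ ≤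
      ((1 + ‖n‖) ^ 3)⁻¹ * (2 ^ (k + 2) * ((∫ z, ‖g z‖) + ∫ z, ‖wirtDbar^[k + 3] g z‖)) := by
  have h0 := norm_pow_mul_norm_planeCoeff_le hg hc 0 n
  have h1 := norm_pow_mul_norm_planeCoeff_le hg hc (k + 3) n
  have h2 := add_pow_le (zero_le_one' ℝ) (norm_nonneg n) (k + 3)
  simp only [pow_zero, one_mul, Function.iterate_zero, id, one_pow] at h0 h2
  rw [inv_mul_eq_div, le_div_iff₀ (by positivity)]
  calc (1 + ‖n‖) ^ k * ‖planeCoeff g n‖ * (1 + ‖n‖) ^ 3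
      = (1 + ‖n‖) ^ (k + 3) * ‖planeCoeff g n‖ := by ring
    _ ≤ 2 ^ (k + 2) * (1 + ‖n‖ ^ (k + 3)) * ‖planeCoeff g n‖ := by gcongr; exact h2
    _ = 2 ^ (k + 2) * (‖planeCoeff g n‖ + ‖n‖ ^ (k + 3) * ‖planeCoeff g n‖) := by ring
    _ ≤ _ := by gcongr

theorem rapidDecay_planeCoeff {g : ℂ → ℂ} (hg : ContDiff ℝ ∞ g) (hc : HasCompactSupport g) :
    RapidDecay (planeCoeff g) := fun k =>
  (summable_inv_one_add_norm_pow_three.mul_right _).of_nonneg_of_le (fun _ => by positivity)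
    (one_add_norm_pow_mul_norm_planeCoeff_le hg hc k)

theorem tsum_norm_planeCoeff_le {g : ℂ → ℂ} (hg : ContDiff ℝ ∞ g) (hc : HasCompactSupport g) :
    ∑' n, ‖planeCoeff g n‖ ≤ (∑' n : Fin 2 → ℤ, ((1 + ‖n‖) ^ 3)⁻¹) *
      (4 * ((∫ z, ‖g z‖) + ∫ z, ‖wirtDbar^[3] g z‖)) := by
  rw [← tsum_mul_right]
  refine Summable.tsum_le_tsum (fun n => ?_) (by simpa using rapidDecay_planeCoeff hg hc 0)
    (summable_inv_one_add_norm_pow_three.mul_right _)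
  have := one_add_norm_pow_mul_norm_planeCoeff_le hg hc 0 n
  norm_num at this ⊢
  exact this

/-- Joint smoothness makes the `L¹` norms in the coefficient bound continuous in the zoom parameter.
-/
theorem contDiff_partial_wirtDbar {F : ℝ × ℂ → ℂ} (hF : ContDiff ℝ ∞ F) (k : ℕ) :
    ContDiff ℝ ∞ fun p : ℝ × ℂ => wirtDbar^[k] (fun z => F (p.1, z)) p.2 := by
  induction k with
  | zero => exact hF
  | succ k ih =>
    set G : ℝ × ℂ → ℂ := fun p => wirtDbar^[k] (fun z => F (p.1, z)) p.2 with hG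
    have hfd : ∀ (p : ℝ × ℂ) (v : ℂ),
        fderiv ℝ (wirtDbar^[k] (fun z => F (p.1, z))) p.2 v = fderiv ℝ G p (0, v) := fun p v => by
      have h1 : HasFDerivAt (wirtDbar^[k] (fun z => F (p.1, z)))
          ((fderiv ℝ G p).comp (ContinuousLinearMap.inr ℝ ℝ ℂ)) p.2 :=
        HasFDerivAt.comp (g := G) (f := fun z => (p.1, z)) p.2
          ((ih.differentiable (by simp)) p).hasFDerivAt (hasFDerivAt_prodMk_right p.1 p.2)
      rw [h1.fderiv]; rfl
    have h2 : ∀ v : ℂ, ContDiff ℝ ∞ fun p => fderiv ℝ G p (0, v) := fun v =>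
      (ih.fderiv_right (m := ∞) (by simp)).clm_apply contDiff_const
    simp only [Function.iterate_succ_apply', wirtDbar, hfd] at h2 ⊢
    exact ((h2 1).add (contDiff_const.mul (h2 _))).div_const _

/-- Zooming in at a zero of `μ` makes the Fourier norm of the localised function small. -/
theorem exists_tsum_norm_planeCoeff_lt {μ χ : ℂ → ℂ} (hμ : ContDiff ℝ ∞ μ) (hμ0 : μ 0 = 0)
    (hχ : ContDiff ℝ ∞ χ) (hc : HasCompactSupport χ) {ε : ℝ} (hε : 0 < ε) :
    ∃ δ₀ > 0, ∀ δ : ℝ, 0 < δ → δ < δ₀ →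
      ∑' n, ‖planeCoeff (fun z => χ z * μ (δ * z)) n‖ < ε := by
  set F : ℝ × ℂ → ℂ := fun p => χ p.2 * μ (p.1 * p.2) with hF
  have hFs : ContDiff ℝ ∞ F := (hχ.comp contDiff_snd).mul
    (hμ.comp ((Complex.ofRealCLM.contDiff.comp contDiff_fst).mul contDiff_snd))
  have hFδ : ∀ δ : ℝ, ContDiff ℝ ∞ fun z : ℂ => χ z * μ (δ * z) := fun δ =>
    hFs.comp (contDiff_prodMk_right δ)
  have hcδ : ∀ δ : ℝ, HasCompactSupport fun z : ℂ => χ z * μ (δ * z) := fun δ => hc.mul_right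
  have hA : ∀ k : ℕ, Continuous fun δ : ℝ =>
      ∫ z, ‖wirtDbar^[k] (fun z => χ z * μ (δ * z)) z‖ := fun k => by
    have h1 := continuous_parametric_integral_of_continuous (μ := (volume : Measure ℂ))
      (f := fun (δ : ℝ) z => ‖wirtDbar^[k] (fun z => F (δ, z)) z‖)
      (contDiff_partial_wirtDbar hFs k).continuous.norm hc
    convert h1 using 2 with δ
    refine (setIntegral_eq_integral_of_forall_compl_eq_zero fun z hz => ?_).symm
    rw [iterate_wirtDbar_eq_zero (isClosed_tsupport χ) (fun w hw => ?_) k hz, norm_zero]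
    simp [image_eq_zero_of_notMem_tsupport hw]
  -- At zoom `0` the function is `χ * μ 0 = 0`, so by continuity the bound is small for small `δ`.
  have hA0 : ∀ k : ℕ, ∫ z, ‖wirtDbar^[k] (fun z => χ z * μ ((0 : ℝ) * z)) z‖ = 0 := fun k => by
    have : ∀ z, wirtDbar^[k] (fun z => χ z * μ ((0 : ℝ) * z)) z = 0 := fun z =>
      iterate_wirtDbar_eq_zero isClosed_empty (fun w _ => by simp [hμ0]) k (notMem_empty z)
    simp only [this, norm_zero, MeasureTheory.integral_zero]
  have hlim : Continuous fun δ : ℝ => (∑' n : Fin 2 → ℤ, ((1 + ‖n‖) ^ 3)⁻¹) *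
      (4 * ((∫ z, ‖wirtDbar^[0] (fun z => χ z * μ (δ * z)) z‖) +
        ∫ z, ‖wirtDbar^[3] (fun z => χ z * μ (δ * z)) z‖)) :=
    continuous_const.mul (continuous_const.mul ((hA 0).add (hA 3)))
  have hev := hlim.continuousAt (x := 0) |>.eventually_lt (continuousAt_const (y := ε))
    (by simp only [hA0]; simpa using hε)
  obtain ⟨δ₀, hδ₀, hball⟩ := Metric.eventually_nhds_iff.1 hev
  refine ⟨δ₀, hδ₀, fun δ hpos hlt => ?_⟩
  refine (tsum_norm_planeCoeff_le (hFδ δ) (hcδ δ)).trans_lt ?_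
  exact hball (by rwa [dist_zero_right, Real.norm_of_nonneg hpos.le])

end Decay

/-! ### The Neumann equation on `ℤ²` and decay of its solution. -/

section Neumann

open scoped BoundedContinuousFunction

/-- The shear `(a, b) ↦ (a - b, b)` of `G × G`. -/
def shearEquiv (G : Type*) [AddGroup G] : G × G ≃ G × G where
  toFun p := (p.1 - p.2, p.2)
  invFun p := (p.1 + p.2, p.2)
  left_inv p := by simp
  right_inv p := by simp

theorem RapidDecay.summable_norm {c : (Fin 2 → ℤ) → ℂ} (hc : RapidDecay c) :
    Summable fun n => ‖c n‖ := by simpa using hc 0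

theorem rapidDecay_of_forall_bounded {c : (Fin 2 → ℤ) → ℂ}
    (hc : ∀ k : ℕ, ∃ C : ℝ, ∀ n, (1 + ‖n‖) ^ k * ‖c n‖ ≤ C) : RapidDecay c := fun k => by
  obtain ⟨C, hC⟩ := hc (k + 3)
  refine (summable_inv_one_add_norm_pow_three.mul_right C).of_nonneg_of_le
    (fun _ => by positivity) fun n => ?_
  rw [inv_mul_eq_div, le_div_iff₀ (by positivity)]
  calc (1 + ‖n‖) ^ k * ‖c n‖ * (1 + ‖n‖) ^ 3 = (1 + ‖n‖) ^ (k + 3) * ‖c n‖ := by ring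
    _ ≤ C := hC n

theorem summable_norm_comp_sub {m : (Fin 2 → ℤ) → ℂ} (hm : Summable fun n => ‖m n‖)
    (n : Fin 2 → ℤ) : Summable fun j => ‖m (n - j)‖ :=
  (Equiv.subLeft n).summable_iff (f := fun j => ‖m j‖) |>.2 hm

/-- Convolution with `m` has norm at most `Σ ‖m n‖ < 1` on bounded families, and the multiplier `S`
does not increase the norm: the right side is a contraction. -/
theorem exists_bounded_neumann {m S : (Fin 2 → ℤ) → ℂ} (hm : Summable fun n => ‖m n‖)
    (hm1 : ∑' n, ‖m n‖ < 1) (hS : ∀ n, ‖S n‖ ≤ 1) :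
    ∃ w : (Fin 2 → ℤ) → ℂ, (∃ C, ∀ n, ‖w n‖ ≤ C) ∧
      ∀ n, w n = m n + ∑' j, m (n - j) * (S j * w j) := by
  set q : ℝ := ∑' n, ‖m n‖ with hq
  have hq0 : 0 ≤ q := tsum_nonneg fun _ => norm_nonneg _
  have hterm : ∀ (w : (Fin 2 → ℤ) →ᵇ ℂ) (n j), ‖m (n - j) * (S j * w j)‖ ≤ ‖m (n - j)‖ * ‖w‖ :=
    fun w n j => by
      rw [norm_mul, norm_mul]
      have := mul_le_mul (hS j) (w.norm_coe_le_norm j) (norm_nonneg _) zero_le_one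
      rw [one_mul] at this
      gcongr
  have hsum : ∀ (w : (Fin 2 → ℤ) →ᵇ ℂ) (n), Summable fun j => m (n - j) * (S j * w j) :=
    fun w n => ((summable_norm_comp_sub hm n).mul_right ‖w‖).of_norm_bounded (hterm w n)
  have hqn : ∀ n, ∑' j, ‖m (n - j)‖ = q := fun n => (Equiv.subLeft n).tsum_eq fun j => ‖m j‖
  have hle : ∀ (w : (Fin 2 → ℤ) →ᵇ ℂ) (n), ‖∑' j, m (n - j) * (S j * w j)‖ ≤ q * ‖w‖ :=
    fun w n => by
      rw [← hqn n, ← tsum_mul_right]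
      exact tsum_of_norm_bounded ((summable_norm_comp_sub hm n).mul_right ‖w‖).hasSum (hterm w n)
  let T : ((Fin 2 → ℤ) →ᵇ ℂ) → ((Fin 2 → ℤ) →ᵇ ℂ) := fun w =>
    BoundedContinuousFunction.ofNormedAddCommGroupDiscrete
      (fun n => m n + ∑' j, m (n - j) * (S j * w j)) (q + q * ‖w‖) fun n =>
        (norm_add_le _ _).trans (add_le_add (hm.le_tsum n fun _ _ => norm_nonneg _) (hle w n))
  have hT : ContractingWith ⟨q, hq0⟩ T := by
    refine ⟨hm1, LipschitzWith.of_dist_le_mul fun w w' => ?_⟩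
    refine (BoundedContinuousFunction.dist_le (by positivity)).2 fun n => ?_
    have h1 : T w n - T w' n = ∑' j, m (n - j) * (S j * (w - w') j) := by
      change (m n + ∑' j, m (n - j) * (S j * w j)) - (m n + ∑' j, m (n - j) * (S j * w' j)) = _
      rw [add_sub_add_left_eq_sub, ← (hsum w n).tsum_sub (hsum w' n)]
      exact tsum_congr fun j => by
        rw [BoundedContinuousFunction.coe_sub, Pi.sub_apply]; ring
    rw [dist_eq_norm, h1, dist_eq_norm]
    exact hle _ n
  have hfix := hT.fixedPoint_isFixedPt
  set w := hT.fixedPoint T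
  refine ⟨w, ⟨‖w‖, w.norm_coe_le_norm⟩, fun n => ?_⟩
  exact (DFunLike.congr_fun hfix n).symm

/-- The weight of degree `k` may push the norm of `m` above 1, but scaling `‖n‖` by a small `ε`
brings it back towards the unweighted norm, by dominated convergence, and yields the same order of
decay. -/
theorem exists_pos_tsum_weight_lt {m : (Fin 2 → ℤ) → ℂ} (hm : RapidDecay m)
    (hm1 : ∑' n, ‖m n‖ < 1) (k : ℕ) :
    ∃ ε : ℝ, 0 < ε ∧ ε ≤ 1 ∧ (Summable fun n => (1 + ε * ‖n‖) ^ k * ‖m n‖) ∧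
      ∑' n, (1 + ε * ‖n‖) ^ k * ‖m n‖ < 1 := by
  have hlim : Filter.Tendsto (fun ε : ℝ => ∑' n, (1 + ε * ‖n‖) ^ k * ‖m n‖) (𝓝[>] 0)
      (𝓝 (∑' n, ‖m n‖)) := by
    refine tendsto_tsum_of_dominated_convergence (hm k) (fun n => ?_) ?_
    · have : Continuous fun ε : ℝ => (1 + ε * ‖n‖) ^ k * ‖m n‖ := by fun_prop
      have h := this.tendsto 0
      simp only [zero_mul, add_zero, one_pow, one_mul] at h
      exact h.mono_left nhdsWithin_le_nhds
    · filter_upwards [Ioo_mem_nhdsGT (zero_lt_one' ℝ)] with ε hε n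
      have h0 : 0 ≤ ε := hε.1.le
      rw [Real.norm_of_nonneg (by positivity)]
      gcongr
      exact mul_le_of_le_one_left (norm_nonneg _) hε.2.le
  obtain ⟨ε, hε1, hε2⟩ := ((hlim.eventually_lt_const hm1).and
    (Ioo_mem_nhdsGT (zero_lt_one' ℝ))).exists
  have h0 : 0 ≤ ε := hε2.1.le
  refine ⟨ε, hε2.1, hε2.2.le, (hm k).of_nonneg_of_le (fun _ => by positivity) fun n => ?_, hε1⟩
  gcongr
  exact mul_le_of_le_one_left (norm_nonneg _) hε2.2.le

/-- A bounded solution of the Neumann equation inherits every submultiplicative weight in which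
the kernel has norm less than one. -/
theorem weight_mul_norm_le {m S w v : (Fin 2 → ℤ) → ℂ} {u : (Fin 2 → ℤ) → ℝ} (hv : v = S * w)
    (hS : ∀ n, ‖S n‖ ≤ 1) {C : ℝ} (hC : ∀ n, ‖w n‖ ≤ C) (hu1 : ∀ n, 1 ≤ u n)
    (hu : ∀ a b, u (a + b) ≤ u a * u b) (hsum : Summable fun n => u n * ‖m n‖)
    (hlt : ∑' n, u n * ‖m n‖ < 1) (hw : ∀ n, w n = m n + ∑' j, m (n - j) * v j) (n : Fin 2 → ℤ) :
    u n * ‖w n‖ ≤ (∑' n, u n * ‖m n‖) / (1 - ∑' n, u n * ‖m n‖) := by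
  set q : ℝ := ∑' n, u n * ‖m n‖ with hq
  set R : ℝ := u n with hR
  -- Truncating at `R = u n ≥ 1` keeps the weight submultiplicative and makes the weighted supremum
  -- `B` finite, so that `B ≤ q + q B` can be solved for `B`. Nothing is lost at `n` itself.
  set t : (Fin 2 → ℤ) → ℝ := fun a => min (u a) R with ht
  have hR1 : 1 ≤ R := hu1 n
  have ht1 : ∀ a, 1 ≤ t a := fun a => le_min (hu1 a) hR1
  have ht0 : ∀ a, 0 ≤ t a := fun a => zero_le_one.trans (ht1 a)
  have htu : ∀ a, t a ≤ u a := fun a => min_le_left _ _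
  have htR : ∀ a, t a ≤ R := fun a => min_le_right _ _
  have htmul : ∀ a b, t (a + b) ≤ t a * t b := fun a b => by
    by_cases ha : u a ≤ R
    · by_cases hb : u b ≤ R
      · have h1 : t a = u a := min_eq_left ha
        have h2 : t b = u b := min_eq_left hb
        rw [h1, h2]; exact (htu _).trans (hu a b)
      · have h2 : t b = R := min_eq_right (not_le.1 hb).le
        rw [h2]; nlinarith [ht1 a, htR (a + b)]
    · have h2 : t a = R := min_eq_right (not_le.1 ha).le
      rw [h2]; nlinarith [ht1 b, htR (a + b)]
  have hbdd : BddAbove (range fun a => t a * ‖w a‖) := by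
    refine ⟨R * C, ?_⟩
    rintro _ ⟨a, rfl⟩
    exact mul_le_mul (htR a) (hC a) (norm_nonneg _) (by linarith)
  set B : ℝ := ⨆ a, t a * ‖w a‖ with hB
  have hle : ∀ a, t a * ‖w a‖ ≤ B := fun a => le_ciSup hbdd a
  have hstep : ∀ a, t a * ‖w a‖ ≤ q + q * B := fun a => by
    have hsa : Summable fun j => u (a - j) * ‖m (a - j)‖ :=
      (Equiv.subLeft a).summable_iff (f := fun j => u j * ‖m j‖) |>.2 hsum
    have hqa : ∑' j, u (a - j) * ‖m (a - j)‖ = q :=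
      (Equiv.subLeft a).tsum_eq fun j => u j * ‖m j‖
    have h1 : ‖(t a : ℂ) * ∑' j, m (a - j) * v j‖ ≤ q * B := by
      rw [← tsum_mul_left, ← hqa, ← tsum_mul_right]
      refine tsum_of_norm_bounded (hsa.mul_right B).hasSum fun j => ?_
      rw [norm_mul, norm_mul, Complex.norm_real, Real.norm_of_nonneg (ht0 a), hv, Pi.mul_apply,
        norm_mul]
      have h2 := htmul (a - j) j
      rw [sub_add_cancel] at h2
      calc t a * (‖m (a - j)‖ * (‖S j‖ * ‖w j‖))
          ≤ (t (a - j) * t j) * (‖m (a - j)‖ * (1 * ‖w j‖)) := by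
            gcongr
            · exact mul_nonneg (ht0 _) (ht0 _)
            · exact hS j
        _ = (t (a - j) * ‖m (a - j)‖) * (t j * ‖w j‖) := by ring
        _ ≤ (u (a - j) * ‖m (a - j)‖) * B := by
            refine mul_le_mul ?_ (hle j) (mul_nonneg (ht0 j) (norm_nonneg _))
              (mul_nonneg (zero_le_one.trans (hu1 _)) (norm_nonneg _))
            exact mul_le_mul_of_nonneg_right (htu _) (norm_nonneg _)
    have h3 : t a * ‖m a‖ ≤ q := (mul_le_mul_of_nonneg_right (htu a) (norm_nonneg _)).trans
      (hsum.le_tsum a fun j _ => mul_nonneg (zero_le_one.trans (hu1 _)) (norm_nonneg _))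
    rw [norm_mul, Complex.norm_real, Real.norm_of_nonneg (ht0 a)] at h1
    calc t a * ‖w a‖ ≤ t a * (‖m a‖ + ‖∑' j, m (a - j) * v j‖) := by
          refine mul_le_mul_of_nonneg_left ?_ (ht0 a)
          rw [hw a]; exact norm_add_le _ _
      _ ≤ q + q * B := by rw [mul_add]; exact add_le_add h3 h1
  have hBq : B ≤ q + q * B := ciSup_le hstep
  have hn : t n = u n := min_eq_left le_rfl
  have hfin := hle n
  rw [hn] at hfin
  rw [le_div_iff₀ (by linarith)]
  nlinarith

/-- The Neumann equation `w = m + m * (S w)` on `ℤ²` with a rapidly decaying kernel of norm less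
than `1/3` has a rapidly decaying solution of norm at most `1/2`. -/
theorem exists_rapidDecay_neumann {m S : (Fin 2 → ℤ) → ℂ} (hm : RapidDecay m)
    (hm1 : ∑' n, ‖m n‖ < 1 / 3) (hS : ∀ n, ‖S n‖ ≤ 1) :
    ∃ w : (Fin 2 → ℤ) → ℂ, RapidDecay w ∧ ∑' n, ‖w n‖ ≤ 1 / 2 ∧
      ∀ n, w n = m n + ∑' j, m (n - j) * (S j * w j) := by
  have hm1' : ∑' n, ‖m n‖ < 1 := by linarith
  obtain ⟨w, ⟨C, hC⟩, hw⟩ := exists_bounded_neumann hm.summable_norm hm1' hS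
  have hRD : RapidDecay w := by
    refine rapidDecay_of_forall_bounded fun k => ?_
    obtain ⟨ε, hε0, hε1, hsum, hlt⟩ := exists_pos_tsum_weight_lt hm hm1' k
    set q := ∑' n, (1 + ε * ‖n‖) ^ k * ‖m n‖
    refine ⟨(ε⁻¹) ^ k * (q / (1 - q)), fun n => ?_⟩
    have h := weight_mul_norm_le (u := fun n => (1 + ε * ‖n‖) ^ k) rfl hS hC
      (fun n => one_le_pow₀ (by have := mul_nonneg hε0.le (norm_nonneg n); linarith))
      (fun a b => by
        rw [← mul_pow]
        have h1 := mul_nonneg hε0.le (norm_nonneg a)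
        have h2 := mul_nonneg hε0.le (norm_nonneg b)
        have h3 := mul_le_mul_of_nonneg_left (norm_add_le a b) hε0.le
        refine pow_le_pow_left₀ (by positivity) ?_ k
        nlinarith [mul_nonneg h1 h2]) hsum hlt hw n
    refine le_trans ?_ (mul_le_mul_of_nonneg_left h (by positivity))
    rw [← mul_assoc, ← mul_pow]
    refine mul_le_mul_of_nonneg_right (pow_le_pow_left₀ (by positivity) ?_ k) (norm_nonneg _)
    rw [inv_mul_eq_div, le_div_iff₀ hε0]
    nlinarith [norm_nonneg n]
  refine ⟨w, hRD, ?_, hw⟩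
  have hprod : Summable fun p : (Fin 2 → ℤ) × (Fin 2 → ℤ) => ‖m p.1‖ * ‖w p.2‖ :=
    hm.summable_norm.mul_of_nonneg hRD.summable_norm (fun _ => norm_nonneg _)
      fun _ => norm_nonneg _
  have hprod' : Summable fun p : (Fin 2 → ℤ) × (Fin 2 → ℤ) => ‖m (p.1 - p.2)‖ * ‖w p.2‖ :=
    (shearEquiv _).summable_iff.2 hprod
  have hconv : ∑' n, ∑' j, ‖m (n - j)‖ * ‖w j‖ = (∑' n, ‖m n‖) * ∑' n, ‖w n‖ := by
    rw [← hprod'.tsum_prod, hm.summable_norm.tsum_mul_tsum hRD.summable_norm hprod]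
    exact (shearEquiv _).tsum_eq fun p => ‖m p.1‖ * ‖w p.2‖
  have hbound : ∀ n, ‖w n‖ ≤ ‖m n‖ + ∑' j, ‖m (n - j)‖ * ‖w j‖ := fun n => by
    have h1 : ‖∑' j, m (n - j) * (S j * w j)‖ ≤ ∑' j, ‖m (n - j)‖ * ‖w j‖ := by
      refine tsum_of_norm_bounded (hprod'.prod_factor n).hasSum fun j => ?_
      rw [norm_mul, norm_mul]
      exact mul_le_mul_of_nonneg_left (mul_le_of_le_one_left (norm_nonneg _) (hS j))
        (norm_nonneg _)
    calc ‖w n‖ = ‖m n + ∑' j, m (n - j) * (S j * w j)‖ := by rw [← hw n]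
      _ ≤ _ := (norm_add_le _ _).trans (by gcongr)
  -- Summing gives `‖w‖₁ ≤ q + q ‖w‖₁` with `q = ‖m‖₁ < 1/3`, hence `‖w‖₁ ≤ q / (1 - q) ≤ 1/2`.
  have hfinal := hRD.summable_norm.tsum_le_tsum hbound (hm.summable_norm.add hprod'.prod)
  rw [hm.summable_norm.tsum_add hprod'.prod, hconv] at hfinal
  have h0 : 0 ≤ ∑' n, ‖w n‖ := tsum_nonneg fun _ => norm_nonneg _
  nlinarith

end Neumann

/-! ### Fourier solution of the Beltrami equation with small coefficient. -/

section PlaneSums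

/-- The Fourier series with coefficients `c`. -/
noncomputable def planeSum (c : (Fin 2 → ℤ) → ℂ) (z : ℂ) : ℂ := ∑' n, c n * planeWave n z

theorem RapidDecay.mul_left {c s : (Fin 2 → ℤ) → ℂ} (hc : RapidDecay c) {A : ℝ}
    (hs : ∀ n, ‖s n‖ ≤ A * (1 + ‖n‖)) : RapidDecay fun n => s n * c n := fun k => by
  refine ((hc (k + 1)).mul_left A).of_nonneg_of_le (fun _ => by positivity) fun n => ?_
  rw [norm_mul]
  calc (1 + ‖n‖) ^ k * (‖s n‖ * ‖c n‖) ≤ (1 + ‖n‖) ^ k * (A * (1 + ‖n‖) * ‖c n‖) := by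
        gcongr; exact hs n
    _ = A * ((1 + ‖n‖) ^ (k + 1) * ‖c n‖) := by ring

theorem RapidDecay.dbarSymbol_mul {c : (Fin 2 → ℤ) → ℂ} (hc : RapidDecay c) :
    RapidDecay fun n => dbarSymbol n * c n :=
  hc.mul_left (A := 8) fun n => (norm_dbarSymbol_le n).trans (by linarith)

theorem RapidDecay.dSymbol_mul {c : (Fin 2 → ℤ) → ℂ} (hc : RapidDecay c) :
    RapidDecay fun n => dSymbol n * c n :=
  hc.mul_left (A := 8) fun n => by
    rw [norm_dSymbol]; exact (norm_dbarSymbol_le n).trans (by linarith)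

theorem RapidDecay.summable_mul_planeWave {c : (Fin 2 → ℤ) → ℂ} (hc : RapidDecay c) (z : ℂ) :
    Summable fun n => c n * planeWave n z :=
  Summable.of_norm (by simpa only [norm_mul, norm_planeWave, mul_one] using hc.summable_norm)

theorem norm_planeSum_le {c : (Fin 2 → ℤ) → ℂ} (hc : RapidDecay c) (z : ℂ) :
    ‖planeSum c z‖ ≤ ∑' n, ‖c n‖ :=
  tsum_of_norm_bounded hc.summable_norm.hasSum fun n => by
    rw [norm_mul, norm_planeWave, mul_one]

theorem hasFDerivAt_planeSum {c : (Fin 2 → ℤ) → ℂ} (hc : RapidDecay c) (z : ℂ) :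
    HasFDerivAt (planeSum c) (planeSum (fun n => dSymbol n * c n) z • ContinuousLinearMap.id ℝ ℂ +
      planeSum (fun n => dbarSymbol n * c n) z • Complex.conjCLE.toContinuousLinearMap) z := by
  set J : ℂ →L[ℝ] ℂ := Complex.conjCLE.toContinuousLinearMap
  have h1 : ∀ n z, HasFDerivAt (fun z => c n * planeWave n z)
      ((dSymbol n * c n * planeWave n z) • ContinuousLinearMap.id ℝ ℂ +
        (dbarSymbol n * c n * planeWave n z) • J) z := fun n z => by
    refine ((hasFDerivAt_planeWave n z).const_mul (c n)).congr_fderiv ?_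
    rw [smul_add, smul_smul, smul_smul]
    congr 2 <;> ring
  have hu : Summable fun n => ‖dSymbol n * c n‖ * ‖ContinuousLinearMap.id ℝ ℂ‖ +
      ‖dbarSymbol n * c n‖ * ‖J‖ :=
    (hc.dSymbol_mul.summable_norm.mul_right _).add (hc.dbarSymbol_mul.summable_norm.mul_right _)
  have h2 := hasFDerivAt_tsum hu h1 (fun n x => (norm_add_le _ _).trans (by
    rw [norm_smul, norm_smul, norm_mul (_ * _), norm_mul (_ * _), norm_planeWave, mul_one,
      mul_one])) (hc.summable_mul_planeWave 0) z
  refine h2.congr_fderiv ?_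
  have h3 := (hc.dSymbol_mul.summable_mul_planeWave z).hasSum.smul_const
    (ContinuousLinearMap.id ℝ ℂ)
  have h4 := (hc.dbarSymbol_mul.summable_mul_planeWave z).hasSum.smul_const J
  exact (h3.add h4).tsum_eq

theorem contDiff_planeSum {c : (Fin 2 → ℤ) → ℂ} (hc : RapidDecay c) :
    ContDiff ℝ ∞ (planeSum c) := by
  refine contDiff_infty.2 fun k => ?_
  induction k generalizing c with
  | zero =>
    exact contDiff_zero.2 (continuous_iff_continuousAt.2 fun z =>
      (hasFDerivAt_planeSum hc z).continuousAt)
  | succ k ih =>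
    refine contDiff_succ_iff_hasFDerivAt.2 ⟨_, ?_, hasFDerivAt_planeSum hc⟩
    exact ((ih hc.dSymbol_mul).smul contDiff_const).add ((ih hc.dbarSymbol_mul).smul contDiff_const)

/-- The double sum over `(i, j)` is regrouped by `n = i + j` through the shear. -/
theorem planeSum_mul_planeSum {a b : (Fin 2 → ℤ) → ℂ} (ha : RapidDecay a) (hb : RapidDecay b)
    (z : ℂ) : planeSum a z * planeSum b z = planeSum (fun n => ∑' j, a (n - j) * b j) z := by
  have ha' : Summable fun n => ‖a n * planeWave n z‖ := (ha.summable_mul_planeWave z).norm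
  have hb' : Summable fun n => ‖b n * planeWave n z‖ := (hb.summable_mul_planeWave z).norm
  set F : (Fin 2 → ℤ) × (Fin 2 → ℤ) → ℂ := fun p =>
    a p.1 * planeWave p.1 z * (b p.2 * planeWave p.2 z) with hF
  have hprod : Summable F := summable_mul_of_summable_norm (f := fun n => a n * planeWave n z)
    (g := fun n => b n * planeWave n z) ha' hb'
  have hprod' : Summable (F ∘ shearEquiv (Fin 2 → ℤ)) :=
    (shearEquiv (Fin 2 → ℤ)).summable_iff.2 hprod
  have h1 : ∑' p, (F ∘ shearEquiv (Fin 2 → ℤ)) p = ∑' p, F p :=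
    (shearEquiv (Fin 2 → ℤ)).tsum_eq F
  have h3 : planeSum a z * planeSum b z = ∑' p, F p := tsum_mul_tsum_of_summable_norm ha' hb'
  rw [h3, ← h1, hprod'.tsum_prod, planeSum]
  refine tsum_congr fun n => ?_
  rw [← tsum_mul_right]
  refine tsum_congr fun j => ?_
  have h2 : planeWave n z = planeWave (n - j) z * planeWave j z := by
    rw [← planeWave_add, sub_add_cancel]
  change a (n - j) * planeWave (n - j) z * (b j * planeWave j z) = _
  rw [h2]; ring

/-- Solution of the Beltrami equation with coefficient `planeSum m`, for small `m`. -/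
theorem exists_beltrami_of_tsum_lt {m : (Fin 2 → ℤ) → ℂ} (hm : RapidDecay m)
    (hm1 : ∑' n, ‖m n‖ < 1 / 3) :
    ∃ f : ℂ → ℂ, ContDiff ℝ ∞ f ∧
      ∀ z, wirtDbar f z = planeSum m z * wirtD f z ∧ wirtD f z ≠ 0 := by
  -- This multiplier turns `∂̄f` into `∂f` on nonconstant modes. At `n = 0` it is `0 / 0 = 0`, as
  -- needed.
  have hS : ∀ n, ‖dSymbol n / dbarSymbol n‖ ≤ 1 := fun n => by
    rw [norm_div, norm_dSymbol]; exact div_self_le_one _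
  obtain ⟨w, hw, hw1, heq⟩ := exists_rapidDecay_neumann hm hm1 hS
  have hdb : ∀ n : Fin 2 → ℤ, n ≠ 0 → 1 ≤ ‖dbarSymbol n‖ := fun n hn => by
    refine le_trans ?_ (norm_le_norm_dbarSymbol n)
    obtain ⟨i, hi⟩ := Function.ne_iff.1 hn
    refine le_trans ?_ (norm_le_pi_norm n i)
    rw [Int.norm_eq_abs]
    exact_mod_cast Int.one_le_abs hi
  have hdb0 : dbarSymbol 0 = 0 := by simp [dbarSymbol]
  have hv : RapidDecay fun n => dSymbol n / dbarSymbol n * w n :=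
    hw.mul_left (A := 1) fun n => (hS n).trans (by linarith [norm_nonneg n])
  have hc : RapidDecay fun n => (dbarSymbol n)⁻¹ * w n := hw.mul_left (A := 1) fun n => by
    by_cases hn : n = 0
    · simp [hn, hdb0]
    · rw [norm_inv]
      exact (inv_le_one_of_one_le₀ (hdb n hn)).trans (by linarith [norm_nonneg n])
  -- The unknown `w` consists of the Fourier coefficients of `∂̄f`. The constant mode has no
  -- periodic primitive and is integrated to `w 0 * conj z`; the leading `z` gives `∂f` its constant
  -- term 1.
  set f : ℂ → ℂ := fun z => z + w 0 * conj z + planeSum (fun n => (dbarSymbol n)⁻¹ * w n) z with hf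
  have hfd : ∀ z, HasFDerivAt f (ContinuousLinearMap.id ℝ ℂ +
      w 0 • Complex.conjCLE.toContinuousLinearMap + _) z := fun z =>
    ((hasFDerivAt_id z).add (Complex.conjCLE.hasFDerivAt.const_mul (w 0))).add
      (hasFDerivAt_planeSum hc z)
  have hfv : ∀ z v, fderiv ℝ f z v =
      (1 + planeSum (fun n => dSymbol n / dbarSymbol n * w n) z) * v +
      (w 0 + planeSum (fun n => dbarSymbol n * ((dbarSymbol n)⁻¹ * w n)) z) * conj v :=
    fun z v => by
      have h1 : (fun n => dSymbol n * ((dbarSymbol n)⁻¹ * w n)) =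
          fun n => dSymbol n / dbarSymbol n * w n := funext fun n => by ring
      have h2 := DFunLike.congr_fun (hfd z).fderiv v
      rw [h1] at h2
      rw [h2]
      simp only [add_apply, smul_apply, ContinuousLinearMap.id_apply,
        ContinuousLinearEquiv.coe_coe, Complex.conjCLE_apply, smul_eq_mul]
      ring
  have hD : ∀ z, wirtD f z = 1 + planeSum (fun n => dSymbol n / dbarSymbol n * w n) z :=
    fun z => wirtD_eq_of_fderiv (hfv z)
  have hDbar : ∀ z, wirtDbar f z = planeSum w z := fun z => by
    rw [wirtDbar_eq_of_fderiv (hfv z)]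
    have h1 : ∀ n, w n * planeWave n z = (if n = 0 then w 0 else 0) +
        dbarSymbol n * ((dbarSymbol n)⁻¹ * w n) * planeWave n z := fun n => by
      by_cases hn : n = 0
      · subst hn
        simp [hdb0, planeWave]
      · have : dbarSymbol n ≠ 0 := norm_pos_iff.1 (zero_lt_one.trans_le (hdb n hn))
        rw [if_neg hn, zero_add, mul_inv_cancel_left₀ this]
    have h2 : planeSum w z = ∑' n, ((if n = 0 then w 0 else 0) +
        dbarSymbol n * ((dbarSymbol n)⁻¹ * w n) * planeWave n z) := tsum_congr h1
    rw [h2, (hasSum_ite_eq (0 : Fin 2 → ℤ) (w 0)).summable.tsum_add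
      (hc.dbarSymbol_mul.summable_mul_planeWave z), tsum_ite_eq]
    rfl
  refine ⟨f, ?_, fun z => ⟨?_, fun h0 => ?_⟩⟩
  · exact (contDiff_id.add (contDiff_const.mul Complex.conjCLE.contDiff)).add
      (contDiff_planeSum hc)
  · have hconv : RapidDecay fun n => ∑' j, m (n - j) * (dSymbol j / dbarSymbol j * w j) := by
      have : (fun n => ∑' j, m (n - j) * (dSymbol j / dbarSymbol j * w j)) =
          fun n => w n - m n := funext fun n => by rw [heq n]; ring
      rw [this]
      intro k
      refine ((hw k).add (hm k)).of_nonneg_of_le (fun _ => by positivity) fun n => ?_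
      rw [← mul_add]
      exact mul_le_mul_of_nonneg_left (norm_sub_le _ _) (by positivity)
    rw [hDbar, hD, mul_add, mul_one, planeSum_mul_planeSum hm hv]
    have h1 : planeSum w z = ∑' n, (m n * planeWave n z +
        (∑' j, m (n - j) * (dSymbol j / dbarSymbol j * w j)) * planeWave n z) :=
      tsum_congr fun n => by rw [← add_mul, ← heq n]
    rw [h1, (hm.summable_mul_planeWave z).tsum_add (hconv.summable_mul_planeWave z)]
    rfl
  -- `∂f - 1` has norm at most `Σ ‖w n‖ ≤ 1/2`.
  · rw [hD] at h0
    have h1 := norm_planeSum_le hv z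
    have h2 : ∑' n, ‖dSymbol n / dbarSymbol n * w n‖ ≤ ∑' n, ‖w n‖ :=
      hv.summable_norm.tsum_le_tsum (fun n => by
        rw [norm_mul]; exact mul_le_of_le_one_left (norm_nonneg _) (hS n)) hw.summable_norm
    rw [eq_neg_of_add_eq_zero_right h0, norm_neg, norm_one] at h1
    linarith

end PlaneSums

/-! ### Local solvability of the Beltrami equation. -/

section Beltrami

/-- `θ` extends `μ` to the plane. `χ` confines the dilated coefficient `μ (δ z)` to a disc inside
the unit square, where Fourier inversion applies. As `μ 0 = 0`, a small `δ` makes its coefficients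
summable to less than `1/3`; the solution is then dilated back. -/
theorem exists_beltrami_of_eq_zero {V : Set ℂ} (hV : IsOpen V) (h0 : (0 : ℂ) ∈ V) {μ : ℂ → ℂ}
    (hμ : ContDiffOn ℝ ∞ μ V) (hμ0 : μ 0 = 0) :
    ∃ f : ℂ → ℂ, ContDiff ℝ ∞ f ∧
      ∀ᶠ z in 𝓝 0, wirtDbar f z = μ z * wirtD f z ∧ wirtD f z ≠ 0 := by
  obtain ⟨θ, hθ, -, hθV, hθ1⟩ := exists_smooth_cutoff hV (isCompact_singleton (x := (0 : ℂ)))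
    (singleton_subset_iff.2 h0)
  obtain ⟨χ, hχ, hχc, hχs, hχ1⟩ := exists_smooth_cutoff (Metric.isOpen_ball (x := (0 : ℂ)) (ε := 1 / 4))
    (isCompact_closedBall (0 : ℂ) (1 / 8)) (Metric.closedBall_subset_ball (by norm_num))
  have hν := contDiff_mul_of_tsupport_subset hV hθ hθV hμ
  set ν : ℂ → ℂ := fun z => θ z * μ z
  obtain ⟨δ₀, hδ₀, hsmall⟩ := exists_tsum_norm_planeCoeff_lt hν (by simp [ν, hμ0]) hχ hχc
    (ε := 1 / 3) (by norm_num)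
  set δ : ℝ := δ₀ / 2
  have hδ : 0 < δ := by positivity
  have hδC : (δ : ℂ) ≠ 0 := Complex.ofReal_ne_zero.2 hδ.ne'
  set g : ℂ → ℂ := fun z => χ z * ν (δ * z) with hg
  have hgs : ContDiff ℝ ∞ g := hχ.mul (hν.comp (contDiff_const.mul contDiff_id))
  have hgc : HasCompactSupport g := hχc.mul_right
  have hRD := rapidDecay_planeCoeff hgs hgc
  obtain ⟨f, hf, hfb⟩ := exists_beltrami_of_tsum_lt hRD (hsmall δ hδ (half_lt_self hδ₀))
  have hgsum : ∀ z : ℂ, ‖z‖ ≤ 1 / 8 → planeSum (planeCoeff g) z = ν (δ * z) := fun z hz => by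
    have h1 := hasSum_planeCoeff_mul_planeWave hgs.continuous (r := 1 / 4) (by norm_num)
      (fun z hz => ?_) hRD.summable_norm.of_norm (z := z)
      ((Complex.abs_re_le_norm z).trans (by linarith))
      ((Complex.abs_im_le_norm z).trans (by linarith))
    · rw [planeSum, h1.tsum_eq, hg]
      dsimp only
      rw [(hχ1 z (mem_closedBall_zero_iff.2 hz)).self_of_nhds, one_mul]
    · have h2 : z ∉ tsupport χ := fun h => by
        have h3 := mem_ball_zero_iff.1 (hχs h)
        rcases hz with h4 | h4
        · linarith [Complex.abs_re_le_norm z]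
        · linarith [Complex.abs_im_le_norm z]
      simp [hg, image_eq_zero_of_notMem_tsupport h2]
  refine ⟨fun z => f ((δ : ℂ)⁻¹ * z), hf.comp (contDiff_const.mul contDiff_id), ?_⟩
  have hscale : ∀ z v, fderiv ℝ (fun z => f ((δ : ℂ)⁻¹ * z)) z v =
      (wirtD f ((δ : ℂ)⁻¹ * z) * (δ : ℂ)⁻¹) * v + (wirtDbar f ((δ : ℂ)⁻¹ * z) * (δ : ℂ)⁻¹) * conj v := by
    intro z v
    have h1 : HasFDerivAt (fun z : ℂ => (δ : ℂ)⁻¹ * z) _ z :=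
      (hasFDerivAt_id (𝕜 := ℝ) z).const_mul ((δ : ℂ)⁻¹)
    have h2 := (((hf.differentiable (by simp)) ((δ : ℂ)⁻¹ * z)).hasFDerivAt.comp z h1).fderiv
    have h3 := DFunLike.congr_fun h2 v
    refine h3.trans ?_
    rw [ContinuousLinearMap.comp_apply, fderiv_apply_eq_wirtD]
    simp
    ring
  have hnorm : ∀ᶠ z : ℂ in 𝓝 0, ‖(δ : ℂ)⁻¹ * z‖ < 1 / 8 := by
    have : Continuous fun z : ℂ => ‖(δ : ℂ)⁻¹ * z‖ := by fun_prop
    exact this.continuousAt.eventually_lt continuousAt_const (by simp)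
  filter_upwards [hnorm, hθ1 0 rfl] with z hz hθz
  have hb := hfb ((δ : ℂ)⁻¹ * z)
  rw [hgsum _ hz.le] at hb
  simp only [ν, mul_inv_cancel_left₀ hδC, hθz, one_mul] at hb
  rw [wirtDbar_eq_of_fderiv (hscale z), wirtD_eq_of_fderiv (hscale z), hb.1]
  exact ⟨by ring, mul_ne_zero hb.2 (inv_ne_zero hδC)⟩

/-- Local solvability of the Beltrami equation with smooth coefficient `|μ| < 1`. -/
theorem exists_beltrami {W : Set ℂ} (hW : IsOpen W) {z₀ : ℂ} (hz₀ : z₀ ∈ W) {μ : ℂ → ℂ}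
    (hμ : ContDiffOn ℝ ∞ μ W) (hμ1 : ‖μ z₀‖ < 1) :
    ∃ f : ℂ → ℂ, ContDiff ℝ ∞ f ∧
      ∀ᶠ z in 𝓝 z₀, wirtDbar f z = μ z * wirtD f z ∧ wirtD f z ≠ 0 := by
  set a : ℂ := μ z₀ with ha
  have ha1 : (1 : ℂ) - a * conj a ≠ 0 := by
    rw [Complex.mul_conj']
    norm_cast
    have := norm_nonneg a
    nlinarith
  set W' : Set ℂ := W ∩ (fun z => 1 - μ z * conj a) ⁻¹' {0}ᶜ with hW'
  have hs : ContDiffOn ℝ ∞ (fun z => 1 - μ z * conj a) W :=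
    contDiffOn_const.sub (hμ.mul contDiffOn_const)
  have hW'o : IsOpen W' := hs.continuousOn.isOpen_inter_preimage hW isClosed_singleton.isOpen_compl
  -- `A` is the inverse of the affine map `L` below, whose Beltrami coefficient is the constant `a =
  -- μ z₀`. For `h ∘ L` to have coefficient `μ`, `h` must have coefficient `(μ - a) / (1 - μ ā)` in
  -- the variable `L z`, and this vanishes at the base point.
  set A : ℂ → ℂ := fun ζ => z₀ + (ζ - a * conj ζ) / (1 - a * conj a) with hA
  have hAs : ContDiff ℝ ∞ A := contDiff_const.add
    ((contDiff_id.sub (contDiff_const.mul Complex.conjCLE.contDiff)).div_const _)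
  set L : ℂ → ℂ := fun z => (z - z₀) + a * conj (z - z₀) with hL
  have hLs : ContDiff ℝ ∞ L := (contDiff_id.sub contDiff_const).add
    (contDiff_const.mul (Complex.conjCLE.contDiff.comp (contDiff_id.sub contDiff_const)))
  have hAL : ∀ z, A (L z) = z := fun z => by
    simp only [hA, hL, map_add, map_mul, Complex.conj_conj]
    field_simp
    ring
  have hL0 : L z₀ = 0 := by simp [hL]
  have hA0 : A 0 = z₀ := by simp [hA]
  have hν : ContDiffOn ℝ ∞ (fun z => (μ z - a) / (1 - μ z * conj a)) W' := by
    simp only [div_eq_mul_inv]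
    exact ((hμ.sub contDiffOn_const).mono inter_subset_left).mul
      ((hs.mono inter_subset_left).inv fun z hz => hz.2)
  obtain ⟨h, hh, hhb⟩ := exists_beltrami_of_eq_zero (hW'o.preimage hAs.continuous)
    (by rw [mem_preimage, hA0]; exact ⟨hz₀, ha1⟩)
    (hν.comp hAs.contDiffOn fun _ hz => hz) (by simp [hA0, ← ha])
  refine ⟨fun z => h (L z), hh.comp hLs, ?_⟩
  have hfd : ∀ z v, fderiv ℝ (fun z => h (L z)) z v =
      (wirtD h (L z) + wirtDbar h (L z) * conj a) * v +
        (wirtD h (L z) * a + wirtDbar h (L z)) * conj v := fun z v => by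
    have h1 : HasFDerivAt L (ContinuousLinearMap.id ℝ ℂ +
        a • Complex.conjCLE.toContinuousLinearMap) z := by
      have h3 : HasFDerivAt (fun z => z - z₀) (ContinuousLinearMap.id ℝ ℂ) z :=
        (hasFDerivAt_id z).sub_const z₀
      exact h3.add ((Complex.conjCLE.hasFDerivAt.comp z h3).const_mul a)
    have h2 := (((hh.differentiable (by simp)) (L z)).hasFDerivAt.comp z h1).fderiv
    refine (DFunLike.congr_fun h2 v).trans ?_
    rw [ContinuousLinearMap.comp_apply, fderiv_apply_eq_wirtD]
    simp only [add_apply, smul_apply, ContinuousLinearMap.id_apply,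
      ContinuousLinearEquiv.coe_coe, Complex.conjCLE_apply, smul_eq_mul, map_add, map_mul,
      Complex.conj_conj]
    ring
  have hLt : Filter.Tendsto L (𝓝 z₀) (𝓝 0) := by
    have := hLs.continuous.tendsto z₀
    rwa [hL0] at this
  filter_upwards [hLt.eventually hhb, hW'o.mem_nhds ⟨hz₀, ha1⟩] with z hz hzW
  obtain ⟨hb, hne⟩ := hz
  have hden : 1 - μ z * conj a ≠ 0 := hzW.2
  rw [Function.comp_apply, hAL] at hb
  rw [wirtDbar_eq_of_fderiv (hfd z), wirtD_eq_of_fderiv (hfd z), hb]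
  constructor
  · field_simp
    ring
  · have : wirtD h (L z) + (μ z - a) / (1 - μ z * conj a) * wirtD h (L z) * conj a =
        wirtD h (L z) * (1 - a * conj a) / (1 - μ z * conj a) := by
      field_simp
      ring
    rw [this]
    exact div_ne_zero (mul_ne_zero hne ha1) hden

end Beltrami

/-! ### Isothermal coordinates from the Beltrami equation. -/

section Isothermal

open scoped RealInnerProductSpace

theorem det_comp_eq_mul (A B : ℂ →L[ℝ] ℂ) : (A.comp B).det = A.det * B.det :=
  LinearMap.det_comp _ _

/-- Normal form of a positive definite binary quadratic form. -/
theorem quadratic_eq_mul_normSq {E F G D x y : ℝ} (hD : D ^ 2 = E * G - F ^ 2)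
    (hpos : 0 < E + G + 2 * D) :
    E * x ^ 2 + 2 * F * x * y + G * y ^ 2 = (E + G + 2 * D) / 4 *
      ‖(x + y * Complex.I : ℂ) + ((E - G : ℝ) + (2 * F : ℝ) * Complex.I) / (E + G + 2 * D : ℝ) *
        conj (x + y * Complex.I : ℂ)‖ ^ 2 := by
  have h1 : (x + y * Complex.I : ℂ) + ((E - G : ℝ) + (2 * F : ℝ) * Complex.I) /
      (E + G + 2 * D : ℝ) * conj (x + y * Complex.I : ℂ) =
      ((x + ((E - G) * x + 2 * F * y) / (E + G + 2 * D) : ℝ) : ℂ) +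
      ((y + (2 * F * x - (E - G) * y) / (E + G + 2 * D) : ℝ) : ℂ) * Complex.I := by
    have hne : ((E + G + 2 * D : ℝ) : ℂ) ≠ 0 := Complex.ofReal_ne_zero.2 hpos.ne'
    push_cast at hne ⊢
    simp only [map_add, map_mul, Complex.conj_ofReal, Complex.conj_I]
    field_simp
    linear_combination (-2 * F * y : ℂ) * Complex.I_sq
  rw [h1, ← Complex.normSq_eq_norm_sq, Complex.normSq_add_mul_I]
  field_simp
  linear_combination -(4 * (x ^ 2 + y ^ 2)) * hD

theorem norm_sq_apply_eq {L : ℂ →L[ℝ] EuclideanSpace ℝ (Fin 4)} (u : ℂ) :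
    ‖L u‖ ^ 2 = ‖L 1‖ ^ 2 * u.re ^ 2 + 2 * ⟪L 1, L Complex.I⟫ * u.re * u.im +
      ‖L Complex.I‖ ^ 2 * u.im ^ 2 := by
  have h1 : L u = u.re • L 1 + u.im • L Complex.I := by
    rw [← map_smul, ← map_smul, ← map_add]
    congr 1
    simp [Complex.re_add_im]
  rw [h1, norm_add_sq_real, norm_smul, norm_smul, inner_smul_left, inner_smul_right, mul_pow,
    mul_pow, Real.norm_eq_abs, Real.norm_eq_abs, sq_abs, sq_abs]
  simp only [conj_trivial]
  ring

theorem gram_pos_of_injective {L : ℂ →L[ℝ] EuclideanSpace ℝ (Fin 4)} (hL : Function.Injective L) :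
    0 < ‖L 1‖ ^ 2 * ‖L Complex.I‖ ^ 2 - ⟪L 1, L Complex.I⟫ ^ 2 := by
  have h1 : 0 < ‖L 1‖ ^ 2 := by
    have : L 1 ≠ 0 := fun h => one_ne_zero (hL (h.trans (map_zero L).symm))
    positivity
  -- `L u` is `‖L 1‖²` times the component of `L i` orthogonal to `L 1`, so its squared norm is `‖L
  -- 1‖²` times the Gram determinant.
  set u : ℂ := ⟨-⟪L 1, L Complex.I⟫, ‖L 1‖ ^ 2⟩ with hu
  have hu0 : L u ≠ 0 := fun h => by
    have h2 := congrArg Complex.im (hL (h.trans (map_zero L).symm))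
    exact h1.ne' h2
  have h3 := norm_sq_apply_eq (L := L) u
  have h4 : 0 < ‖L u‖ ^ 2 := by positivity
  simp only [hu] at h3
  rw [← hu] at h3
  have h5 : 0 < ‖L 1‖ ^ 2 * (‖L 1‖ ^ 2 * ‖L Complex.I‖ ^ 2 - ⟪L 1, L Complex.I⟫ ^ 2) := by
    calc 0 < ‖L u‖ ^ 2 := h4
      _ = _ := by rw [h3]; ring
  exact (mul_pos_iff_of_pos_left h1).1 h5

theorem isConformalMap_of_norm_sq {L : ℂ →L[ℝ] EuclideanSpace ℝ (Fin 4)} {c : ℝ} (hc : 0 < c)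
    (hL : ∀ v, ‖L v‖ ^ 2 = c * ‖v‖ ^ 2) : IsConformalMap L := by
  have hs : 0 < √c := Real.sqrt_pos.2 hc
  refine ⟨√c, hs.ne', ⟨(√c)⁻¹ • (L : ℂ →ₗ[ℝ] EuclideanSpace ℝ (Fin 4)), fun v => ?_⟩, ?_⟩
  · have h1 : ‖L v‖ = √c * ‖v‖ := by
      rw [← abs_of_nonneg (norm_nonneg (L v)), ← abs_of_nonneg (mul_nonneg hs.le (norm_nonneg v)),
        ← sq_eq_sq_iff_abs_eq_abs, hL, mul_pow, Real.sq_sqrt hc.le]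
    rw [LinearMap.smul_apply, norm_smul, norm_inv, Real.norm_of_nonneg hs.le]
    change (√c)⁻¹ * ‖L v‖ = _
    rw [h1, inv_mul_cancel_left₀ hs.ne']
  · ext1 v
    change L v = √c • ((√c)⁻¹ • L v)
    rw [smul_inv_smul₀ hs.ne']

/-- Near a point where the differential is injective, the induced metric has the form
`λ |dz + μ dz̄|²` with smooth `|μ| < 1`. -/
theorem exists_beltrami_coefficient {V : Set ℂ} (hV : IsOpen V) {z₀ : ℂ} (hz₀ : z₀ ∈ V)
    {X : ℂ → EuclideanSpace ℝ (Fin 4)} (hX : ContDiffOn ℝ ∞ X V)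
    (hinj : Function.Injective (fderiv ℝ X z₀)) :
    ∃ (V' : Set ℂ) (μ : ℂ → ℂ) (l : ℂ → ℝ), IsOpen V' ∧ z₀ ∈ V' ∧ V' ⊆ V ∧ ContDiffOn ℝ ∞ μ V' ∧
      ∀ z ∈ V', ‖μ z‖ < 1 ∧ 0 < l z ∧ ∀ u, ‖fderiv ℝ X z u‖ ^ 2 = l z * ‖u + μ z * conj u‖ ^ 2 := by
  set E : ℂ → ℝ := fun z => ‖fderiv ℝ X z 1‖ ^ 2 with hE
  set G : ℂ → ℝ := fun z => ‖fderiv ℝ X z Complex.I‖ ^ 2 with hG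
  set F : ℂ → ℝ := fun z => ⟪fderiv ℝ X z 1, fderiv ℝ X z Complex.I⟫ with hF
  have h1 : ContDiffOn ℝ ∞ (fun z => fderiv ℝ X z 1) V := hX.fderiv_apply_const hV 1
  have h2 : ContDiffOn ℝ ∞ (fun z => fderiv ℝ X z Complex.I) V := hX.fderiv_apply_const hV _
  have hEs : ContDiffOn ℝ ∞ E V := h1.norm_sq ℝ
  have hGs : ContDiffOn ℝ ∞ G V := h2.norm_sq ℝ
  have hFs : ContDiffOn ℝ ∞ F V := h1.inner ℝ h2
  have hgs : ContDiffOn ℝ ∞ (fun z => E z * G z - F z ^ 2) V := (hEs.mul hGs).sub (hFs.pow 2)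
  set V' := V ∩ (fun z => E z * G z - F z ^ 2) ⁻¹' Ioi 0
  have hV'o : IsOpen V' := hgs.continuousOn.isOpen_inter_preimage hV isOpen_Ioi
  have hsub : V' ⊆ V := inter_subset_left
  set D : ℂ → ℝ := fun z => √(E z * G z - F z ^ 2) with hD
  have hDs : ContDiffOn ℝ ∞ D V' := (hgs.mono hsub).sqrt fun z hz => (ne_of_gt hz.2)
  have hDpos : ∀ z ∈ V', 0 < D z := fun z hz => Real.sqrt_pos.2 hz.2
  have hDsq : ∀ z ∈ V', D z ^ 2 = E z * G z - F z ^ 2 := fun z hz => Real.sq_sqrt (le_of_lt hz.2)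
  have hpos : ∀ z ∈ V', 0 < E z + G z + 2 * D z := fun z hz => by
    have h3 : 0 ≤ E z := sq_nonneg _
    have h4 : 0 ≤ G z := sq_nonneg _
    linarith [hDpos z hz]
  refine ⟨V', fun z => ((E z - G z : ℝ) + (2 * F z : ℝ) * Complex.I) / (E z + G z + 2 * D z : ℝ),
    fun z => (E z + G z + 2 * D z) / 4, hV'o, ⟨hz₀, gram_pos_of_injective hinj⟩, hsub, ?_,
    fun z hz => ⟨?_, ?_, fun u => ?_⟩⟩
  · have hof : ∀ {h : ℂ → ℝ}, ContDiffOn ℝ ∞ h V' → ContDiffOn ℝ ∞ (fun z => (h z : ℂ)) V' :=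
      fun hh => Complex.ofRealCLM.contDiff.comp_contDiffOn hh
    simp only [div_eq_mul_inv]
    exact ((hof ((hEs.sub hGs).mono hsub)).add ((hof (contDiffOn_const.mul (hFs.mono hsub))).mul
      contDiffOn_const)).mul ((hof (((hEs.add hGs).mono hsub).add
        (contDiffOn_const.mul hDs))).inv fun z hz => Complex.ofReal_ne_zero.2 (hpos z hz).ne')
  -- `(E - G)² + 4F² = (E + G)² - 4D²`, which is less than `(E + G + 2D)²`.
  · rw [norm_div, Complex.norm_real, Real.norm_of_nonneg (hpos z hz).le, div_lt_one (hpos z hz)]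
    refine lt_of_pow_lt_pow_left₀ 2 (hpos z hz).le ?_
    rw [← Complex.normSq_eq_norm_sq, Complex.normSq_add_mul_I]
    have h3 : 0 ≤ E z := sq_nonneg _
    have h4 : 0 ≤ G z := sq_nonneg _
    nlinarith [hDsq z hz, hDpos z hz, mul_nonneg (add_nonneg h3 h4) (hDpos z hz).le]
  · linarith [hpos z hz]
  · rw [norm_sq_apply_eq]
    have h3 := quadratic_eq_mul_normSq (x := u.re) (y := u.im) (hDsq z hz) (hpos z hz)
    rw [Complex.re_add_im] at h3
    exact h3

/-- A Beltrami solution `f` turns `l |dz + μ dz̄|²` into `l |∂f|⁻² |df|²` and has Jacobian `|∂f|² (1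
- |μ|²) > 0`. The local inverse of `f`, on a disc about `f z₀`, is the reparametrization; a disc is
convex, hence simply connected. -/
theorem exists_conformal_reparametrization {V : Set ℂ} (hV : IsOpen V) {z₀ : ℂ} (hz₀ : z₀ ∈ V)
    {X : ℂ → EuclideanSpace ℝ (Fin 4)} (hX : ContDiffOn ℝ ∞ X V)
    (hinj : Function.Injective (fderiv ℝ X z₀)) :
    ∃ (W : Set ℂ) (g : ℂ → ℂ), IsOpen W ∧ IsSimplyConnected W ∧ ContDiffOn ℝ ∞ g W ∧
      MapsTo g W V ∧ InjOn g W ∧ IsOpen (g '' W) ∧ z₀ ∈ g '' W ∧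
      ∀ z ∈ W, 0 < (fderiv ℝ g z).det ∧ ConformalAt (X ∘ g) z := by
  obtain ⟨V', μ, l, hV'o, hz₀', hV'V, hμ, hmetric⟩ := exists_beltrami_coefficient hV hz₀ hX hinj
  obtain ⟨f, hf, hfb⟩ := exists_beltrami hV'o hz₀' hμ (hmetric z₀ hz₀').1
  obtain ⟨N, hN, hNo, hz₀N⟩ := eventually_nhds_iff.1 (hfb.and (hV'o.mem_nhds hz₀'))
  have hdet : ∀ z ∈ N, 0 < (fderiv ℝ f z).det := fun z hz => by
    obtain ⟨⟨h1, h2⟩, h3⟩ := hN z hz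
    have h4 := (hmetric z h3).1
    have h5 : 0 < ‖wirtD f z‖ := norm_pos_iff.2 h2
    rw [det_fderiv_eq, h1, norm_mul, mul_pow]
    have h6 : ‖μ z‖ ^ 2 < 1 := by
      have := norm_nonneg (μ z)
      nlinarith
    have h7 : 0 < ‖wirtD f z‖ ^ 2 := by positivity
    nlinarith
  set f' : ∀ z ∈ N, ℂ ≃L[ℝ] ℂ := fun z hz =>
    (fderiv ℝ f z).toContinuousLinearEquivOfDetNeZero (hdet z hz).ne' with hf'
  have hfd : ∀ z (hz : z ∈ N), HasFDerivAt f (f' z hz : ℂ →L[ℝ] ℂ) z := fun z hz => by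
    rw [hf', ContinuousLinearMap.coe_toContinuousLinearEquivOfDetNeZero]
    exact (hf.differentiable (by simp) z).hasFDerivAt
  set e := hf.contDiffAt.toOpenPartialHomeomorph f (hfd z₀ hz₀N) (by simp) with he
  have hecoe : (e : ℂ → ℂ) = f := rfl
  have hz₀e : z₀ ∈ e.source := ContDiffAt.mem_toOpenPartialHomeomorph_source _ _ _
  have hfz₀ : f z₀ ∈ e.target := e.map_source hz₀e
  have hopen : IsOpen (e.target ∩ e.symm ⁻¹' N) := e.symm.isOpen_inter_preimage hNo
  have hleft : e.symm (f z₀) = z₀ := e.left_inv hz₀e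
  obtain ⟨ρ, hρ, hball⟩ := Metric.isOpen_iff.1 hopen (f z₀)
    ⟨hfz₀, by rwa [mem_preimage, hleft]⟩
  have hW : ∀ z ∈ Metric.ball (f z₀) ρ, z ∈ e.target := fun z hz => (hball hz).1
  have hgN : ∀ z ∈ Metric.ball (f z₀) ρ, e.symm z ∈ N := fun z hz => (hball hz).2
  have hgs : ∀ z ∈ Metric.ball (f z₀) ρ, ContDiffAt ℝ ∞ e.symm z := fun z hz =>
    e.contDiffAt_symm (hW z hz) (hfd _ (hgN z hz)) hf.contDiffAt
  have hcomp : ∀ z ∈ Metric.ball (f z₀) ρ, ∀ v,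
      fderiv ℝ f (e.symm z) (fderiv ℝ e.symm z v) = v := fun z hz v => by
    have h1 : f ∘ e.symm =ᶠ[𝓝 z] id := by
      filter_upwards [e.open_target.mem_nhds (hW z hz)] with w hw
      exact e.right_inv hw
    have h2 := h1.fderiv_eq (𝕜 := ℝ)
    rw [fderiv_comp z (hf.differentiable (by simp) _) ((hgs z hz).differentiableAt (by simp)),
      fderiv_id] at h2
    exact DFunLike.congr_fun h2 v
  refine ⟨Metric.ball (f z₀) ρ, e.symm, Metric.isOpen_ball, ?_,
    fun z hz => (hgs z hz).contDiffWithinAt, fun z hz => hV'V (hN _ (hgN z hz)).2,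
    e.symm.injOn.mono hW, e.symm.isOpen_image_of_subset_source Metric.isOpen_ball hW,
    ⟨f z₀, Metric.mem_ball_self hρ, hleft⟩, fun z hz => ⟨?_, ?_⟩⟩
  · have : ContractibleSpace (Metric.ball (f z₀) ρ) :=
      (convex_ball (f z₀) ρ).contractibleSpace ⟨f z₀, Metric.mem_ball_self hρ⟩
    exact inferInstanceAs (SimplyConnectedSpace (Metric.ball (f z₀) ρ))
  · have h1 : (fderiv ℝ f (e.symm z)).comp (fderiv ℝ e.symm z) = ContinuousLinearMap.id ℝ ℂ :=
      ContinuousLinearMap.ext (hcomp z hz)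
    have h2 : (fderiv ℝ f (e.symm z)).det * (fderiv ℝ e.symm z).det = 1 := by
      rw [← det_comp_eq_mul, h1]
      exact LinearMap.det_id
    exact (pos_iff_pos_of_mul_pos (by rw [h2]; exact one_pos)).1 (hdet _ (hgN z hz))
  · obtain ⟨⟨hb, hne⟩, hzV'⟩ := hN _ (hgN z hz)
    obtain ⟨-, hl, hq⟩ := hmetric _ hzV'
    have hXd : HasFDerivAt X (fderiv ℝ X (e.symm z)) (e.symm z) :=
      (hX.differentiableAt_of_mem hV (hV'V hzV')).hasFDerivAt
    refine ⟨_, hXd.comp z ((hgs z hz).differentiableAt (by simp)).hasFDerivAt,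
      isConformalMap_of_norm_sq (c := l (e.symm z) / ‖wirtD f (e.symm z)‖ ^ 2) ?_ fun v => ?_⟩
    · have := norm_pos_iff.2 hne
      positivity
    · rw [ContinuousLinearMap.comp_apply, hq]
      set u := fderiv ℝ e.symm z v with hu
      have h1 : v = wirtD f (e.symm z) * (u + μ (e.symm z) * conj u) := by
        have h2 := hcomp z hz v
        rw [fderiv_apply_eq_wirtD, hb] at h2
        rw [← h2]; ring
      have h3 : ‖v‖ ^ 2 = ‖wirtD f (e.symm z)‖ ^ 2 * ‖u + μ (e.symm z) * conj u‖ ^ 2 := by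
        rw [← mul_pow, ← norm_mul, ← h1]
      have := norm_pos_iff.2 hne
      rw [h3]
      field_simp

end Isothermal

/-! ### Conformal parameters on the surface. -/

section ConformalParameters

/-- The derivative defaults to `0` at points of nondifferentiability, so a positive Jacobian entails
differentiability. This makes the chain rule available for the transition maps of an oriented atlas.
-/
theorem differentiableAt_of_det_pos {f : ℂ → ℂ} {z : ℂ} (h : 0 < (fderiv ℝ f z).det) :
    DifferentiableAt ℝ f z := by
  by_contra hf
  have h0 : (fderiv ℝ f z).det = ‖(0 : ℂ)‖ ^ 2 - ‖(0 : ℂ)‖ ^ 2 :=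
    det_of_apply_eq fun v => by simp [fderiv_zero_of_not_differentiableAt hf]
  simp [h0] at h

theorem exists_isConformalParameter {S : Type*} [TopologicalSpace S] [ChartedSpace ℂ S]
    [IsManifold 𝓘(ℝ, ℂ) ∞ S] (horient : IsOrientedAtlas S) {r : S → EuclideanSpace ℝ (Fin 4)}
    (hr : ContMDiff 𝓘(ℝ, ℂ) 𝓘(ℝ, EuclideanSpace ℝ (Fin 4)) ∞ r) (p : S)
    (himm : Function.Injective (mfderiv 𝓘(ℝ, ℂ) 𝓘(ℝ, EuclideanSpace ℝ (Fin 4)) r p)) :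
    ∃ (W : Set ℂ) (σ : ℂ → S), IsConformalParameter r W σ ∧ IsSimplyConnected W ∧
        InjOn σ W ∧ IsOpen (σ '' W) ∧ p ∈ σ '' W := by
  set e := chartAt ℂ p with he
  have heA : e ∈ atlas ℂ S := chart_mem_atlas ℂ p
  have hp : p ∈ e.source := mem_chart_source ℂ p
  have hes : ContMDiffOn 𝓘(ℝ, ℂ) 𝓘(ℝ, ℂ) ∞ e.symm e.target := contMDiffOn_chart_symm
  have hX : ContDiffOn ℝ ∞ (r ∘ e.symm) e.target :=
    contMDiffOn_iff_contDiffOn.1 (hr.comp_contMDiffOn hes)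
  have hinj : Function.Injective (fderiv ℝ (r ∘ e.symm) (e p)) := by
    have h1 : mfderiv 𝓘(ℝ, ℂ) 𝓘(ℝ, EuclideanSpace ℝ (Fin 4)) r p =
        fderiv ℝ (r ∘ e.symm) (e p) := by
      refine (hr.mdifferentiableAt (by simp)).mfderiv.trans ?_
      simp only [writtenInExtChartAt, extChartAt, chartAt_self_eq, mfld_simps, fderivWithin_univ]
      rfl
    rwa [h1] at himm
  obtain ⟨W, g, hWo, hWs, hg, hgm, hgi, hgo, hgp, hgc⟩ :=
    exists_conformal_reparametrization e.open_target (e.map_source hp) hX hinj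
  refine ⟨W, e.symm ∘ g, ⟨hWo, hes.comp hg.contMDiffOn hgm, fun z hz e' he' hze' => ?_,
    fun z hz => (hgc z hz).2⟩, hWs, e.symm.injOn.comp hgi hgm, ?_, ?_⟩
  · have h1 := horient e heA e' he' (g z) (by
      rw [OpenPartialHomeomorph.trans_source]; exact ⟨hgm hz, hze'⟩)
    have h2 : e' ∘ (e.symm ∘ g) = (e.symm.trans e') ∘ g := rfl
    rw [h2, fderiv_comp z (differentiableAt_of_det_pos h1) (hg.differentiableAt_of_mem hWo hz),
      det_comp_eq_mul]
    exact mul_pos h1 (hgc z hz).1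
  · rw [image_comp]
    exact e.symm.isOpen_image_of_subset_source hgo hgm.image_subset
  · rw [image_comp]
    exact ⟨e p, hgp, e.left_inv hp⟩

end ConformalParameters

theorem mainTheorem2 {S : Type*} [TopologicalSpace S] [ChartedSpace ℂ S]
    [IsManifold 𝓘(ℝ, ℂ) ∞ S] (horient : IsOrientedAtlas S)
    (r : S → EuclideanSpace ℝ (Fin 4))
    (hr : ContMDiff 𝓘(ℝ, ℂ) 𝓘(ℝ, EuclideanSpace ℝ (Fin 4)) ∞ r)
    (himm : ∀ p : S, Function.Injective
      (mfderiv 𝓘(ℝ, ℂ) 𝓘(ℝ, EuclideanSpace ℝ (Fin 4)) r p)) :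
    (∀ p : S, ∃ (W : Set ℂ) (σ : ℂ → S), IsConformalParameter r W σ ∧ IsSimplyConnected W ∧
        InjOn σ W ∧ IsOpen (σ '' W) ∧ p ∈ σ '' W) ∧
    (∀ (W : Set ℂ) (σ : ℂ → S), IsConformalParameter r W σ →
      ∃ (ψ φ : ℂ → Fin 2 → ℂ) (U : ℂ → ℂ),
        IsWeierstrassRepresentation W (r ∘ σ) ψ φ U ∧
        (∀ z ∈ W, conformalFactor (r ∘ σ) z =
          (‖ψ z 0‖ ^ 2 + ‖ψ z 1‖ ^ 2) * (‖φ z 0‖ ^ 2 + ‖φ z 1‖ ^ 2)) ∧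
        (∀ z ∈ W, ‖U z‖ =
          ‖meanCurvatureVector (r ∘ σ) z‖ * Real.sqrt (conformalFactor (r ∘ σ) z) / 2)) := by
  refine ⟨fun p => exists_isConformalParameter horient hr p (himm p), fun W σ hσ => ?_⟩
  exact exists_weierstrassRepresentation hσ.isOpen
    (contMDiffOn_iff_contDiffOn.1 (hr.comp_contMDiffOn hσ.smooth)) hσ.conformal
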